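/- Notation. Let $\mathbb{L}^3,\mathbb{L}^4=\mathbb{L}^3\times\mathbb{R}$ be Minkowski spaces with metric $\langle\,,\rangle$ of signature $(-,+,+)$, resp. $(-,+,+,+)$, extended complex bilinearly; $\mathbb{H}^2=\{x\in\mathbb{L}^3:\langle x,x\rangle=-1,\ x_0>0\}$, so that $\mathbb{H}^2\times\mathbb{R}\subset\mathbb{L}^4$. Let $\Sigma$ be an open (i.e. non-compact) simply connected Riemann surface; $z$ denotes an arbitrary conformal parameter. A smooth map $G:\Sigma\to\mathbb{H}^2$ is harmonic if $G_{z\bar z}=\langle G_z,G_{\bar z}\rangle G$. A harmonic map $G$ has Weierstrass data $\{Q_0\,dz^2,\tau_0|dz|^2\}$ if $Q_0\,dz^2=\langle G_z,G_z\rangle dz^2$ is its Hopf differential, $\tau_0|dz|^2$ is a smooth conformal metric ($\tau_0>0$), and $$\langle dG,dG\rangle=Q_0\,dz^2+\Big(\frac{\tau_0}{4}+\frac{4|Q_0|^2}{\tau_0}\Big)|dz|^2+\overline{Q_0}\,d\bar z^2 .$$ A point is regular for $G$ if $dG$ is injective there, and singular otherwise. For a smooth conformal immersion $\psi=(N,h):\Sigma\to\mathbb{H}^2\times\mathbb{R}$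 with $\langle d\psi,d\psi\rangle=\lambda|dz|^2$ and regular vertical projection $N$ (i.e. $dN$ is an isomorphism at every point), let $\eta=(\hat N,u)$ be its smooth unit normal in $\mathbb{H}^2\times\mathbb{R}$ with positive last coordinate $u$ (the angle function); the mean curvature $H$ is half the trace of $-\langle d\psi,d\eta\rangle$ with respect to $\langle d\psi,d\psi\rangle$, and the hyperbolic Gauss map of $\psi$ is the map $G:\Sigma\to\mathbb{H}^2$ with $\frac1u(\eta+(N,0))=(G,1)$. A mean curvature one half surface is such a $\psi$ with $H\equiv 1/2$. Theorem. Let $G:\Sigma\to\mathbb{H}^2$ be a harmonic map from an open simply connected Riemann surface, admitting Weierstrass data $\{-Q\,dz^2,2\tau|dz|^2\}$. Assume that the set of singular points of $G$ has empty interior. Let $z_0\in\Sigma$ be a regular point of $G$, fix a conformal parameter around $z_0$, and let $\vartheta_0\in\mathbb{C}$. Then there is a mean curvature one half surface $\psi=(N,h):\Sigma\to\mathbb{H}^2\times\mathbb{R}$, unique up to vertical translations, such that (i) $G$ is the hyperbolic Gauss map of $\psi$; (ii) $\tau=\lambda u^2/2$; (iii) $h_z(z_0)=\vartheta_0$ (in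 the fixed parameter). Moreover, $h$ is the unique (up to additive constants) solution $h:\Sigma\to\mathbb{R}$ of class $C^2$ of $$h_{zz}=(\log\tau)_z\,h_z+Q\sqrt{\frac{\tau+2|h_z|^2}{\tau}},\qquad h_{z\bar z}=\frac12\sqrt{\tau\,(\tau+2|h_z|^2)}$$ with $h_z(z_0)=\vartheta_0$, and $$N=\frac{4\,\mathrm{Re}\big(G_z(2\overline{Q}h_z+\tau h_{\bar z})\big)}{\tau^2-4|Q|^2}+G\sqrt{\frac{\tau+2|h_z|^2}{\tau}}$$ at every regular point of $G$ (where $\tau^2-4|Q|^2\neq0$), the regular points are dense, and at every point of $\Sigma$ the value of $N$ is the limit of the right-hand side along the regular points of $G$. -/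

import Mathlib

open Set Filter Topology Manifold
open scoped ContDiff Manifold Topology

noncomputable section

/-- The Lorentzian scalar product `-x₀y₀ + x₁y₁ + x₂y₂` on `𝕃³` (`R = ℝ`) and its complex bilinear
extension (`R = ℂ`). -/
def lorentz3 {R : Type*} [CommRing R] (x y : Fin 3 → R) : R :=
  -(x 0 * y 0) + x 1 * y 1 + x 2 * y 2

/-- The Minkowski space `𝕃⁴`, split as `𝕃³ × ℝ`. -/
abbrev Mink4 : Type := (Fin 3 → ℝ) × ℝ

/-- The Lorentzian scalar product of `𝕃⁴ = 𝕃³ × ℝ`. -/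
def lorentz4 (x y : Mink4) : ℝ := lorentz3 x.1 y.1 + x.2 * y.2

/-- The hyperbolic plane, as the upper sheet of the hyperboloid in `𝕃³`. -/
def hypPlane : Set (Fin 3 → ℝ) := {x | lorentz3 x x = -1 ∧ 0 < x 0}

/-- Wirtinger derivative `∂f/∂z`. -/
def dz (f : ℂ → ℂ) (w : ℂ) : ℂ :=
  (fderiv ℝ f w 1 - Complex.I * fderiv ℝ f w Complex.I) / 2

/-- Wirtinger derivative `∂f/∂z̄`. -/
def dzbar (f : ℂ → ℂ) (w : ℂ) : ℂ :=
  (fderiv ℝ f w 1 + Complex.I * fderiv ℝ f w Complex.I) / 2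

/-- The (local) conformal parameters of a Riemann surface `S`: the charts of its maximal
holomorphic atlas. -/
def conformalParams (S : Type*) [TopologicalSpace S] [ChartedSpace ℂ S] :
    Set (OpenPartialHomeomorph S ℂ) :=
  IsManifold.maximalAtlas (modelWithCornersSelf ℂ ℂ) ω S

section Surface

variable {S : Type*} [TopologicalSpace S]

/-- A real function on `S`, read in the parameter `e` as a complex valued function. -/
def inParam (e : OpenPartialHomeomorph S ℂ) (f : S → ℝ) : ℂ → ℂ :=
  fun w => (f (e.symm w) : ℂ)

/-- `F_z` in the parameter `e`, for a map `F : S → 𝕃³`; a vector of `ℂ³`. -/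
def vecDz (e : OpenPartialHomeomorph S ℂ) (F : S → Fin 3 → ℝ) (w : ℂ) : Fin 3 → ℂ :=
  fun i => dz (inParam e fun x => F x i) w

/-- `F_z̄` in the parameter `e`, for a map `F : S → 𝕃³`. -/
def vecDzbar (e : OpenPartialHomeomorph S ℂ) (F : S → Fin 3 → ℝ) (w : ℂ) : Fin 3 → ℂ :=
  fun i => dzbar (inParam e fun x => F x i) w

/-- First fundamental form `⟨dψ(v), dψ(v')⟩` of `ψ : S → 𝕃⁴` in the parameter `e`, where
`v = a + i b` stands for the vector `a ∂ₛ + b ∂ₜ`, `z = s + i t`. -/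
def firstForm (e : OpenPartialHomeomorph S ℂ) (ψ : S → Mink4) (w v v' : ℂ) : ℝ :=
  lorentz4 (fderiv ℝ (fun y => ψ (e.symm y)) w v) (fderiv ℝ (fun y => ψ (e.symm y)) w v')

/-- Second fundamental form `-⟨dψ(v), dη(v')⟩` of `ψ` with respect to the unit normal `η`, in the
parameter `e`. -/
def secondForm (e : OpenPartialHomeomorph S ℂ) (ψ η : S → Mink4) (w v v' : ℂ) : ℝ :=
  -lorentz4 (fderiv ℝ (fun y => ψ (e.symm y)) w v) (fderiv ℝ (fun y => η (e.symm y)) w v')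

/-- Mean curvature: half the trace of the second fundamental form with respect to the first one. -/
def meanCurvature (e : OpenPartialHomeomorph S ℂ) (ψ η : S → Mink4) (w : ℂ) : ℝ :=
  (firstForm e ψ w 1 1 * secondForm e ψ η w Complex.I Complex.I
      - firstForm e ψ w 1 Complex.I
        * (secondForm e ψ η w 1 Complex.I + secondForm e ψ η w Complex.I 1)
      + firstForm e ψ w Complex.I Complex.I * secondForm e ψ η w 1 1)
    / (2 * (firstForm e ψ w 1 1 * firstForm e ψ w Complex.I Complex.I
      - firstForm e ψ w 1 Complex.I ^ 2))

/-- The factor `λ` of the metric `⟨dψ, dψ⟩ = λ |dz|²` of a conformal map `ψ` in the parameter `e`. -/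
def conformalFactor (e : OpenPartialHomeomorph S ℂ) (ψ : S → Mink4) (w : ℂ) : ℝ :=
  firstForm e ψ w 1 1

variable [ChartedSpace ℂ S]

/-- `x` is a regular point of `F`: `dF` is injective at `x`. (For a map into the two-dimensional
`hypPlane` this says that `dF` is a linear isomorphism onto the tangent plane.) -/
def IsRegularPt (F : S → Fin 3 → ℝ) (x : S) : Prop :=
  Function.Injective
    (mfderiv (modelWithCornersSelf ℝ ℂ) (modelWithCornersSelf ℝ (Fin 3 → ℝ)) F x)

/-- `F : S → ℍ² ⊂ 𝕃³` is a (smooth) harmonic map: the part of `F_{z z̄}` tangent to `ℍ²` vanishes,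
that is, `F_{z z̄} = ⟨F_z, F_z̄⟩ F`. -/
structure IsHarmonicMap (F : S → Fin 3 → ℝ) : Prop where
  smooth : ContMDiff (modelWithCornersSelf ℝ ℂ) (modelWithCornersSelf ℝ (Fin 3 → ℝ)) ∞ F
  mem_hypPlane : ∀ x, F x ∈ hypPlane
  harmonic : ∀ e ∈ conformalParams S, ∀ w ∈ e.target, ∀ i,
    dzbar (fun y => vecDz e F y i) w
      = lorentz3 (vecDz e F w) (vecDzbar e F w) * (F (e.symm w) i : ℂ)

/-- `τ |dz|²` is a smooth conformal metric on `S`; it is given by its coefficient `τ e`, a function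
on `e.target`, in every conformal parameter `e`. -/
structure IsConformalMetric (τ : OpenPartialHomeomorph S ℂ → ℂ → ℝ) : Prop where
  smooth : ∀ e ∈ conformalParams S, ContDiffOn ℝ ∞ (τ e) e.target
  pos : ∀ e ∈ conformalParams S, ∀ w ∈ e.target, 0 < τ e w
  transform : ∀ e ∈ conformalParams S, ∀ e' ∈ conformalParams S,
    ∀ x ∈ e.source ∩ e'.source,
      τ e (e x) = τ e' (e' x) * ‖deriv (fun y => e' (e.symm y)) (e x)‖ ^ 2

/-- `{Q₀ dz², τ₀ |dz|²}` are Weierstrass data of `G`: `Q₀ dz²` is the Hopf differential of `G`,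
`τ₀ |dz|²` is a smooth conformal metric and
`⟨dG, dG⟩ = Q₀ dz² + (τ₀/4 + 4|Q₀|²/τ₀) |dz|² + conj(Q₀) dz̄²`. -/
structure IsWeierstrassData (G : S → Fin 3 → ℝ) (Q₀ : OpenPartialHomeomorph S ℂ → ℂ → ℂ)
    (τ₀ : OpenPartialHomeomorph S ℂ → ℂ → ℝ) : Prop where
  hopf : ∀ e ∈ conformalParams S, ∀ w ∈ e.target,
    Q₀ e w = lorentz3 (vecDz e G w) (vecDz e G w)
  isConformalMetric : IsConformalMetric τ₀
  metric : ∀ e ∈ conformalParams S, ∀ w ∈ e.target, ∀ v : ℂ,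
    lorentz3 (fderiv ℝ (fun y => G (e.symm y)) w v) (fderiv ℝ (fun y => G (e.symm y)) w v)
      = 2 * (Q₀ e w * v ^ 2).re + (τ₀ e w / 4 + 4 * ‖Q₀ e w‖ ^ 2 / τ₀ e w) * ‖v‖ ^ 2

/-- `ψ = (N, h) : S → ℍ² × ℝ` is a conformal immersion with regular vertical projection `N`, and
`η` is its canonically oriented unit normal, i.e. the one whose angle function `u = η₃` is
positive. -/
structure IsSurfaceWithNormal (ψ η : S → Mink4) : Prop where
  smooth : ContMDiff (modelWithCornersSelf ℝ ℂ) (modelWithCornersSelf ℝ Mink4) ∞ ψ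
  mem_hypPlane : ∀ x, (ψ x).1 ∈ hypPlane
  factor_pos : ∀ e ∈ conformalParams S, ∀ w ∈ e.target, 0 < conformalFactor e ψ w
  conformal : ∀ e ∈ conformalParams S, ∀ w ∈ e.target, ∀ v : ℂ,
    firstForm e ψ w v v = conformalFactor e ψ w * ‖v‖ ^ 2
  regular_projection : ∀ x, IsRegularPt (fun y => (ψ y).1) x
  normal_smooth : ContMDiff (modelWithCornersSelf ℝ ℂ) (modelWithCornersSelf ℝ Mink4) ∞ η
  normal_unit : ∀ x, lorentz4 (η x) (η x) = 1
  normal_tangent_ambient : ∀ x, lorentz4 (η x) ((ψ x).1, 0) = 0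
  normal_orth : ∀ e ∈ conformalParams S, ∀ w ∈ e.target, ∀ v : ℂ,
    lorentz4 (η (e.symm w)) (fderiv ℝ (fun y => ψ (e.symm y)) w v) = 0
  angle_pos : ∀ x, 0 < (η x).2

/-- The surface `ψ` with unit normal `η` has constant mean curvature `1/2`. -/
def HasMeanCurvatureHalf (ψ η : S → Mink4) : Prop :=
  ∀ e ∈ conformalParams S, ∀ w ∈ e.target, meanCurvature e ψ η w = 1 / 2

/-- `G` is the hyperbolic Gauss map of the surface `ψ = (N, h)` with unit normal `η = (N̂, u)`:
`(1/u) (η + N) = (G, 1)`. -/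
def IsHyperbolicGaussMap (ψ η : S → Mink4) (G : S → Fin 3 → ℝ) : Prop :=
  ∀ x, (1 / (η x).2) • (η x + ((ψ x).1, 0)) = (G x, 1)

/-- `ψ` is a mean curvature one half surface with hyperbolic Gauss map `G`, with
`τ = λ u² / 2`, and with `h_z = ϑ₀` at `z₀` in the parameter `e₀`. -/
def IsPrescribedSurface (G : S → Fin 3 → ℝ) (τ : OpenPartialHomeomorph S ℂ → ℂ → ℝ)
    (e₀ : OpenPartialHomeomorph S ℂ) (z₀ : S) (ϑ₀ : ℂ) (ψ : S → Mink4) : Prop :=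
  ∃ η : S → Mink4, IsSurfaceWithNormal ψ η ∧ HasMeanCurvatureHalf ψ η ∧
    IsHyperbolicGaussMap ψ η G ∧
    (∀ e ∈ conformalParams S, ∀ w ∈ e.target,
      τ e w = conformalFactor e ψ w * (η (e.symm w)).2 ^ 2 / 2) ∧
    dz (inParam e₀ fun x => (ψ x).2) (e₀ z₀) = ϑ₀

/-- `h` is a (`C²`) solution of the system
`h_zz = (log τ)_z h_z + Q √((τ + 2|h_z|²)/τ)`, `h_{z z̄} = (1/2) √(τ (τ + 2|h_z|²))`. -/
structure SolvesHeightSystem (Q : OpenPartialHomeomorph S ℂ → ℂ → ℂ)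
    (τ : OpenPartialHomeomorph S ℂ → ℂ → ℝ) (h : S → ℝ) : Prop where
  contMDiff : ContMDiff (modelWithCornersSelf ℝ ℂ) (modelWithCornersSelf ℝ ℝ) 2 h
  eq_zz : ∀ e ∈ conformalParams S, ∀ w ∈ e.target,
    dz (dz (inParam e h)) w
      = dz (fun y => (Real.log (τ e y) : ℂ)) w * dz (inParam e h) w
        + Q e w * (Real.sqrt ((τ e w + 2 * ‖dz (inParam e h) w‖ ^ 2) / τ e w) : ℂ)
  eq_zzbar : ∀ e ∈ conformalParams S, ∀ w ∈ e.target,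
    dzbar (dz (inParam e h)) w
      = ((1 / 2 * Real.sqrt (τ e w * (τ e w + 2 * ‖dz (inParam e h) w‖ ^ 2)) : ℝ) : ℂ)

end Surface

/-- The vector
`4 Re(G_z (2 conj(Q) h_z + τ h_z̄)) / (τ² - 4|Q|²) + √((τ + 2|h_z|²)/τ) G` of `𝕃³` at the point `x`,
computed in the parameter `e`. (A genuine quotient only where `τ² ≠ 4|Q|²`.) -/
def representedProjection {S : Type*} [TopologicalSpace S] (G : S → Fin 3 → ℝ)
    (Q : OpenPartialHomeomorph S ℂ → ℂ → ℂ) (τ : OpenPartialHomeomorph S ℂ → ℂ → ℝ) (h : S → ℝ)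
    (e : OpenPartialHomeomorph S ℂ) (x : S) : Fin 3 → ℝ :=
  fun i =>
    4 * (vecDz e G (e x) i * (2 * (starRingEnd ℂ) (Q e (e x)) * dz (inParam e h) (e x)
          + (τ e (e x) : ℂ) * dzbar (inParam e h) (e x))).re
        / (τ e (e x) ^ 2 - 4 * ‖Q e (e x)‖ ^ 2)
      + G x i * Real.sqrt ((τ e (e x) + 2 * ‖dz (inParam e h) (e x)‖ ^ 2) / τ e (e x))

end

/-! Write `q = ⟨G_z, G_z⟩ = -Q`. The complexified tangent plane of ℍ² at `G` has two isotropic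
lines, and `G_z` splits as `P + P'` along them, with `P = (G_z - j G × G_z) / 2` and `j = ± i`. The
squared lengths `A = ⟨P, P̄⟩` and `A' = ⟨P', P̄'⟩` have sum `τ/4 + |Q|²/τ` (from the metric) and
product `|Q|²/4`, so they are `τ/4` and `|Q|²/τ` in some order. Harmonicity becomes `P_z̄ = A G`,
and it implies the Bochner formula `(log A)_{zz̄} = A - |q|²/(4A)`.

One sign `j` has to give `A = τ/4` on all of the surface (`exists_isoNorm_eq`). At a regular point
`τ ≠ 2|Q|`, the two candidates differ and the choice is locally constant. Singular points might
separate the surface. There the function `d = log A - log (τ/4)` satisfies `|d_{zz̄}| ≤ C |d|`,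
because `τ` obeys the same Bochner equation by density of the regular points. A Carleman argument
with the weights `(z - c)⁻ⁿ` shows that such a `d`, vanishing on an open set that accumulates at
`c`, vanishes near `c`. The locus of `A = τ/4` is therefore open and closed.

With `s = -⟨N, G⟩ = 1/u`, the required surfaces `ψ = (N, h)` are the solutions with `N` in ℍ² of the
real linear system `N_z = 2⟨N, P⟩ G - 2⟨N, G⟩ P`, `h_z = 2⟨N, P⟩`. Its integrability is a
consequence of harmonicity (`theta_flat`), so a Frobenius theorem and monodromy on the simply
connected surface give a global solution with any initial value. The system preserves `⟨N, N⟩`. From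
`N_z = h_z G + 2 s P` one reads `⟨ψ_z, ψ_z⟩ = 0`, `⟨ψ_z, ψ_z̄⟩ = 4 s² A` and `⟨ψ_z, η_z̄⟩ = -2 s²
A`; hence `ψ` is conformal, `H = 1/2` and `λ u²/2 = 4A = τ`. Differentiating `h_z = 2⟨N, P⟩` gives
the height system.

Uniqueness reduces everything to the linear system. A surface with the prescribed data satisfies it
at the regular points (`IsLocalPrescribed.vdz_fst_of_ne`), hence everywhere by continuity. A
solution of the height system yields a solution of it when `N` is rebuilt algebraically from `h_z`
(`recon`, `IsLocalHarmonic.hasFDerivAt_theta_of_height`). In both cases `h_z(z₀)` determines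
`N(z₀)`, and the system does not involve the value of `h`, so only a vertical translation is free.
Expressing `P` through `G_z` and its conjugate turns the reconstruction into the stated quotient
(`IsLocalHarmonic.recon_eq_quotient`). -/

noncomputable section

/-! ### Frobenius theorem for linear systems -/

section Frobenius

set_option maxSynthPendingDepth 3

variable {E F : Type*} [NormedAddCommGroup E] [NormedSpace ℝ E]
  [NormedAddCommGroup F] [NormedSpace ℝ F]

/-- Second order Taylor estimate for a map with Lipschitz derivative on a convex set. -/
theorem norm_sub_sub_fderiv_le_of_lipschitz {s : Set E} (hs : Convex ℝ s) {f : E → F} {L : ℝ}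
    (hd : ∀ w ∈ s, DifferentiableAt ℝ f w) (hL0 : 0 ≤ L)
    (hL : ∀ w ∈ s, ∀ w' ∈ s, ‖fderiv ℝ f w - fderiv ℝ f w'‖ ≤ L * ‖w - w'‖)
    {w k : E} (hw : w ∈ s) (hwk : w + k ∈ s) :
    ‖f (w + k) - f w - fderiv ℝ f w k‖ ≤ L * ‖k‖ ^ 2 := by
  have hseg : segment ℝ w (w + k) ⊆ s := hs.segment_subset hw hwk
  have key := (convex_segment (𝕜 := ℝ) w (w + k)).norm_image_sub_le_of_norm_fderiv_le'
    (f := f) (C := L * ‖k‖) (φ := fderiv ℝ f w) (fun x hx => hd x (hseg hx)) ?_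
    (left_mem_segment ℝ w (w + k)) (right_mem_segment ℝ w (w + k))
  · simpa [add_sub_cancel_left, pow_two, mul_assoc] using key
  · intro x hx
    refine (hL x (hseg hx) w hw).trans ?_
    have : ‖x - w‖ ≤ ‖k‖ := by
      obtain ⟨t, ht, rfl⟩ := (segment_eq_image' ℝ w (w + k)).subset hx
      simp only [add_sub_cancel_left, norm_smul, Real.norm_eq_abs, abs_of_nonneg ht.1]
      exact mul_le_of_le_one_left (norm_nonneg _) ht.2
    gcongr

/-- Solvability of a linear equation on `[0, 1]` with small coefficients. -/
theorem exists_linear_ode_solution [CompleteSpace F] (M : ℝ → F →L[ℝ] F)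
    (hM : ContinuousOn M (Icc 0 1)) (hb : ∀ t ∈ Icc (0 : ℝ) 1, ‖M t‖ ≤ 1 / 2) (y₀ : F) :
    ∃ y : ℝ → F, y 0 = y₀ ∧
      ∀ t ∈ Icc (0 : ℝ) 1, HasDerivWithinAt y (M t (y t)) (Icc 0 1) t := by
  have h01 : (0 : ℝ) ∈ Icc (0 : ℝ) 1 := by simp
  -- The number `‖y₀‖ + 1` serves both as radius and as speed bound: in that ball `‖y‖ ≤ 2‖y₀‖ + 1`,
  -- and halving keeps the speed below the radius. Thus unit time is admissible without shrinking.
  have hPL : IsPicardLindelof (fun t y => M t y) (tmin := 0) (tmax := 1) ⟨0, h01⟩ y₀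
      (‖y₀‖₊ + 1) 0 (‖y₀‖₊ + 1) 1 := by
    refine ⟨fun t ht => ?_, fun x _ => ?_, fun t ht x hx => ?_, ?_⟩
    · refine LipschitzOnWith.of_dist_le_mul fun x _ y _ => ?_
      rw [dist_eq_norm, dist_eq_norm, ← map_sub]
      refine ((M t).le_opNorm _).trans ?_
      have := hb t ht
      push_cast
      gcongr
      linarith
    · exact hM.clm_apply continuousOn_const
    · have hx' : ‖x‖ ≤ 2 * ‖y₀‖ + 1 := by
        have : ‖x - y₀‖ ≤ ‖y₀‖ + 1 := by simpa [dist_eq_norm] using hx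
        calc ‖x‖ = ‖(x - y₀) + y₀‖ := by simp
          _ ≤ ‖x - y₀‖ + ‖y₀‖ := norm_add_le _ _
          _ ≤ _ := by linarith
      have h1 := (M t).le_of_opNorm_le (hb t ht) x
      simp only [NNReal.coe_add, coe_nnnorm, NNReal.coe_one]
      linarith
    · simp
  obtain ⟨y, hy0, hy⟩ := hPL.exists_eq_forall_mem_Icc_hasDerivWithinAt₀
  exact ⟨y, hy0, hy⟩

/-- A vector valued function on an interval with right derivative, from a derivative within the
interval. -/
theorem HasDerivWithinAt.Ici_of_Icc {f : ℝ → F} {f' : F} {t : ℝ} (ht : t ∈ Ico (0 : ℝ) 1)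
    (h : HasDerivWithinAt f f' (Icc 0 1) t) : HasDerivWithinAt f f' (Ici t) t := by
  refine h.mono_of_mem_nhdsWithin ?_
  exact mem_of_superset (Icc_mem_nhdsGE ht.2) (Icc_subset_Icc ht.1 le_rfl)

/-- The estimate of the defect of the first variation of radial solutions of a flat system. -/
theorem norm_radial_variation_defect_le (a R : E →L[ℝ] F →L[ℝ] F) (D : E →L[ℝ] E →L[ℝ] F →L[ℝ] F)
    {C C' L m ρ t : ℝ} (hC : ‖a‖ ≤ C) (hC' : ‖D‖ ≤ C') (ht0 : 0 ≤ t) (ht1 : t ≤ 1)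
    {u k : E} {y : F} (hy : ‖y‖ ≤ m) (hk : ‖k‖ ≤ ρ) (huk : ‖u + k‖ ≤ ρ) (hR : ‖R‖ ≤ L * ‖k‖ ^ 2)
    (hflat : D u k y + a k (a u y) = D k u y + a u (a k y)) :
    ‖(a u y + (t • (D u k y + a k (a u y)) + (1 : ℝ) • a k y))
        - (a + t • D k + R) (u + k) (y + t • a k y)‖
      ≤ (C * C * m + C' * m + C' * ρ * (C * m) + L * ρ * (m + C * ρ * m)) * ‖k‖ ^ 2 := by
  have hC0 : 0 ≤ C := (norm_nonneg _).trans hC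
  have hC'0 : 0 ≤ C' := (norm_nonneg _).trans hC'
  have hm0 : 0 ≤ m := (norm_nonneg _).trans hy
  have hρ0 : 0 ≤ ρ := (norm_nonneg _).trans hk
  have e1 : ‖a k‖ ≤ C * ‖k‖ := a.le_of_opNorm_le hC k
  have e2 : ‖D k‖ ≤ C' * ‖k‖ := D.le_of_opNorm_le hC' k
  have e3 : ‖a k y‖ ≤ C * ‖k‖ * m := (a k).le_of_opNorm_le_of_le e1 hy
  have e4 : ‖a k (a k y)‖ ≤ C * ‖k‖ * (C * ‖k‖ * m) := (a k).le_of_opNorm_le_of_le e1 e3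
  have e5 : ‖D k k‖ ≤ C' * ‖k‖ * ‖k‖ := (D k).le_of_opNorm_le e2 k
  have e6 : ‖D k k y‖ ≤ C' * ‖k‖ * ‖k‖ * m := (D k k).le_of_opNorm_le_of_le e5 hy
  have e7 : ‖D k (u + k)‖ ≤ C' * ‖k‖ * ρ := (D k).le_of_opNorm_le_of_le e2 huk
  have e8 : ‖D k (u + k) (a k y)‖ ≤ C' * ‖k‖ * ρ * (C * ‖k‖ * m) :=
    (D k (u + k)).le_of_opNorm_le_of_le e7 e3
  have e9 : ‖y + t • a k y‖ ≤ m + C * ρ * m := by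
    refine (norm_add_le _ _).trans (add_le_add hy ?_)
    rw [norm_smul, Real.norm_eq_abs, abs_of_nonneg ht0]
    calc t * ‖a k y‖ ≤ 1 * (C * ‖k‖ * m) := by gcongr
      _ ≤ C * ρ * m := by rw [one_mul]; gcongr
  have e10 : ‖R (u + k)‖ ≤ L * ‖k‖ ^ 2 * ρ := R.le_of_opNorm_le_of_le hR huk
  have e11 : ‖R (u + k) (y + t • a k y)‖ ≤ L * ‖k‖ ^ 2 * ρ * (m + C * ρ * m) :=
    (R (u + k)).le_of_opNorm_le_of_le e10 e9
  -- Flatness exchanges `u` and `k` in the variation term, after which all terms of order at most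
  -- one in `k` cancel. Only four terms of second order remain.
  have heq : (a u y + (t • (D u k y + a k (a u y)) + (1 : ℝ) • a k y))
        - (a + t • D k + R) (u + k) (y + t • a k y) =
      -(t • a k (a k y) + t • D k k y + (t * t) • D k (u + k) (a k y)
        + R (u + k) (y + t • a k y)) := by
    rw [hflat]
    simp only [add_apply, smul_apply, map_add, map_smul, smul_add]
    module
  have n1 : ‖t • a k (a k y)‖ ≤ C * ‖k‖ * (C * ‖k‖ * m) := by
    rw [norm_smul, Real.norm_eq_abs, abs_of_nonneg ht0]
    exact (mul_le_of_le_one_left (norm_nonneg _) ht1).trans e4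
  have n2 : ‖t • D k k y‖ ≤ C' * ‖k‖ * ‖k‖ * m := by
    rw [norm_smul, Real.norm_eq_abs, abs_of_nonneg ht0]
    exact (mul_le_of_le_one_left (norm_nonneg _) ht1).trans e6
  have n3 : ‖(t * t) • D k (u + k) (a k y)‖ ≤ C' * ‖k‖ * ρ * (C * ‖k‖ * m) := by
    rw [norm_smul, Real.norm_eq_abs, abs_of_nonneg (mul_nonneg ht0 ht0)]
    exact (mul_le_of_le_one_left (norm_nonneg _) (mul_le_one₀ ht1 ht0 ht1)).trans e8
  rw [heq, norm_neg]
  refine norm_add₄_le.trans ?_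
  linarith

/-- Flat linear systems `dY = Ω Y` are solvable near a point, with arbitrary value at any point of
a neighbourhood independent of the value. -/
theorem exists_forall_mem_ball_hasFDerivAt_of_flat [CompleteSpace F]
    {Ω : E → E →L[ℝ] F →L[ℝ] F} {x₀ : E} (hΩ : ContDiffAt ℝ 2 Ω x₀)
    (hflat : ∀ᶠ w in 𝓝 x₀, ∀ v k y, fderiv ℝ Ω w v k y + Ω w k (Ω w v y)
      = fderiv ℝ Ω w k v y + Ω w v (Ω w k y)) :
    ∃ r > 0, ∀ r' ∈ Ioc 0 r, ∀ x₁ ∈ Metric.ball x₀ r', ∀ y₀ : F, ∃ Y : E → F, Y x₁ = y₀ ∧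
      ∀ w ∈ Metric.ball x₀ r', HasFDerivAt Y ((Ω w).flip (Y w)) w := by
  -- uniform bounds near `x₀`
  have h1 : ContDiffAt ℝ 1 (fderiv ℝ Ω) x₀ := hΩ.fderiv_right (by norm_num)
  obtain ⟨L, s, hs, hLip⟩ := h1.exists_lipschitzOnWith
  have hdiff : ∀ᶠ w in 𝓝 x₀, DifferentiableAt ℝ Ω w :=
    (hΩ.eventually (by simp)).mono fun w hw => hw.differentiableAt (by norm_num)
  have hbd : ∀ᶠ w in 𝓝 x₀, ‖Ω w‖ < ‖Ω x₀‖ + 1 :=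
    hΩ.continuousAt.norm.eventually_lt_const (by linarith)
  have hbd' : ∀ᶠ w in 𝓝 x₀, ‖fderiv ℝ Ω w‖ < ‖fderiv ℝ Ω x₀‖ + 1 :=
    h1.continuousAt.norm.eventually_lt_const (by linarith)
  obtain ⟨ρ, hρ, hball⟩ := Metric.eventually_nhds_iff_ball.1
    ((eventually_mem_set.2 hs).and (hdiff.and (hbd.and (hbd'.and hflat))))
  set C := ‖Ω x₀‖ + 1 with hC
  set C' := ‖fderiv ℝ Ω x₀‖ + 1 with hC'
  have hCpos : 0 < C := by positivity
  have hC'pos : 0 < C' := by positivity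
  -- Two points of the small ball are less than `2r` apart, so `r ≤ 1 / (4C)` bounds the coefficient
  -- of the radial equation by `1/2`.
  refine ⟨min (ρ / 3) (1 / (4 * C)), by positivity, fun r hr x₁ hx₁ y₀ => ?_⟩
  have hrpos : 0 < r := hr.1
  have hr3 : 3 * r ≤ ρ := by
    have := hr.2.trans (min_le_left _ _); linarith
  have hrC : 2 * r * C ≤ 1 / 2 := by
    have := hr.2.trans (min_le_right _ _)
    rw [le_div_iff₀ (by positivity)] at this; linarith
  have hpath : ∀ z ∈ Metric.ball x₀ r, ∀ t ∈ Icc (0 : ℝ) 1,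
      x₁ + t • (z - x₁) ∈ Metric.ball x₀ ρ := by
    intro z hz t ht
    refine Metric.ball_subset_ball (by linarith) ((convex_ball x₀ r).add_smul_sub_mem hx₁ hz ht)
  have hzx : ∀ z ∈ Metric.ball x₀ r, ‖z - x₁‖ ≤ 2 * r := by
    intro z hz
    rw [← dist_eq_norm]
    have := dist_triangle_right z x₁ x₀
    rw [Metric.mem_ball] at hz hx₁
    linarith
  have hMb : ∀ z ∈ Metric.ball x₀ r, ∀ t ∈ Icc (0 : ℝ) 1,
      ‖Ω (x₁ + t • (z - x₁)) (z - x₁)‖ ≤ 1 / 2 := by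
    intro z hz t ht
    refine ((Ω _).le_opNorm _).trans (le_trans ?_ hrC)
    rw [mul_comm]
    exact mul_le_mul (hzx z hz) (hball _ (hpath z hz t ht)).2.2.1.le (norm_nonneg _) (by linarith)
  have hpd : ∀ (u : E) (t : ℝ), HasDerivAt (fun t : ℝ => x₁ + t • u) u t := by
    intro u t
    simpa using ((hasDerivAt_id t).smul_const u).const_add x₁
  have hΩpath : ∀ z ∈ Metric.ball x₀ r, ∀ t ∈ Icc (0 : ℝ) 1,
      HasDerivAt (fun t : ℝ => Ω (x₁ + t • (z - x₁)))
        (fderiv ℝ Ω (x₁ + t • (z - x₁)) (z - x₁)) t := by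
    intro z hz t ht
    exact (hball _ (hpath z hz t ht)).2.1.hasFDerivAt.comp_hasDerivAt t (hpd _ t)
  have hex : ∀ z : E, ∃ y : ℝ → F, z ∈ Metric.ball x₀ r → (y 0 = y₀ ∧
      ∀ t ∈ Icc (0 : ℝ) 1, HasDerivWithinAt y (Ω (x₁ + t • (z - x₁)) (z - x₁) (y t))
        (Icc 0 1) t) := by
    intro z
    by_cases hz : z ∈ Metric.ball x₀ r
    · obtain ⟨y, hy⟩ := exists_linear_ode_solution (fun t => Ω (x₁ + t • (z - x₁)) (z - x₁))
        (fun t ht => ((hΩpath z hz t ht).continuousAt.continuousWithinAt).clm_apply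
          continuousWithinAt_const) (hMb z hz) y₀
      exact ⟨y, fun _ => hy⟩
    · exact ⟨0, fun h => absurd h hz⟩
  choose y hy using hex
  -- The solution at `z` is the time-one value of the equation restricted to the segment from `x₁`
  -- to `z`.
  refine ⟨fun z => y z 1, ?_, fun z hz => ?_⟩
  · -- constant at the base point
    obtain ⟨hy0, hyd⟩ := hy x₁ hx₁
    have hconst : ∀ t ∈ Ico (0 : ℝ) 1, HasDerivWithinAt (y x₁) 0 (Ici t) t := by
      intro t ht
      have := hyd t (Ico_subset_Icc_self ht)
      simp only [sub_self, map_zero, zero_apply] at this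
      exact this.Ici_of_Icc ht
    have := constant_of_has_deriv_right_zero (fun t ht => (hyd t ht).continuousWithinAt) hconst
      1 (by simp)
    show y x₁ 1 = y₀
    rw [this, hy0]
  obtain ⟨hy0, hyd⟩ := hy z hz
  have hycont : ContinuousOn (y z) (Icc 0 1) := fun t ht => (hyd t ht).continuousWithinAt
  obtain ⟨m, hm⟩ := isCompact_Icc.exists_bound_of_continuousOn hycont
  have hm0 : 0 ≤ m := (norm_nonneg _).trans (hm 0 (by simp))
  set u := z - x₁ with hu
  set B : ℝ := C * C * m + C' * m + C' * (2 * r) * (C * m) + L * (2 * r) * (m + C * (2 * r) * m)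
    with hB
  have hest : ∀ k : E, ‖k‖ ≤ 2 * r → z + k ∈ Metric.ball x₀ r →
      ‖y (z + k) 1 - (y z 1 + Ω z k (y z 1))‖ ≤ B * ‖k‖ ^ 2 * (Real.exp 1 - 1) := by
    intro k hk hzk
    obtain ⟨hk0, hkd⟩ := hy (z + k) hzk
    have hsub : z + k - x₁ = u + k := by rw [hu]; abel
    rw [hsub] at hkd
    have hpt : ∀ t : ℝ, x₁ + t • (u + k) = (x₁ + t • u) + t • k := by
      intro t; rw [smul_add, add_assoc]
    -- First-order guess for the radial solution towards `z + k`: move the solution towards `z` by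
    -- its expected increment in the direction `t • k`. By flatness it solves the new radial
    -- equation up to `O(‖k‖²)`, and Grönwall compares it with the true solution. At `t = 1` this is
    -- differentiability at `z` with the right derivative.
    set W : ℝ → F := fun t => y z t + t • Ω (x₁ + t • u) k (y z t) with hW
    set W' : ℝ → F := fun t => Ω (x₁ + t • u) u (y z t) +
      (t • (fderiv ℝ Ω (x₁ + t • u) u k (y z t) + Ω (x₁ + t • u) k (Ω (x₁ + t • u) u (y z t)))
        + (1 : ℝ) • Ω (x₁ + t • u) k (y z t)) with hW'
    have hWd : ∀ t ∈ Icc (0 : ℝ) 1, HasDerivWithinAt W (W' t) (Icc 0 1) t := by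
      intro t ht
      have hΩk : HasDerivWithinAt (fun t : ℝ => Ω (x₁ + t • u) k)
          (fderiv ℝ Ω (x₁ + t • u) u k) (Icc 0 1) t := by
        have := ((hΩpath z hz t ht).clm_apply (hasDerivAt_const t k)).hasDerivWithinAt
          (s := Icc 0 1)
        simpa only [map_zero, add_zero] using this
      exact (hyd t ht).add ((hasDerivAt_id t).hasDerivWithinAt.smul (hΩk.clm_apply (hyd t ht)))
    have hdist := dist_le_of_approx_trajectories_ODE_of_mem (E := F) (K := 1)
      (v := fun t Y => Ω (x₁ + t • (u + k)) (u + k) Y) (s := fun _ => univ)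
      (f := y (z + k)) (g := W) (f' := fun t => Ω (x₁ + t • (u + k)) (u + k) (y (z + k) t))
      (g' := W') (a := 0) (b := 1) (εf := 0) (εg := B * ‖k‖ ^ 2) (δ := 0) ?_
      (fun t ht => (hkd t ht).continuousWithinAt)
      (fun t ht => (hkd t (Ico_subset_Icc_self ht)).Ici_of_Icc ht)
      (fun t ht => by simp) (fun _ _ => trivial)
      (fun t ht => (hWd t ht).continuousWithinAt)
      (fun t ht => (hWd t (Ico_subset_Icc_self ht)).Ici_of_Icc ht) ?_ (fun _ _ => trivial)
      (by simp [hW, hy0, hk0]) 1 (by simp)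
    · rw [NNReal.coe_one, gronwallBound_of_K_ne_0 one_ne_zero] at hdist
      have hx1 : x₁ + u = z := by simp [hu]
      simpa [dist_eq_norm, hW, hx1] using hdist
    · intro t ht
      refine LipschitzOnWith.of_dist_le_mul fun a _ b _ => ?_
      rw [dist_eq_norm, dist_eq_norm, ← map_sub]
      refine (ContinuousLinearMap.le_opNorm _ _).trans ?_
      have := hMb (z + k) hzk t (Ico_subset_Icc_self ht)
      rw [hsub] at this
      push_cast
      gcongr
      linarith
    · intro t ht'
      have ht := Ico_subset_Icc_self ht'
      have hp := hpath z hz t ht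
      have hp' := hpath (z + k) hzk t ht
      rw [hsub, hpt] at hp'
      rw [hpt]
      set p := x₁ + t • u with hpdef
      obtain ⟨-, -, hb1, hb2, hfl⟩ := hball p hp
      have hT := norm_sub_sub_fderiv_le_of_lipschitz (convex_ball x₀ ρ)
        (fun w hw => (hball w hw).2.1) L.2
        (fun w hw w' hw' => by
          simpa [dist_eq_norm] using hLip.dist_le_mul w (hball w hw).1 w' (hball w' hw').1)
        hp hp'
      set R := Ω (p + t • k) - Ω p - fderiv ℝ Ω p (t • k) with hR
      have hΩ' : Ω (p + t • k) = Ω p + t • fderiv ℝ Ω p k + R := by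
        rw [hR, map_smul]; abel
      have hR' : ‖R‖ ≤ L * ‖k‖ ^ 2 := by
        refine hT.trans ?_
        have : ‖t • k‖ ≤ ‖k‖ := by
          rw [norm_smul, Real.norm_eq_abs, abs_of_nonneg ht.1]
          exact mul_le_of_le_one_left (norm_nonneg _) ht.2
        show (L : ℝ) * _ ≤ _
        gcongr
      have hukn : ‖u + k‖ ≤ 2 * r := by rw [← hsub]; exact hzx _ hzk
      rw [dist_eq_norm, hΩ']
      exact norm_radial_variation_defect_le (Ω p) R (fderiv ℝ Ω p) hb1.le hb2.le ht.1 ht.2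
        (hm t ht) hk hukn hR' (hfl u k (y z t))
  rw [hasFDerivAt_iff_isLittleO_nhds_zero]
  have hO : (fun k : E => y (z + k) 1 - y z 1 - (Ω z).flip (y z 1) k) =O[𝓝 0]
      fun k : E => ‖k‖ ^ 2 := by
    refine Asymptotics.IsBigO.of_bound (B * (Real.exp 1 - 1)) ?_
    have e1 : ∀ᶠ k : E in 𝓝 0, ‖k‖ ≤ 2 * r :=
      (Metric.eventually_nhds_iff_ball.2 ⟨2 * r, by linarith, fun k hk => by
        simpa using (mem_ball_zero_iff.1 hk).le⟩)
    have e2 : ∀ᶠ k : E in 𝓝 0, z + k ∈ Metric.ball x₀ r := by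
      have : Tendsto (fun k : E => z + k) (𝓝 0) (𝓝 z) := by
        simpa using (continuous_const.add continuous_id).tendsto (0 : E) (f := fun k : E => z + k)
      exact this.eventually (Metric.isOpen_ball.mem_nhds hz)
    filter_upwards [e1, e2] with k hk hk'
    have := hest k hk hk'
    rw [sub_sub, ContinuousLinearMap.flip_apply]
    refine this.trans (le_of_eq ?_)
    simp; ring
  exact hO.trans_isLittleO (Asymptotics.isLittleO_norm_pow_id one_lt_two)

/-- Uniqueness for linear systems `dY = Ω Y` on convex open sets. -/
theorem eqOn_of_hasFDerivAt_linear {Ω : E → E →L[ℝ] F →L[ℝ] F} {s : Set E} (hs : Convex ℝ s)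
    (hΩ : ContinuousOn Ω s) {Y Z : E → F}
    (hY : ∀ w ∈ s, HasFDerivAt Y ((Ω w).flip (Y w)) w)
    (hZ : ∀ w ∈ s, HasFDerivAt Z ((Ω w).flip (Z w)) w) {x : E} (hx : x ∈ s) (h : Y x = Z x) :
    EqOn Y Z s := by
  intro z hz
  have hp : ∀ t ∈ Icc (0 : ℝ) 1, x + t • (z - x) ∈ s := fun t ht => hs.add_smul_sub_mem hx hz ht
  have hpd : ∀ t : ℝ, HasDerivAt (fun t : ℝ => x + t • (z - x)) (z - x) t := fun t => by
    simpa using ((hasDerivAt_id t).smul_const (z - x)).const_add x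
  have hpc : ContinuousOn (fun t : ℝ => x + t • (z - x)) (Icc 0 1) :=
    fun t _ => (hpd t).continuousAt.continuousWithinAt
  obtain ⟨K, hK⟩ := isCompact_Icc.exists_bound_of_continuousOn
    ((hΩ.comp hpc hp).clm_apply (continuousOn_const (c := z - x)))
  have aux : ∀ {Y : E → F}, (∀ w ∈ s, HasFDerivAt Y ((Ω w).flip (Y w)) w) →
      ∀ t ∈ Icc (0 : ℝ) 1, HasDerivAt (fun t : ℝ => Y (x + t • (z - x)))
        (Ω (x + t • (z - x)) (z - x) (Y (x + t • (z - x)))) t := by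
    intro Y hY t ht
    exact (hY _ (hp t ht)).comp_hasDerivAt t (hpd t)
  have := ODE_solution_unique_of_mem_Icc_right (E := F) (K := K.toNNReal)
    (v := fun t Y => Ω (x + t • (z - x)) (z - x) Y) (s := fun _ => univ)
    (f := fun t : ℝ => Y (x + t • (z - x))) (g := fun t : ℝ => Z (x + t • (z - x)))
    (a := 0) (b := 1) ?_ (fun t ht => (aux hY t ht).continuousAt.continuousWithinAt)
    (fun t ht => (aux hY t (Ico_subset_Icc_self ht)).hasDerivWithinAt) (fun _ _ => trivial)
    (fun t ht => (aux hZ t ht).continuousAt.continuousWithinAt)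
    (fun t ht => (aux hZ t (Ico_subset_Icc_self ht)).hasDerivWithinAt) (fun _ _ => trivial)
    (by simpa using h)
  · simpa using this (right_mem_Icc.2 zero_le_one)
  · intro t ht
    refine LipschitzOnWith.of_dist_le_mul fun a _ b _ => ?_
    rw [dist_eq_norm, dist_eq_norm, ← map_sub]
    refine (ContinuousLinearMap.le_opNorm _ _).trans ?_
    gcongr
    exact (hK t (Ico_subset_Icc_self ht)).trans (Real.le_coe_toNNReal K)

/-- Solutions of a linear system `dY = Ω Y` are as smooth as the coefficients. -/
theorem contDiffOn_of_hasFDerivAt_linear {Ω : E → E →L[ℝ] F →L[ℝ] F} {s : Set E} (hs : IsOpen s)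
    (hΩ : ContDiffOn ℝ ∞ Ω s) {Y : E → F}
    (hY : ∀ w ∈ s, HasFDerivAt Y ((Ω w).flip (Y w)) w) : ContDiffOn ℝ ∞ Y s := by
  rw [contDiffOn_infty]
  intro n
  induction n with
  | zero =>
    exact contDiffOn_zero.2 fun w hw => (hY w hw).continuousAt.continuousWithinAt
  | succ n ih =>
    push_cast
    rw [contDiffOn_succ_iff_fderiv_of_isOpen hs]
    refine ⟨fun w hw => (hY w hw).differentiableAt.differentiableWithinAt, by simp, ?_⟩
    have h1 : ContDiffOn ℝ n (fun w => (Ω w).flip (Y w)) s := by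
      have := (ContinuousLinearMap.flipₗᵢ ℝ E F F).toContinuousLinearEquiv.contDiff.comp_contDiffOn
        (hΩ.of_le (m := n) (by exact_mod_cast le_top))
      exact this.clm_apply ih
    exact h1.congr fun w hw => (hY w hw).fderiv

end Frobenius

/-! ### Continuation of local solutions over a simply connected space -/

section Monodromy

/-- Monodromy principle: on a simply connected space, solutions of a local problem which exist
locally with arbitrary prescribed value at a point, and are determined by that value, extend to
global solutions. -/
theorem exists_global_solution_of_local {S V : Type*} [TopologicalSpace S]
    [SimplyConnectedSpace S] [LocallyPathConnectedSpace S] (P : S → (S → V) → Prop)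
    (hcongr : ∀ x f g, f =ᶠ[𝓝 x] g → P x f → P x g)
    (hloc : ∀ x, ∀ W ∈ 𝓝 x, ∃ U ⊆ W, IsOpen U ∧ x ∈ U ∧
      (∀ y ∈ U, ∀ v, ∃ f, f y = v ∧ ∀ z ∈ U, P z f) ∧
      ∀ f g, (∀ z ∈ U, P z f) → (∀ z ∈ U, P z g) → ∀ y ∈ U, f y = g y → EqOn f g U)
    (x₀ : S) (v₀ : V) : ∃ f : S → V, f x₀ = v₀ ∧ ∀ x, P x f := by
  have hloc1 := fun x => hloc x univ univ_mem
  choose U _ hUo hU hUex hUuniq using hloc1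
  have hsol : ∀ i y v, ∃ f : S → V, y ∈ U i → (f y = v ∧ ∀ z ∈ U i, P z f) := by
    intro i y v
    by_cases h : y ∈ U i
    · obtain ⟨f, hf⟩ := hUex i y h v
      exact ⟨f, fun _ => hf⟩
    · exact ⟨fun _ => v, fun h' => absurd h' h⟩
  choose sol hsol using hsol
  have sol_val : ∀ {i y v}, y ∈ U i → sol i y v y = v := fun h => (hsol _ _ _ h).1
  have sol_P : ∀ {i y v}, y ∈ U i → ∀ z ∈ U i, P z (sol i y v) := fun h => (hsol _ _ _ h).2
  have sol_eq : ∀ {i y v f z}, y ∈ U i → (∀ z ∈ U i, P z f) → f y = v → z ∈ U i →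
      sol i y v z = f z := by
    intro i y v f z hy hf hv hz
    exact hUuniq i _ _ (sol_P hy) hf y hy ((sol_val hy).trans hv.symm) hz
  -- With the discrete topology on the values, a bundle with fibre `V` is a covering, and a section
  -- of it is a choice of germs that are locally the germs of one solution.
  let _ : TopologicalSpace V := ⊥
  have _ : DiscreteTopology V := ⟨rfl⟩
  -- Over `U i` a solution is labelled by its value at the centre `i`. Passing from `i` to `j` at
  -- `x` means evaluating at `x`, solving again on `U j` from there, and reading the value at `j`.
  -- Since the bundle charts are indexed by the points themselves, the fibre coordinate over `x` is
  -- the value at `x`.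
  let Z : FiberBundleCore S S V :=
    { baseSet := U
      isOpen_baseSet := hUo
      indexAt := id
      mem_baseSet_at := hU
      coordChange := fun i j x v => sol j x (sol i i v x) j
      coordChange_self := by
        intro i x hx v
        rw [sol_eq hx (sol_P (hU i)) rfl (hU i), sol_val (hU i)]
      continuousOn_coordChange := by
        rintro i j ⟨x, v⟩ ⟨⟨hxi, hxj⟩, -⟩
        refine ContinuousAt.continuousWithinAt ?_
        -- Uniqueness may fail on `U i ∩ U j`, which need not be connected. It holds on a smaller
        -- `W` around `x`, and this makes the coordinate change locally constant.
        obtain ⟨W, hWs, hWo, hxW, -, hWuniq⟩ := hloc x (U i ∩ U j)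
          (((hUo i).inter (hUo j)).mem_nhds ⟨hxi, hxj⟩)
        have hconst : ∀ᶠ p : S × V in 𝓝 (x, v), sol j p.1 (sol i i p.2 p.1) j
            = sol j x (sol i i v x) j := by
          rw [nhds_prod_eq, nhds_discrete V, prod_pure]
          refine (eventually_map).2 ?_
          filter_upwards [hWo.mem_nhds hxW] with x' hx'
          have h1 : EqOn (sol j x (sol i i v x)) (sol i i v) W :=
            hWuniq _ _ (fun z hz => sol_P hxj z (hWs hz).2)
              (fun z hz => sol_P (hU i) z (hWs hz).1) x hxW (sol_val hxj)
          exact sol_eq (hWs hx').2 (sol_P hxj) (h1 hx') (hU j)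
        exact (continuousAt_const.congr (hconst.mono fun p hp => hp.symm))
      coordChange_comp := by
        rintro i j k x ⟨⟨hxi, hxj⟩, hxk⟩ v
        have : sol j j (sol j x (sol i i v x) j) x = sol i i v x := by
          rw [sol_eq (hU j) (sol_P hxj) rfl hxj, sol_val hxj]
        simp only [this] }
  have hcov : IsCoveringMap (Bundle.TotalSpace.proj : Bundle.TotalSpace V Z.Fiber → S) :=
    FiberBundle.isCoveringMap
  obtain ⟨F, ⟨hF0, hF⟩, -⟩ := hcov.existsUnique_continuousMap_lifts (ContinuousMap.id S) x₀
    (⟨x₀, v₀⟩ : Bundle.TotalSpace V Z.Fiber) rfl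
  have hFp : ∀ x, (F x).1 = x := fun x => congrFun hF x
  refine ⟨fun x => (F x).2, ?_, fun x => ?_⟩
  · exact congrArg (fun p : Bundle.TotalSpace V Z.Fiber => (p.2 : V)) hF0
  have hcont : ContinuousAt (fun y => (Z.localTriv x (F y)).2) x := by
    have h1 : ContinuousAt (Z.localTriv x) (F x) := by
      refine (Z.localTriv x).continuousAt ?_
      rw [Z.mem_localTriv_source, hFp]
      exact hU x
    exact continuousAt_snd.comp (ContinuousAt.comp (f := F) h1 F.continuous.continuousAt)
  have hev : ∀ᶠ y in 𝓝 x, (Z.localTriv x (F y)).2 = (Z.localTriv x (F x)).2 := by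
    have := hcont.tendsto
    rw [nhds_discrete V, tendsto_pure] at this
    exact this
  set w := (Z.localTriv x (F x)).2
  -- The lift has constant coordinate `w` in the chart at `x`, so near `x` it coincides with the
  -- single local solution labelled `w`.
  refine hcongr x (sol x x w) _ ?_ (sol_P (hU x) x (hU x))
  filter_upwards [hev, (hUo x).mem_nhds (hU x)] with y hy hyU
  have hval : ∀ y', y' = y → ∀ v : V, sol x y' (sol y' y' v y') x = sol x y v x := by
    rintro _ rfl v
    rw [sol_val (hU _)]
  have e1 : sol x y (F y).2 x = w := (hval (F y).1 (hFp y) (F y).2).symm.trans hy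
  exact (sol_eq (hU x) (sol_P hyU) e1 hyU).trans (sol_val hyU)

end Monodromy

/-! ### Wirtinger calculus -/

section Wirtinger

open ComplexConjugate

variable {f g : ℂ → ℂ} {w : ℂ} {Ω : Set ℂ}

theorem dz_congr (h : f =ᶠ[𝓝 w] g) : dz f w = dz g w := by
  simp only [dz, h.fderiv_eq]

theorem dzbar_congr (h : f =ᶠ[𝓝 w] g) : dzbar f w = dzbar g w := by
  simp only [dzbar, h.fderiv_eq]

theorem fderiv_eq_dz_add_dzbar (f : ℂ → ℂ) (w v : ℂ) :
    fderiv ℝ f w v = dz f w * v + dzbar f w * conj v := by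
  have hv : fderiv ℝ f w v = v.re * fderiv ℝ f w 1 + v.im * fderiv ℝ f w Complex.I := by
    conv_lhs => rw [← Complex.re_add_im v]
    have h1 : ((v.re : ℂ) + v.im * Complex.I) = v.re • (1 : ℂ) + v.im • Complex.I := by
      simp
    rw [h1, map_add, map_smul, map_smul]
    simp
  have e1 : v = v.re + v.im * Complex.I := (Complex.re_add_im v).symm
  have e2 : conj v = v.re - v.im * Complex.I := by
    apply Complex.ext <;> simp
  rw [hv]
  simp only [dz, dzbar]
  linear_combination (-(fderiv ℝ f w 1 - Complex.I * fderiv ℝ f w Complex.I) / 2) * e1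
    - ((fderiv ℝ f w 1 + Complex.I * fderiv ℝ f w Complex.I) / 2) * e2
    + (v.im * fderiv ℝ f w Complex.I) * Complex.I_sq

@[simp] theorem dz_const (c w : ℂ) : dz (fun _ => c) w = 0 := by simp [dz]

@[simp] theorem dzbar_const (c w : ℂ) : dzbar (fun _ => c) w = 0 := by simp [dzbar]

theorem dz_add (hf : DifferentiableAt ℝ f w) (hg : DifferentiableAt ℝ g w) :
    dz (fun y => f y + g y) w = dz f w + dz g w := by
  simp only [dz, fderiv_fun_add hf hg, add_apply]; ring

theorem dzbar_add (hf : DifferentiableAt ℝ f w) (hg : DifferentiableAt ℝ g w) :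
    dzbar (fun y => f y + g y) w = dzbar f w + dzbar g w := by
  simp only [dzbar, fderiv_fun_add hf hg, add_apply]; ring

theorem dz_sub (hf : DifferentiableAt ℝ f w) (hg : DifferentiableAt ℝ g w) :
    dz (fun y => f y - g y) w = dz f w - dz g w := by
  simp only [dz, fderiv_fun_sub hf hg, sub_apply]; ring

theorem dzbar_sub (hf : DifferentiableAt ℝ f w) (hg : DifferentiableAt ℝ g w) :
    dzbar (fun y => f y - g y) w = dzbar f w - dzbar g w := by
  simp only [dzbar, fderiv_fun_sub hf hg, sub_apply]; ring

theorem dz_neg : dz (fun y => -f y) w = -dz f w := by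
  simp only [dz, fderiv_fun_neg, neg_apply]; ring

theorem dzbar_neg : dzbar (fun y => -f y) w = -dzbar f w := by
  simp only [dzbar, fderiv_fun_neg, neg_apply]; ring

theorem dz_mul (hf : DifferentiableAt ℝ f w) (hg : DifferentiableAt ℝ g w) :
    dz (fun y => f y * g y) w = dz f w * g w + f w * dz g w := by
  simp only [dz, fderiv_fun_mul hf hg, add_apply, smul_apply, smul_eq_mul]; ring

theorem dzbar_mul (hf : DifferentiableAt ℝ f w) (hg : DifferentiableAt ℝ g w) :
    dzbar (fun y => f y * g y) w = dzbar f w * g w + f w * dzbar g w := by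
  simp only [dzbar, fderiv_fun_mul hf hg, add_apply, smul_apply, smul_eq_mul]; ring

theorem dz_const_mul (c : ℂ) (hf : DifferentiableAt ℝ f w) :
    dz (fun y => c * f y) w = c * dz f w := by
  rw [dz_mul (differentiableAt_const c) hf]; simp

theorem dzbar_const_mul (c : ℂ) (hf : DifferentiableAt ℝ f w) :
    dzbar (fun y => c * f y) w = c * dzbar f w := by
  rw [dzbar_mul (differentiableAt_const c) hf]; simp

theorem fderiv_conj (f : ℂ → ℂ) (w v : ℂ) :
    fderiv ℝ (fun y => conj (f y)) w v = conj (fderiv ℝ f w v) := by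
  have := (Complex.conjCLE).comp_fderiv (f := f) (x := w)
  have h2 := congrArg (fun L : ℂ →L[ℝ] ℂ => L v) this
  simpa [Function.comp_def] using h2

theorem dz_conj (f : ℂ → ℂ) (w : ℂ) : dz (fun y => conj (f y)) w = conj (dzbar f w) := by
  simp only [dz, dzbar, fderiv_conj, map_div₀, map_add, map_mul, Complex.conj_I, map_ofNat]
  ring

theorem dzbar_conj (f : ℂ → ℂ) (w : ℂ) : dzbar (fun y => conj (f y)) w = conj (dz f w) := by
  simp only [dz, dzbar, fderiv_conj, map_div₀, map_sub, map_mul, Complex.conj_I, map_ofNat]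
  ring

/-- For a real function, `∂/∂z̄` is the conjugate of `∂/∂z`. -/
theorem dzbar_ofReal (f : ℂ → ℝ) (w : ℂ) :
    dzbar (fun y => (f y : ℂ)) w = conj (dz (fun y => (f y : ℂ)) w) := by
  rw [← dzbar_conj]; simp

theorem fderiv_ofReal_apply {f : ℂ → ℝ} (hf : DifferentiableAt ℝ f w) (v : ℂ) :
    fderiv ℝ (fun y => (f y : ℂ)) w v = (fderiv ℝ f w v : ℂ) := by
  have := (Complex.ofRealCLM.hasFDerivAt.comp w hf.hasFDerivAt).fderiv
  have h2 := congrArg (fun L : ℂ →L[ℝ] ℂ => L v) this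
  simpa [Function.comp_def] using h2

theorem fderiv_real_eq_two_re {f : ℂ → ℝ} (hf : DifferentiableAt ℝ f w) (v : ℂ) :
    fderiv ℝ f w v = 2 * (dz (fun y => (f y : ℂ)) w * v).re := by
  have h1 := fderiv_ofReal_apply hf v
  rw [fderiv_eq_dz_add_dzbar, dzbar_ofReal, ← map_mul, Complex.add_conj] at h1
  exact_mod_cast h1.symm

theorem differentiableAt_ofReal {f : ℂ → ℝ} (hf : DifferentiableAt ℝ f w) :
    DifferentiableAt ℝ (fun y => (f y : ℂ)) w :=
  (Complex.ofRealCLM.differentiableAt).comp w hf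

theorem differentiableAt_conj (hf : DifferentiableAt ℝ f w) :
    DifferentiableAt ℝ (fun y => conj (f y)) w :=
  (Complex.conjCLE.differentiableAt).comp w hf

/-- Chain rule for the composition of a real function with a function of one variable. -/
theorem dz_ofReal_comp {f : ℂ → ℝ} {φ : ℝ → ℝ} {φ' : ℝ} (hf : DifferentiableAt ℝ f w)
    (hφ : HasDerivAt φ φ' (f w)) :
    dz (fun y => (φ (f y) : ℂ)) w = φ' * dz (fun y => (f y : ℂ)) w := by
  have h1 : HasFDerivAt (fun y => φ (f y)) (φ' • fderiv ℝ f w) w :=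
    hφ.comp_hasFDerivAt w hf.hasFDerivAt
  simp only [dz, fderiv_ofReal_apply h1.differentiableAt, fderiv_ofReal_apply hf, h1.fderiv,
    smul_apply, smul_eq_mul]
  push_cast
  ring

theorem dzbar_holomorphic {φ : ℂ → ℂ} (hφ : DifferentiableAt ℂ φ w) : dzbar φ w = 0 := by
  have hφ' : HasFDerivAt φ ((fderiv ℂ φ w).restrictScalars ℝ) w :=
    hφ.hasFDerivAt.restrictScalars ℝ
  have h : ∀ v, fderiv ℝ φ w v = deriv φ w * v := by
    intro v; rw [hφ'.fderiv]; simp [mul_comm]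
  simp only [dzbar, h]
  linear_combination (deriv φ w / 2) * Complex.I_sq

theorem contDiffOn_fderiv_apply_const (hΩ : IsOpen Ω) (hf : ContDiffOn ℝ ∞ f Ω) (v : ℂ) :
    ContDiffOn ℝ ∞ (fun w => fderiv ℝ f w v) Ω :=
  (hf.fderiv_of_isOpen hΩ (by simp)).clm_apply contDiffOn_const

theorem ContDiffOn.dz (hΩ : IsOpen Ω) (hf : ContDiffOn ℝ ∞ f Ω) : ContDiffOn ℝ ∞ (dz f) Ω := by
  unfold _root_.dz
  exact ((contDiffOn_fderiv_apply_const hΩ hf 1).sub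
    (contDiffOn_const.mul (contDiffOn_fderiv_apply_const hΩ hf Complex.I))).div_const 2

theorem ContDiffOn.dzbar (hΩ : IsOpen Ω) (hf : ContDiffOn ℝ ∞ f Ω) :
    ContDiffOn ℝ ∞ (dzbar f) Ω := by
  unfold _root_.dzbar
  exact ((contDiffOn_fderiv_apply_const hΩ hf 1).add
    (contDiffOn_const.mul (contDiffOn_fderiv_apply_const hΩ hf Complex.I))).div_const 2

theorem ContDiffOn.conj (hf : ContDiffOn ℝ ∞ f Ω) :
    ContDiffOn ℝ ∞ (fun y => (starRingEnd ℂ) (f y)) Ω :=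
  Complex.conjCLE.contDiff.comp_contDiffOn hf

theorem ContDiffOn.ofReal {f : ℂ → ℝ} (hf : ContDiffOn ℝ ∞ f Ω) :
    ContDiffOn ℝ ∞ (fun y => (f y : ℂ)) Ω :=
  Complex.ofRealCLM.contDiff.comp_contDiffOn hf

theorem ContDiffOn.differentiableAt_of_isOpen {E F : Type*} [NormedAddCommGroup E]
    [NormedSpace ℝ E] [NormedAddCommGroup F] [NormedSpace ℝ F] {f : E → F} {Ω : Set E} {w : E}
    (hΩ : IsOpen Ω) (hf : ContDiffOn ℝ ∞ f Ω) (hw : w ∈ Ω) : DifferentiableAt ℝ f w :=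
  (hf.contDiffAt (hΩ.mem_nhds hw)).differentiableAt (by simp)

/-- Mixed second derivatives commute. -/
theorem fderiv_fderiv_apply_comm (hf : ContDiffAt ℝ 2 f w) (u v : ℂ) :
    fderiv ℝ (fun y => fderiv ℝ f y u) w v = fderiv ℝ (fun y => fderiv ℝ f y v) w u := by
  have hs : IsSymmSndFDerivAt ℝ f w := hf.isSymmSndFDerivAt (by simp)
  have hd : DifferentiableAt ℝ (fderiv ℝ f) w :=
    (hf.fderiv_right (m := 1) (by norm_num)).differentiableAt (by norm_num)
  rw [fderiv_clm_apply hd (differentiableAt_const u), fderiv_clm_apply hd (differentiableAt_const v)]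
  simpa using hs v u

theorem differentiableAt_fderiv_apply (hf : ContDiffAt ℝ 2 f w) (v : ℂ) :
    DifferentiableAt ℝ (fun y => fderiv ℝ f y v) w :=
  ((hf.fderiv_right (m := 1) (by norm_num)).differentiableAt (by norm_num)).clm_apply
    (differentiableAt_const v)

theorem fderiv_dz_apply (hf : ContDiffAt ℝ 2 f w) (v : ℂ) : fderiv ℝ (dz f) w v =
    (fderiv ℝ (fun y => fderiv ℝ f y 1) w v
      - Complex.I * fderiv ℝ (fun y => fderiv ℝ f y Complex.I) w v) / 2 := by
  have h1 := differentiableAt_fderiv_apply hf 1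
  have h2 := differentiableAt_fderiv_apply hf Complex.I
  have : HasFDerivAt (dz f) ((2 : ℂ)⁻¹ • (fderiv ℝ (fun y => fderiv ℝ f y 1) w
      - Complex.I • fderiv ℝ (fun y => fderiv ℝ f y Complex.I) w)) w := by
    have := (h1.hasFDerivAt.sub (h2.hasFDerivAt.const_mul Complex.I)).const_mul (2 : ℂ)⁻¹
    refine this.congr_of_eventuallyEq (Eventually.of_forall fun y => ?_)
    simp only [dz, Pi.sub_apply]; ring
  rw [this.fderiv]
  simp; ring

theorem fderiv_dzbar_apply (hf : ContDiffAt ℝ 2 f w) (v : ℂ) : fderiv ℝ (dzbar f) w v =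
    (fderiv ℝ (fun y => fderiv ℝ f y 1) w v
      + Complex.I * fderiv ℝ (fun y => fderiv ℝ f y Complex.I) w v) / 2 := by
  have h1 := differentiableAt_fderiv_apply hf 1
  have h2 := differentiableAt_fderiv_apply hf Complex.I
  have : HasFDerivAt (dzbar f) ((2 : ℂ)⁻¹ • (fderiv ℝ (fun y => fderiv ℝ f y 1) w
      + Complex.I • fderiv ℝ (fun y => fderiv ℝ f y Complex.I) w)) w := by
    have := (h1.hasFDerivAt.add (h2.hasFDerivAt.const_mul Complex.I)).const_mul (2 : ℂ)⁻¹
    refine this.congr_of_eventuallyEq (Eventually.of_forall fun y => ?_)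
    simp only [dzbar, Pi.add_apply]; ring
  rw [this.fderiv]
  simp; ring

theorem dz_dzbar_comm (hf : ContDiffAt ℝ 2 f w) : dz (dzbar f) w = dzbar (dz f) w := by
  rw [dz, dzbar, fderiv_dz_apply hf, fderiv_dz_apply hf, fderiv_dzbar_apply hf,
    fderiv_dzbar_apply hf, fderiv_fderiv_apply_comm hf 1 Complex.I]
  ring

end Wirtinger

/-! ### An L² estimate for `∂/∂z̄` -/

section UniqueContinuation

open ComplexConjugate MeasureTheory

variable {u : ℂ → ℂ}

/-- The integral of a directional derivative of a compactly supported function vanishes. -/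
theorem integral_fderiv_apply_eq_zero {f : ℂ → ℂ} (hf : ContDiff ℝ 1 f) (hc : HasCompactSupport f)
    (v : ℂ) : ∫ z, fderiv ℝ f z v = 0 := by
  have hcont : Continuous fun z => fderiv ℝ f z v :=
    (hf.continuous_fderiv (by norm_num)).clm_apply continuous_const
  have hcs : HasCompactSupport fun z => fderiv ℝ f z v := hc.fderiv_apply (𝕜 := ℝ) v
  have hi : Integrable fun z => fderiv ℝ f z v := hcont.integrable_of_hasCompactSupport hcs
  have hi' : Integrable f := hf.continuous.integrable_of_hasCompactSupport hc
  have := integral_mul_fderiv_eq_neg_fderiv_mul_of_integrable (μ := volume) (f := fun _ => (1 : ℂ))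
    (g := f) (v := v) (by simp) (by simpa using hi) (by simpa using hi')
    (fun x _ => differentiableAt_const _) (fun x _ => hf.differentiable (by norm_num) x)
  simpa using this

/-- `∂_1 u · conj (∂_I u)` and its conjugate have the same integral. -/
theorem integral_fderiv_mul_conj_sub (hu : ContDiff ℝ ∞ u) (hc : HasCompactSupport u) :
    ∫ z, (fderiv ℝ u z 1 * conj (fderiv ℝ u z Complex.I)
      - fderiv ℝ u z Complex.I * conj (fderiv ℝ u z 1)) = 0 := by
  have hd : ∀ v, ContDiff ℝ ∞ fun z => fderiv ℝ u z v := fun v =>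
    (hu.fderiv_right (m := ∞) (by simp)).clm_apply contDiff_const
  have hdc : ∀ v, ContDiff ℝ ∞ fun z => conj (fderiv ℝ u z v) := fun v =>
    Complex.conjCLE.contDiff.comp (hd v)
  have hΦ : ∀ v, ContDiff ℝ 1 fun z => u z * conj (fderiv ℝ u z v) := fun v =>
    (hu.mul (hdc v)).of_le ENat.LEInfty.out
  have hΦc : ∀ v, HasCompactSupport fun z => u z * conj (fderiv ℝ u z v) := fun v => hc.mul_right
  have key : ∀ v v' z, fderiv ℝ (fun z => u z * conj (fderiv ℝ u z v)) z v'
      = fderiv ℝ u z v' * conj (fderiv ℝ u z v)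
        + u z * conj (fderiv ℝ (fun y => fderiv ℝ u y v) z v') := by
    intro v v' z
    rw [fderiv_fun_mul (hu.differentiable (by simp) z) ((hdc v).differentiable (by simp) z)]
    simp only [add_apply, smul_apply, smul_eq_mul, _root_.fderiv_conj]
    ring
  have hint : ∀ v v', Integrable fun z => fderiv ℝ (fun z => u z * conj (fderiv ℝ u z v)) z v' :=
    fun v v' => Continuous.integrable_of_hasCompactSupport
      (((hΦ v).continuous_fderiv (by norm_num)).clm_apply continuous_const)
      ((hΦc v).fderiv_apply (𝕜 := ℝ) v')
  -- The integrand is the difference of `∂_1 (u conj(∂_I u))` and `∂_I (u conj(∂_1 u))`: the second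
  -- derivatives cancel by symmetry.
  have h1 := integral_fderiv_apply_eq_zero (hΦ Complex.I) (hΦc Complex.I) 1
  have h2 := integral_fderiv_apply_eq_zero (hΦ 1) (hΦc 1) Complex.I
  have h3 := integral_sub (hint Complex.I 1) (hint 1 Complex.I)
  rw [h1, h2, sub_zero] at h3
  rw [← h3]
  congr 1
  ext z
  rw [key, key, fderiv_fderiv_apply_comm (hu.contDiffAt.of_le ENat.LEInfty.out)
    Complex.I 1]
  ring

/-- Pointwise, `4 |u_z̄|²` differs from `|∂_1 u|² + |∂_I u|²` by the imaginary part of the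
expression in `integral_fderiv_mul_conj_sub`, whose integral is zero. -/
theorem integral_normSq_fderiv_add (hu : ContDiff ℝ ∞ u) (hc : HasCompactSupport u) :
    ∫ z, (‖fderiv ℝ u z 1‖ ^ 2 + ‖fderiv ℝ u z Complex.I‖ ^ 2) = 4 * ∫ z, ‖dzbar u z‖ ^ 2 := by
  have hd : ∀ v, Continuous fun z => fderiv ℝ u z v := fun v =>
    (hu.continuous_fderiv (by simp)).clm_apply continuous_const
  have hdc : ∀ v, HasCompactSupport fun z => fderiv ℝ u z v := fun v =>
    hc.fderiv_apply (𝕜 := ℝ) v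
  have h0 := integral_fderiv_mul_conj_sub hu hc
  have hi0 : Integrable fun z => (fderiv ℝ u z 1 * conj (fderiv ℝ u z Complex.I)
      - fderiv ℝ u z Complex.I * conj (fderiv ℝ u z 1)) := by
    refine Continuous.integrable_of_hasCompactSupport ?_ ?_
    · exact ((hd _).mul (Complex.continuous_conj.comp (hd _))).sub
        ((hd _).mul (Complex.continuous_conj.comp (hd _)))
    · exact ((hdc _).mul_right).sub ((hdc _).mul_right)
  have him : ∫ z, (fderiv ℝ u z 1 * conj (fderiv ℝ u z Complex.I)
      - fderiv ℝ u z Complex.I * conj (fderiv ℝ u z 1)).im = 0 := by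
    have := integral_im (𝕜 := ℂ) hi0
    simp only [RCLike.im_to_complex] at this
    rw [this, h0]; simp
  have hsq : ∀ a b : ℂ, 4 * ‖(a + Complex.I * b) / 2‖ ^ 2
      = (‖a‖ ^ 2 + ‖b‖ ^ 2) + (a * conj b - b * conj a).im := by
    intro a b
    simp only [← Complex.normSq_eq_norm_sq, Complex.normSq_apply]
    simp
    ring
  have hi1 : Integrable fun z => (‖fderiv ℝ u z 1‖ ^ 2 + ‖fderiv ℝ u z Complex.I‖ ^ 2) := by
    refine Continuous.integrable_of_hasCompactSupport ?_ ?_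
    · exact ((hd _).norm.pow 2).add ((hd _).norm.pow 2)
    · refine HasCompactSupport.add ?_ ?_
      · exact (hdc 1).comp_left (g := fun x : ℂ => ‖x‖ ^ 2) (by simp)
      · exact (hdc Complex.I).comp_left (g := fun x : ℂ => ‖x‖ ^ 2) (by simp)
  rw [← integral_const_mul]
  simp only [dzbar, hsq]
  have hi2 : Integrable fun z => (fderiv ℝ u z 1 * conj (fderiv ℝ u z Complex.I)
      - fderiv ℝ u z Complex.I * conj (fderiv ℝ u z 1)).im := hi0.im
  rw [integral_add hi1 hi2, him, add_zero]

/-- `L²` estimate for `∂/∂z̄` on functions supported in a ball. -/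
theorem integral_normSq_le_dzbar (hu : ContDiff ℝ ∞ u) (hc : HasCompactSupport u) {c : ℂ} {R : ℝ}
    (hR : 0 ≤ R) (hs : ∀ z, u z ≠ 0 → ‖z - c‖ ≤ R) :
    ∫ z, ‖u z‖ ^ 2 ≤ 16 * R ^ 2 * ∫ z, ‖dzbar u z‖ ^ 2 := by
  have hd : ∀ v, Continuous fun z => fderiv ℝ u z v := fun v =>
    (hu.continuous_fderiv (by simp)).clm_apply continuous_const
  have hdc : ∀ v, HasCompactSupport fun z => fderiv ℝ u z v := fun v =>
    hc.fderiv_apply (𝕜 := ℝ) v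
  have hin : ∀ v, Integrable fun z => ‖fderiv ℝ u z v‖ ^ 2 := fun v =>
    Continuous.integrable_of_hasCompactSupport ((hd v).norm.pow 2)
      ((hdc v).comp_left (g := fun x : ℂ => ‖x‖ ^ 2) (by simp))
  have hiu : Integrable fun z => ‖u z‖ ^ 2 :=
    Continuous.integrable_of_hasCompactSupport (hu.continuous.norm.pow 2)
      (hc.comp_left (g := fun x : ℂ => ‖x‖ ^ 2) (by simp))
  -- integrate the divergence of `(x - x₀) |u|²`
  have hconj : ContDiff ℝ ∞ fun z => conj (u z) := Complex.conjCLE.contDiff.comp hu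
  have hre : ContDiff ℝ ∞ fun z : ℂ => (((z - c).re : ℝ) : ℂ) :=
    Complex.ofRealCLM.contDiff.comp (Complex.reCLM.contDiff.comp (contDiff_id.sub contDiff_const))
  have hΦ : ContDiff ℝ 1 fun z : ℂ => (((z - c).re : ℝ) : ℂ) * (u z * conj (u z)) :=
    (hre.mul (hu.mul hconj)).of_le ENat.LEInfty.out
  have hΦc : HasCompactSupport fun z : ℂ => (((z - c).re : ℝ) : ℂ) * (u z * conj (u z)) :=
    (hc.mul_right).mul_left
  have hI := integral_fderiv_apply_eq_zero hΦ hΦc 1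
  have hfd : ∀ z, fderiv ℝ (fun z : ℂ => (((z - c).re : ℝ) : ℂ) * (u z * conj (u z))) z 1
      = ((‖u z‖ ^ 2 + 2 * (z - c).re * (fderiv ℝ u z 1 * conj (u z)).re : ℝ) : ℂ) := by
    intro z
    have h1 : fderiv ℝ (fun z : ℂ => (((z - c).re : ℝ) : ℂ)) z 1 = 1 := by
      have : HasFDerivAt (fun z : ℂ => (((z - c).re : ℝ) : ℂ))
          (Complex.ofRealCLM.comp Complex.reCLM) z :=
        (Complex.ofRealCLM.comp Complex.reCLM).hasFDerivAt.comp z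
          ((hasFDerivAt_id z).sub_const c)
      rw [this.fderiv]; simp
    rw [fderiv_fun_mul (hre.differentiable (by simp) z)
      ((hu.mul hconj).differentiable (by simp) z),
      fderiv_fun_mul (hu.differentiable (by simp) z) (hconj.differentiable (by simp) z)]
    simp only [add_apply, smul_apply, smul_eq_mul, _root_.fderiv_conj, h1]
    rw [← Complex.normSq_eq_norm_sq, Complex.normSq_apply]
    apply Complex.ext
    · simp; ring
    · simp; ring
  simp only [hfd] at hI
  rw [integral_complex_ofReal] at hI
  have hI' : ∫ z, (‖u z‖ ^ 2 + 2 * (z - c).re * (fderiv ℝ u z 1 * conj (u z)).re) = 0 := by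
    exact_mod_cast hI
  have hint2 : Integrable fun z =>
      (‖u z‖ ^ 2 + 2 * (z - c).re * (fderiv ℝ u z 1 * conj (u z)).re) := by
    have : Integrable fun z => fderiv ℝ
        (fun z : ℂ => (((z - c).re : ℝ) : ℂ) * (u z * conj (u z))) z 1 :=
      Continuous.integrable_of_hasCompactSupport
        ((hΦ.continuous_fderiv (by norm_num)).clm_apply continuous_const)
        (hΦc.fderiv_apply (𝕜 := ℝ) 1)
    simp only [hfd] at this
    have := this.re
    simp only [RCLike.re_to_complex, Complex.ofReal_re] at this
    exact this
  -- Completing the square: on the support `|re (z - c)| ≤ R`, and the right side minus the left is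
  -- at least `(‖u‖ - 2R ‖∂_1 u‖)²`.
  have hpt : ∀ z, ‖u z‖ ^ 2 - 4 * R ^ 2 * ‖fderiv ℝ u z 1‖ ^ 2 ≤
      2 * (‖u z‖ ^ 2 + 2 * (z - c).re * (fderiv ℝ u z 1 * conj (u z)).re) := by
    intro z
    by_cases hz : u z = 0
    · simp [hz]; positivity
    have h1 : |(z - c).re| ≤ R := (Complex.abs_re_le_norm _).trans (hs z hz)
    have h2 : |(fderiv ℝ u z 1 * conj (u z)).re| ≤ ‖fderiv ℝ u z 1‖ * ‖u z‖ := by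
      refine (Complex.abs_re_le_norm _).trans ?_
      rw [norm_mul, RCLike.norm_conj]
    have h3 : |(z - c).re * (fderiv ℝ u z 1 * conj (u z)).re|
        ≤ R * (‖fderiv ℝ u z 1‖ * ‖u z‖) := by
      rw [abs_mul]; gcongr
    have h4 := (abs_le.1 h3).1
    nlinarith [sq_nonneg (‖u z‖ - 2 * R * ‖fderiv ℝ u z 1‖)]
  have hle : ∫ z, (‖u z‖ ^ 2 - 4 * R ^ 2 * ‖fderiv ℝ u z 1‖ ^ 2) ≤ 0 := by
    refine (integral_mono (hiu.sub ((hin 1).const_mul _)) (hint2.const_mul 2) hpt).trans ?_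
    rw [integral_const_mul, hI', mul_zero]
  rw [integral_sub hiu ((hin 1).const_mul _), integral_const_mul] at hle
  have h5 : ∫ z, ‖fderiv ℝ u z 1‖ ^ 2
      ≤ ∫ z, (‖fderiv ℝ u z 1‖ ^ 2 + ‖fderiv ℝ u z Complex.I‖ ^ 2) :=
    integral_mono (hin 1) ((hin 1).add (hin Complex.I)) fun z => by simp
  rw [integral_normSq_fderiv_add hu hc] at h5
  nlinarith [mul_le_mul_of_nonneg_left h5 (by positivity : (0 : ℝ) ≤ 4 * R ^ 2)]

end UniqueContinuation

/-! ### Carleman's weights and unique continuation -/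

section Carleman

open ComplexConjugate MeasureTheory

theorem contDiff_inv_pow_mul {α : ℂ → ℂ} {c : ℂ} (hα : ContDiff ℝ ∞ α) (h0 : α =ᶠ[𝓝 c] 0)
    (n : ℕ) : ContDiff ℝ ∞ fun z => ((z - c) ^ n)⁻¹ * α z := by
  rw [contDiff_iff_contDiffAt]
  intro z
  by_cases hz : z = c
  · subst hz
    refine (contDiffAt_const (c := (0 : ℂ))).congr_of_eventuallyEq ?_
    filter_upwards [h0] with y hy
    simp [hy]
  · refine ContDiffAt.mul ?_ hα.contDiffAt
    exact ((contDiffAt_id.sub contDiffAt_const).pow n).inv (pow_ne_zero _ (sub_ne_zero.2 hz))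

/-- The weight is holomorphic off `c`, so `∂/∂z̄` does not see it. Its pole is harmless because `α`
vanishes near `c`. -/
theorem dzbar_inv_pow_mul {α : ℂ → ℂ} {c : ℂ} (hα : ContDiff ℝ ∞ α) (h0 : α =ᶠ[𝓝 c] 0)
    (n : ℕ) (z : ℂ) :
    dzbar (fun z => ((z - c) ^ n)⁻¹ * α z) z = ((z - c) ^ n)⁻¹ * dzbar α z := by
  by_cases hz : z = c
  · subst hz
    have h1 : (fun y => ((y - z) ^ n)⁻¹ * α y) =ᶠ[𝓝 z] fun _ => 0 := by
      filter_upwards [h0] with y hy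
      simp [hy]
    have h2 : α =ᶠ[𝓝 z] fun _ => 0 := h0
    rw [dzbar_congr h1, dzbar_congr h2]
    simp
  · have hd : DifferentiableAt ℂ (fun z => ((z - c) ^ n)⁻¹) z :=
      DifferentiableAt.inv (by fun_prop) (pow_ne_zero _ (sub_ne_zero.2 hz))
    rw [dzbar_mul (hd.restrictScalars ℝ) (hα.differentiable (by simp) z), dzbar_holomorphic hd]
    ring

theorem integrable_normSq {f : ℂ → ℂ} (hf : Continuous f) (hc : HasCompactSupport f) :
    Integrable fun z => ‖f z‖ ^ 2 :=
  Continuous.integrable_of_hasCompactSupport (hf.norm.pow 2)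
    (hc.comp_left (g := fun x : ℂ => ‖x‖ ^ 2) (by simp))

theorem ContDiff.continuous_dzbar {f : ℂ → ℂ} (hf : ContDiff ℝ ∞ f) : Continuous (dzbar f) := by
  have := ContDiffOn.dzbar isOpen_univ hf.contDiffOn
  exact (contDiffOn_univ.1 this).continuous

theorem HasCompactSupport.dzbar {f : ℂ → ℂ} (hc : HasCompactSupport f) :
    HasCompactSupport (dzbar f) := by
  have h := hc.fderiv (𝕜 := ℝ)
  exact h.comp_left (g := fun L : ℂ →L[ℝ] ℂ => (L 1 + Complex.I * L Complex.I) / 2) (by simp)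

/-- Carleman's unique continuation argument for a pair of functions satisfying a differential
inequality for `∂/∂z̄`. -/
theorem eq_zero_of_normSq_dzbar_le {α β : ℂ → ℂ} {c : ℂ} {R K : ℝ} (hR : 0 < R) (hK0 : 0 ≤ K)
    (hK : 16 * R ^ 2 * K ≤ 1 / 2) (hα : ContDiff ℝ ∞ α) (hβ : ContDiff ℝ ∞ β)
    (hsα : ∀ z, α z ≠ 0 → ‖z - c‖ ≤ R) (hsβ : ∀ z, β z ≠ 0 → ‖z - c‖ ≤ R)
    (hα0 : α =ᶠ[𝓝 c] 0) (hβ0 : β =ᶠ[𝓝 c] 0)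
    (hle : ∀ z, ‖z - c‖ < R / 2 →
      ‖dzbar α z‖ ^ 2 + ‖dzbar β z‖ ^ 2 ≤ K * (‖α z‖ ^ 2 + ‖β z‖ ^ 2)) :
    ∀ z ∈ Metric.ball c (R / 4), α z = 0 := by
  have hcs : ∀ {f : ℂ → ℂ}, (∀ z, f z ≠ 0 → ‖z - c‖ ≤ R) → HasCompactSupport f := fun h =>
    HasCompactSupport.intro (isCompact_closedBall c R) fun z hz => by
      by_contra h'
      exact hz (by simpa [dist_eq_norm] using h z h')
  have hcα := hcs hsα
  have hcβ := hcs hsβ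
  have hdz0 : ∀ {f : ℂ → ℂ}, (∀ z, f z ≠ 0 → ‖z - c‖ ≤ R) → ∀ z, R < ‖z - c‖ → dzbar f z = 0 := by
    intro f h z hz
    have : f =ᶠ[𝓝 z] fun _ => 0 := by
      have ho : IsOpen {z | R < ‖z - c‖} :=
        isOpen_lt continuous_const ((continuous_id.sub continuous_const).norm)
      filter_upwards [ho.mem_nhds hz] with y hy
      by_contra h'
      exact absurd (h y h') (not_le.2 hy)
    rw [dzbar_congr this, dzbar_const]
  obtain ⟨Mα, hMα⟩ := hα.continuous_dzbar.bounded_above_of_compact_support hcα.dzbar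
  obtain ⟨Mβ, hMβ⟩ := hβ.continuous_dzbar.bounded_above_of_compact_support hcβ.dzbar
  set M : ℝ := Mα ^ 2 + Mβ ^ 2 with hM
  have hM0 : 0 ≤ M := by positivity
  have hTM : ∀ z, ‖dzbar α z‖ ^ 2 + ‖dzbar β z‖ ^ 2 ≤ M := fun z =>
    add_le_add (pow_le_pow_left₀ (norm_nonneg _) (hMα z) 2)
      (pow_le_pow_left₀ (norm_nonneg _) (hMβ z) 2)
  set V : ℝ := volume.real (Metric.closedBall c R) with hV
  have hV0 : 0 ≤ V := measureReal_nonneg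
  set S : ℂ → ℝ := fun z => ‖α z‖ ^ 2 + ‖β z‖ ^ 2 with hS
  have hSc : Continuous S := (hα.continuous.norm.pow 2).add (hβ.continuous.norm.pow 2)
  have hS0 : ∀ z, 0 ≤ S z := fun z => by positivity
  have hSi : Integrable S :=
    (integrable_normSq hα.continuous hcα).add (integrable_normSq hβ.continuous hcβ)
  -- The weight `|z - c|⁻ⁿ` is at least `(4/R)ⁿ` on the quarter ball and at most `(2/R)ⁿ` where `|z
  -- - c| ≥ R/2`, the region in which the differential inequality is not available. The square of
  -- the ratio of these bounds is the factor `4⁻ⁿ`.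
  have main : ∀ n : ℕ, ∫ z in Metric.ball c (R / 4), S z ≤ (32 * R ^ 2 * M * V) * (1 / 4) ^ n := by
    intro n
    set u : ℂ → ℂ := fun z => ((z - c) ^ n)⁻¹ * α z with hu
    set v : ℂ → ℂ := fun z => ((z - c) ^ n)⁻¹ * β z with hv
    have hus : ContDiff ℝ ∞ u := contDiff_inv_pow_mul hα hα0 n
    have hvs : ContDiff ℝ ∞ v := contDiff_inv_pow_mul hβ hβ0 n
    have huc : HasCompactSupport u := hcα.mul_left
    have hvc : HasCompactSupport v := hcβ.mul_left
    have e1 := integral_normSq_le_dzbar hus huc hR.le fun z hz => hsα z (right_ne_zero_of_mul hz)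
    have e2 := integral_normSq_le_dzbar hvs hvc hR.le fun z hz => hsβ z (right_ne_zero_of_mul hz)
    have iu := integrable_normSq hus.continuous huc
    have iv := integrable_normSq hvs.continuous hvc
    have idu := integrable_normSq hus.continuous_dzbar huc.dzbar
    have idv := integrable_normSq hvs.continuous_dzbar hvc.dzbar
    set D : ℝ := M * ((2 / R) ^ n) ^ 2 with hD
    have hD0 : 0 ≤ D := by positivity
    -- Error term for the annulus `R/2 ≤ |z - c| ≤ R`, where the weighted derivatives are merely
    -- bounded.
    set χ : ℂ → ℝ := (Metric.closedBall c R).indicator fun _ => D with hχ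
    have iχ : Integrable χ := (integrable_indicator_iff measurableSet_closedBall).2
      (integrableOn_const (isCompact_closedBall c R).measure_lt_top.ne)
    have hpt : ∀ z, ‖dzbar u z‖ ^ 2 + ‖dzbar v z‖ ^ 2 ≤ K * (‖u z‖ ^ 2 + ‖v z‖ ^ 2) + χ z := by
      intro z
      rw [hu, hv, dzbar_inv_pow_mul hα hα0, dzbar_inv_pow_mul hβ hβ0]
      simp only [norm_mul, mul_pow]
      set q := ‖((z - c) ^ n)⁻¹‖ with hq
      have hq0 : 0 ≤ q := norm_nonneg _
      have hχ0 : 0 ≤ χ z := indicator_nonneg (fun _ _ => hD0) z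
      rcases lt_or_ge ‖z - c‖ (R / 2) with h | h
      · have := mul_le_mul_of_nonneg_left (hle z h) (sq_nonneg q)
        linarith
      rcases le_or_gt ‖z - c‖ R with h' | h'
      · have hχz : χ z = D := indicator_of_mem (by simpa [dist_eq_norm] using h') _
        have hqle : q ≤ (2 / R) ^ n := by
          rw [hq, norm_inv, norm_pow, ← inv_pow]
          refine pow_le_pow_left₀ (by positivity) ?_ n
          rw [inv_le_comm₀ (by linarith) (by positivity), inv_div]
          exact h
        have h1 : q ^ 2 * (‖dzbar α z‖ ^ 2 + ‖dzbar β z‖ ^ 2) ≤ ((2 / R) ^ n) ^ 2 * M :=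
          mul_le_mul (pow_le_pow_left₀ hq0 hqle 2) (hTM z) (by positivity) (by positivity)
        have h2 : 0 ≤ K * (q ^ 2 * ‖α z‖ ^ 2 + q ^ 2 * ‖β z‖ ^ 2) := by positivity
        rw [hχz, hD]
        linarith
      · rw [hdz0 hsα z h', hdz0 hsβ z h']
        have h2 : 0 ≤ K * (q ^ 2 * ‖α z‖ ^ 2 + q ^ 2 * ‖β z‖ ^ 2) := by positivity
        simp only [norm_zero]
        linarith
    have iuv : Integrable fun z => ‖u z‖ ^ 2 + ‖v z‖ ^ 2 := iu.add iv
    have iKuv : Integrable fun z => K * (‖u z‖ ^ 2 + ‖v z‖ ^ 2) := iuv.const_mul K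
    have hI := integral_mono (idu.add idv) (iKuv.add iχ) hpt
    simp only [Pi.add_apply] at hI
    rw [integral_add idu idv, integral_add iKuv iχ, integral_const_mul, integral_add iu iv] at hI
    have hχI : ∫ z, χ z = V * D := by
      rw [hχ, integral_indicator measurableSet_closedBall, setIntegral_const, smul_eq_mul]
    rw [hχI] at hI
    set Iu := ∫ z, ‖u z‖ ^ 2
    set Iv := ∫ z, ‖v z‖ ^ 2
    have hIuv : 0 ≤ Iu + Iv :=
      add_nonneg (integral_nonneg fun z => by positivity) (integral_nonneg fun z => by positivity)
    -- Since `16 R² K ≤ 1/2`, half of the left side absorbs the term with `K`.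
    have hbound : Iu + Iv ≤ 32 * R ^ 2 * (V * D) := by
      have h1 := mul_le_mul_of_nonneg_left hI (by positivity : (0 : ℝ) ≤ 16 * R ^ 2)
      have h2 := mul_le_mul_of_nonneg_right hK hIuv
      linarith
    have hlow : ((4 / R) ^ n) ^ 2 * ∫ z in Metric.ball c (R / 4), S z ≤ Iu + Iv := by
      rw [← integral_const_mul, ← integral_add iu iv]
      refine (setIntegral_mono_on (hSi.integrableOn.const_mul _) (iu.add iv).integrableOn
        measurableSet_ball fun z hz => ?_).trans
        (setIntegral_le_integral (iu.add iv) (ae_of_all _ fun z => ?_))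
      · simp only [hS, hu, hv, norm_mul, mul_pow, Pi.add_apply]
        by_cases hzc : z = c
        · have h1 : α z = 0 := by rw [hzc]; exact hα0.self_of_nhds
          have h2 : β z = 0 := by rw [hzc]; exact hβ0.self_of_nhds
          simp [h1, h2]
        have hzc' : 0 < ‖z - c‖ := norm_pos_iff.2 (sub_ne_zero.2 hzc)
        rw [mem_ball_iff_norm] at hz
        have hq : (4 / R) ^ n ≤ ‖((z - c) ^ n)⁻¹‖ := by
          rw [norm_inv, norm_pow, ← inv_pow]
          refine pow_le_pow_left₀ (by positivity) ?_ n
          rw [le_inv_comm₀ (by positivity) hzc', inv_div]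
          exact hz.le
        have := mul_le_mul_of_nonneg_right (pow_le_pow_left₀ (by positivity) hq 2) (hS0 z)
        simp only [hS] at this
        linarith
      · simp only [Pi.add_apply, Pi.zero_apply]; positivity
    have h4 : ((4 / R) ^ n) ^ 2 = ((2 / R) ^ n) ^ 2 * 4 ^ n := by
      rw [← pow_mul, ← pow_mul, mul_comm n 2, pow_mul, pow_mul, ← mul_pow]
      congr 1; ring
    have hpos : (0 : ℝ) < ((2 / R) ^ n) ^ 2 := by positivity
    rw [hD] at hbound
    rw [h4] at hlow
    have h5 : ((2 / R) ^ n) ^ 2 * (4 ^ n * ∫ z in Metric.ball c (R / 4), S z)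
        ≤ ((2 / R) ^ n) ^ 2 * (32 * R ^ 2 * M * V) := by linarith
    have h6 := le_of_mul_le_mul_left h5 hpos
    rw [one_div, inv_pow, ← div_eq_mul_inv, le_div_iff₀ (by positivity)]
    linarith
  have hlim : Tendsto (fun n : ℕ => (32 * R ^ 2 * M * V) * (1 / 4 : ℝ) ^ n) atTop (𝓝 0) := by
    simpa using (tendsto_pow_atTop_nhds_zero_of_lt_one (r := (1 / 4 : ℝ)) (by norm_num)
      (by norm_num)).const_mul (32 * R ^ 2 * M * V)
  have hzero : ∫ z in Metric.ball c (R / 4), S z = 0 :=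
    le_antisymm (ge_of_tendsto' hlim main) (integral_nonneg hS0)
  have hae := (setIntegral_eq_zero_iff_of_nonneg_ae (ae_of_all _ hS0) hSi.integrableOn).1 hzero
  have heq : EqOn S 0 (Metric.ball c (R / 4)) :=
    Measure.eqOn_open_of_ae_eq hae Metric.isOpen_ball hSc.continuousOn continuousOn_const
  intro z hz
  have h1 : ‖α z‖ ^ 2 + ‖β z‖ ^ 2 = 0 := heq hz
  have h2 : ‖α z‖ ^ 2 = 0 := by nlinarith [sq_nonneg ‖α z‖, sq_nonneg ‖β z‖]
  simpa using h2

/-- Unique continuation for real solutions of `|d_{z z̄}| ≤ C |d|`. -/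
theorem eventually_eq_zero_of_norm_dzbar_dz_le {d : ℂ → ℝ} {c : ℂ} {ρ C : ℝ} (hρ : 0 < ρ)
    (hd : ContDiffOn ℝ ∞ d (Metric.ball c ρ))
    (hC : ∀ z ∈ Metric.ball c ρ, ‖dzbar (dz fun y => (d y : ℂ)) z‖ ≤ C * |d z|)
    (hc : c ∈ closure {z | d =ᶠ[𝓝 z] 0}) : d =ᶠ[𝓝 c] 0 := by
  -- The second-order inequality is treated as a first-order system for the pair `(d, d_z)`: `|d_z̄|
  -- = |d_z|` because `d` is real, and `|(d_z)_z̄| ≤ C |d|`. This explains both entries of the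
  -- maximum.
  set K : ℝ := max 1 (C ^ 2) with hK
  have hK1 : 1 ≤ K := le_max_left _ _
  set R : ℝ := min (ρ / 2) (1 / (8 * K)) with hR
  have hRpos : 0 < R := by positivity
  have hRρ : R ≤ ρ / 2 := min_le_left _ _
  have hRK : R * K ≤ 1 / 8 := by
    have : R ≤ 1 / (8 * K) := min_le_right _ _
    rw [le_div_iff₀ (by positivity)] at this
    linarith
  have hR1 : R ≤ 1 / 8 := by nlinarith
  have hRK2 : 16 * R ^ 2 * K ≤ 1 / 2 := by nlinarith
  -- The estimate is centred not at `c` but at a nearby point `x` around which `d` already vanishes.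
  -- Its conclusion covers a ball of radius `R/4`, which contains `c`.
  obtain ⟨x, hx, hxc⟩ := Metric.mem_closure_iff.1 hc (R / 4) (by positivity)
  have hsub : Metric.closedBall x R ⊆ Metric.ball c ρ := by
    intro z hz
    rw [Metric.mem_closedBall] at hz
    rw [Metric.mem_ball]
    have := dist_triangle z x c
    rw [dist_comm c x] at hxc
    linarith
  set B := Metric.ball c ρ with hB
  have hBo : IsOpen B := Metric.isOpen_ball
  set a : ℂ → ℂ := fun y => (d y : ℂ) with ha
  have has : ContDiffOn ℝ ∞ a B := hd.ofReal
  have hbs : ContDiffOn ℝ ∞ (dz a) B := has.dz hBo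
  let χ : ContDiffBump x := ⟨R / 2, R, by positivity, by linarith⟩
  have hχs : ContDiff ℝ ∞ fun z => ((χ z : ℝ) : ℂ) :=
    Complex.ofRealCLM.contDiff.comp χ.contDiff
  have hsm : ∀ {f : ℂ → ℂ}, ContDiffOn ℝ ∞ f B → ContDiff ℝ ∞ fun z => ((χ z : ℝ) : ℂ) * f z := by
    intro f hf
    rw [contDiff_iff_contDiffAt]
    intro z
    by_cases hz : z ∈ B
    · exact hχs.contDiffAt.mul (hf.contDiffAt (hBo.mem_nhds hz))
    · have hz' : z ∉ tsupport χ := by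
        rw [χ.tsupport_eq]
        exact fun h => hz (hsub h)
      refine (contDiffAt_const (c := (0 : ℂ))).congr_of_eventuallyEq ?_
      filter_upwards [notMem_tsupport_iff_eventuallyEq.1 hz'] with y hy
      simp [hy]
  have hsupp : ∀ {f : ℂ → ℂ} (z : ℂ), ((χ z : ℝ) : ℂ) * f z ≠ 0 → ‖z - x‖ ≤ R := by
    intro f z hz
    have : z ∈ Function.support χ := fun h => hz (by simp [h])
    rw [χ.support_eq] at this
    exact (mem_ball_iff_norm.1 this).le
  have ha0 : a =ᶠ[𝓝 x] 0 := by
    have hx' : d =ᶠ[𝓝 x] 0 := hx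
    filter_upwards [hx'] with y hy
    simp [ha, hy]
  have hb0 : dz a =ᶠ[𝓝 x] 0 := by
    filter_upwards [ha0.eventuallyEq_nhds] with y hy
    rw [dz_congr (g := fun _ => 0) hy]
    simp
  have key := eq_zero_of_normSq_dzbar_le (α := fun z => ((χ z : ℝ) : ℂ) * a z)
    (β := fun z => ((χ z : ℝ) : ℂ) * dz a z) (c := x) hRpos (by positivity) hRK2 (hsm has) (hsm hbs)
    (hsupp (f := a)) (hsupp (f := dz a))
    (by filter_upwards [ha0] with y hy; simp [hy])
    (by filter_upwards [hb0] with y hy; simp [hy]) ?_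
  · have hcx : c ∈ Metric.ball x (R / 4) := hxc
    filter_upwards [Metric.isOpen_ball.mem_nhds hcx] with y hy
    have h1 := key y hy
    have h2 : χ y = 1 := χ.one_of_mem_closedBall (by
      have : dist y x < R / 4 := hy
      show dist y x ≤ R / 2
      linarith)
    simpa [h2, ha] using h1
  · intro z hz
    have hzx : z ∈ Metric.ball x (R / 2) := by rwa [mem_ball_iff_norm]
    have h1 : ∀ᶠ y in 𝓝 z, χ y = 1 := by
      filter_upwards [Metric.isOpen_ball.mem_nhds hzx] with y hy
      exact χ.one_of_mem_closedBall (Metric.ball_subset_closedBall hy)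
    have hcongr : ∀ f : ℂ → ℂ, (fun y => ((χ y : ℝ) : ℂ) * f y) =ᶠ[𝓝 z] f := fun f => by
      filter_upwards [h1] with y hy
      simp [hy]
    have hzB : z ∈ B := hsub (by
      have : dist z x < R / 2 := hzx
      show dist z x ≤ R
      linarith)
    rw [dzbar_congr (hcongr a), dzbar_congr (hcongr (dz a))]
    simp only [h1.self_of_nhds, Complex.ofReal_one, one_mul]
    have e1 : ‖dzbar a z‖ = ‖dz a z‖ := by rw [ha, dzbar_ofReal, RCLike.norm_conj]
    have e2 : ‖dzbar (dz a) z‖ ≤ C * ‖a z‖ := by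
      simpa [ha] using hC z hzB
    have e3 : ‖dzbar (dz a) z‖ ^ 2 ≤ C ^ 2 * ‖a z‖ ^ 2 := by
      rw [← mul_pow]; exact pow_le_pow_left₀ (norm_nonneg _) e2 2
    rw [e1]
    have e4 : C ^ 2 * ‖a z‖ ^ 2 ≤ K * ‖a z‖ ^ 2 := by gcongr; exact le_max_right _ _
    have e5 : 1 * ‖dz a z‖ ^ 2 ≤ K * ‖dz a z‖ ^ 2 := by gcongr
    linarith

end Carleman

/-! ### Scalar and cross product of Minkowski space -/

section LorentzAlgebra

variable {R : Type*} [CommRing R]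

theorem lorentz3_comm (x y : Fin 3 → R) : lorentz3 x y = lorentz3 y x := by
  simp only [lorentz3]; ring

theorem lorentz3_add_left (x y z : Fin 3 → R) :
    lorentz3 (x + y) z = lorentz3 x z + lorentz3 y z := by
  simp only [lorentz3, Pi.add_apply]; ring

theorem lorentz3_add_right (x y z : Fin 3 → R) :
    lorentz3 x (y + z) = lorentz3 x y + lorentz3 x z := by
  simp only [lorentz3, Pi.add_apply]; ring

theorem lorentz3_sub_left (x y z : Fin 3 → R) :
    lorentz3 (x - y) z = lorentz3 x z - lorentz3 y z := by
  simp only [lorentz3, Pi.sub_apply]; ring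

theorem lorentz3_sub_right (x y z : Fin 3 → R) :
    lorentz3 x (y - z) = lorentz3 x y - lorentz3 x z := by
  simp only [lorentz3, Pi.sub_apply]; ring

theorem lorentz3_smul_left (a : R) (x y : Fin 3 → R) :
    lorentz3 (a • x) y = a * lorentz3 x y := by
  simp only [lorentz3, Pi.smul_apply, smul_eq_mul]; ring

theorem lorentz3_smul_right (a : R) (x y : Fin 3 → R) :
    lorentz3 x (a • y) = a * lorentz3 x y := by
  simp only [lorentz3, Pi.smul_apply, smul_eq_mul]; ring

/-- The cross product of Minkowski space. -/
def lcross (x y : Fin 3 → R) : Fin 3 → R :=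
  ![-(x 1 * y 2 - x 2 * y 1), x 2 * y 0 - x 0 * y 2, x 0 * y 1 - x 1 * y 0]

@[simp] theorem lcross_zero_apply (x y : Fin 3 → R) :
    lcross x y 0 = -(x 1 * y 2 - x 2 * y 1) := rfl

@[simp] theorem lcross_one_apply (x y : Fin 3 → R) : lcross x y 1 = x 2 * y 0 - x 0 * y 2 := rfl

@[simp] theorem lcross_two_apply (x y : Fin 3 → R) : lcross x y 2 = x 0 * y 1 - x 1 * y 0 := rfl

theorem lorentz3_lcross_lcross (g x y : Fin 3 → R) :
    lorentz3 (lcross g x) (lcross g y)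
      = lorentz3 g x * lorentz3 g y - lorentz3 g g * lorentz3 x y := by
  simp only [lorentz3, lcross_zero_apply, lcross_one_apply, lcross_two_apply]; ring

theorem lorentz3_lcross_swap (g x y : Fin 3 → R) :
    lorentz3 (lcross g x) y = -lorentz3 x (lcross g y) := by
  simp only [lorentz3, lcross_zero_apply, lcross_one_apply, lcross_two_apply]; ring

theorem lorentz3_lcross_self (g x : Fin 3 → R) : lorentz3 x (lcross g x) = 0 := by
  simp only [lorentz3, lcross_zero_apply, lcross_one_apply, lcross_two_apply]; ring

theorem lorentz3_self_lcross (g x : Fin 3 → R) : lorentz3 g (lcross g x) = 0 := by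
  simp only [lorentz3, lcross_zero_apply, lcross_one_apply, lcross_two_apply]; ring

/-- The square of the determinant is minus the Gram determinant. -/
theorem sq_lorentz3_lcross (x g y : Fin 3 → R) :
    lorentz3 x (lcross g y) ^ 2 = -(lorentz3 x x * (lorentz3 g g * lorentz3 y y - lorentz3 g y ^ 2)
      - lorentz3 x g * (lorentz3 x g * lorentz3 y y - lorentz3 g y * lorentz3 x y)
      + lorentz3 x y * (lorentz3 x g * lorentz3 g y - lorentz3 g g * lorentz3 x y)) := by
  simp only [lorentz3, lcross_zero_apply, lcross_one_apply, lcross_two_apply]; ring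

theorem lcross_expand (g x y : Fin 3 → R) (i : Fin 3) :
    lorentz3 g g * lcross x y i + lorentz3 g x * lcross y g i + lorentz3 g y * lcross g x i
      = lorentz3 (lcross x y) g * g i := by
  fin_cases i <;>
    simp [lorentz3] <;> ring

/-- Cramer's rule. -/
theorem lorentz3_lcross_mul_apply (v a b c : Fin 3 → R) (i : Fin 3) :
    lorentz3 (lcross a b) c * v i = lorentz3 v a * lcross b c i + lorentz3 v b * lcross c a i
      + lorentz3 v c * lcross a b i := by
  fin_cases i <;>
    simp [lorentz3] <;> ring

end LorentzAlgebra

/-! ### Splitting of tangent vectors into isotropic parts -/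

section NullParts

open ComplexConjugate

/-- Half of `X - j g × X`; for `j = ± i` and `X` orthogonal to the timelike unit vector `g` this
is one of the two isotropic parts of `X`. -/
def nullPart (j : ℂ) (g X : Fin 3 → ℂ) : Fin 3 → ℂ := fun i => (X i - j * lcross g X i) / 2

theorem nullPart_add_nullPart_neg (j : ℂ) (g X : Fin 3 → ℂ) :
    nullPart j g X + nullPart (-j) g X = X := by
  ext i; simp only [Pi.add_apply, nullPart]; ring

theorem nullPart_smul (j c : ℂ) (g X : Fin 3 → ℂ) :
    nullPart j g (c • X) = c • nullPart j g X := by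
  ext i
  fin_cases i <;> simp [nullPart] <;> ring

variable {j : ℂ} {g X Y : Fin 3 → ℂ}

theorem lorentz3_nullPart_self (hgX : lorentz3 g X = 0) : lorentz3 (nullPart j g X) g = 0 := by
  have h : lorentz3 (nullPart j g X) g
      = (lorentz3 g X - j * lorentz3 g (lcross g X)) / 2 := by
    simp only [lorentz3, nullPart]; ring
  rw [h, hgX, lorentz3_self_lcross]; ring

/-- On the complement of the timelike unit vector `g`, the map `g ×` is a skew isometry. All
products of isotropic parts are the cases `a, b = ± j`. -/
theorem lorentz3_nullPart_nullPart (hg : lorentz3 g g = -1) (hgX : lorentz3 g X = 0) (a b : ℂ) :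
    lorentz3 (nullPart a g X) (nullPart b g Y)
      = ((1 + a * b) * lorentz3 X Y + (a - b) * lorentz3 X (lcross g Y)) / 4 := by
  have h : lorentz3 (nullPart a g X) (nullPart b g Y) = (lorentz3 X Y - b * lorentz3 X (lcross g Y)
      - a * lorentz3 (lcross g X) Y + a * b * lorentz3 (lcross g X) (lcross g Y)) / 4 := by
    simp only [lorentz3, nullPart]; ring
  rw [h, lorentz3_lcross_lcross, lorentz3_lcross_swap, hg, hgX]; ring

theorem lorentz3_nullPart_same (hj : j ^ 2 = -1) (hg : lorentz3 g g = -1)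
    (hgX : lorentz3 g X = 0) : lorentz3 (nullPart j g X) (nullPart j g Y) = 0 := by
  rw [lorentz3_nullPart_nullPart hg hgX]; linear_combination (lorentz3 X Y / 4) * hj

theorem lorentz3_nullPart_neg (hj : j ^ 2 = -1) (hg : lorentz3 g g = -1)
    (hgX : lorentz3 g X = 0) :
    lorentz3 (nullPart j g X) (nullPart (-j) g X) = lorentz3 X X / 2 := by
  rw [lorentz3_nullPart_nullPart hg hgX, lorentz3_lcross_self]
  linear_combination (-lorentz3 X X / 4) * hj

theorem lorentz3_nullPart_neg' (hj : j ^ 2 = -1) (hg : lorentz3 g g = -1)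
    (hgX : lorentz3 g X = 0) :
    lorentz3 (nullPart j g X) (nullPart (-j) g Y)
      = (lorentz3 X Y + j * lorentz3 X (lcross g Y)) / 2 := by
  rw [lorentz3_nullPart_nullPart hg hgX]
  linear_combination (-lorentz3 X Y / 4) * hj

theorem nullPart_norms_add (hj : j ^ 2 = -1) (hg : lorentz3 g g = -1) (hgX : lorentz3 g X = 0) :
    lorentz3 (nullPart j g X) (nullPart (-j) g Y) + lorentz3 (nullPart (-j) g X) (nullPart j g Y)
      = lorentz3 X Y := by
  have h := lorentz3_nullPart_neg' (Y := Y) (j := -j) (by rw [neg_sq, hj]) hg hgX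
  rw [neg_neg] at h
  rw [lorentz3_nullPart_neg' hj hg hgX, h]; ring

/-- With `D = ⟨X, g × Y⟩` the product is `(⟨X, Y⟩² + D²) / 4`, and the Gram determinant evaluates
`D²` as `⟨X, X⟩⟨Y, Y⟩ - ⟨X, Y⟩²`. -/
theorem nullPart_norms_mul (hj : j ^ 2 = -1) (hg : lorentz3 g g = -1) (hgX : lorentz3 g X = 0)
    (hgY : lorentz3 g Y = 0) :
    lorentz3 (nullPart j g X) (nullPart (-j) g Y) * lorentz3 (nullPart (-j) g X) (nullPart j g Y)
      = lorentz3 X X * lorentz3 Y Y / 4 := by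
  have h := lorentz3_nullPart_neg' (Y := Y) (j := -j) (by rw [neg_sq, hj]) hg hgX
  rw [neg_neg] at h
  rw [lorentz3_nullPart_neg' hj hg hgX, h]
  have h2 := sq_lorentz3_lcross X g Y
  rw [hg, hgY, lorentz3_comm X g, hgX] at h2
  linear_combination h2 / 4 - (lorentz3 X (lcross g Y) ^ 2 / 4) * hj

theorem lcross_eq_of_orthogonal (hg : lorentz3 g g = -1) (hgX : lorentz3 g X = 0)
    (hgY : lorentz3 g Y = 0) (i : Fin 3) : lcross Y X i = -lorentz3 X (lcross g Y) * g i := by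
  have h := lcross_expand g Y X i
  rw [hg, hgX, hgY] at h
  have h2 : lorentz3 (lcross Y X) g = lorentz3 X (lcross g Y) := by
    simp only [lorentz3, lcross_zero_apply, lcross_one_apply, lcross_two_apply]; ring
  rw [h2] at h
  linear_combination -h

/-- Expansion in the frame of two isotropic vectors and a timelike unit vector. -/
theorem frame_expand {P P' : Fin 3 → ℂ} {A : ℂ} (hA : A ≠ 0) (hPP : lorentz3 P P = 0)
    (hPP' : lorentz3 P' P' = 0) (h : lorentz3 P P' = A) (hPg : lorentz3 P g = 0)
    (hP'g : lorentz3 P' g = 0) (hg : lorentz3 g g = -1) (V : Fin 3 → ℂ) (i : Fin 3) :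
    V i = lorentz3 V P' / A * P i + lorentz3 V P / A * P' i - lorentz3 V g * g i := by
  -- The difference of the two sides is orthogonal to `P`, `P'` and `g`. Their determinant has
  -- square `-A² ≠ 0`, so Cramer's rule annihilates it.
  set W : Fin 3 → ℂ := V - ((lorentz3 V P' / A) • P + (lorentz3 V P / A) • P' - lorentz3 V g • g)
    with hW
  have h1 : lorentz3 W P = 0 := by
    rw [hW]
    simp only [lorentz3_sub_left, lorentz3_add_left, lorentz3_smul_left, hPP, lorentz3_comm P' P,
      lorentz3_comm g P, h, hPg]
    field_simp; ring
  have h2 : lorentz3 W P' = 0 := by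
    rw [hW]
    simp only [lorentz3_sub_left, lorentz3_add_left, lorentz3_smul_left, hPP',
      lorentz3_comm g P', h, hP'g]
    field_simp; ring
  have h3 : lorentz3 W g = 0 := by
    rw [hW]
    simp only [lorentz3_sub_left, lorentz3_add_left, lorentz3_smul_left, hPg, hP'g, hg]
    ring
  have hdet : lorentz3 (lcross P P') g ^ 2 = -A ^ 2 := by
    have := sq_lorentz3_lcross g P P'
    rw [lorentz3_comm g P, lorentz3_comm g P', hPP, hPP', h, hPg, hP'g, hg] at this
    rw [lorentz3_comm, this]; ring
  have hdet0 : lorentz3 (lcross P P') g ≠ 0 := by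
    intro h0
    rw [h0] at hdet
    exact hA (by simpa using hdet)
  have := lorentz3_lcross_mul_apply W P P' g i
  rw [h1, h2, h3] at this
  have hWi : W i = 0 := by simpa [hdet0] using this
  simp only [hW, Pi.sub_apply, Pi.add_apply, Pi.smul_apply, smul_eq_mul] at hWi
  linear_combination hWi

end NullParts

/-! ### Wirtinger derivatives of vector-valued maps -/

section VectorWirtinger

open ComplexConjugate

/-- A real vector, seen as a complex one. -/
def ofRealVec (v : Fin 3 → ℝ) : Fin 3 → ℂ := fun i => (v i : ℂ)

/-- Componentwise complex conjugation. -/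
def conjVec (X : Fin 3 → ℂ) : Fin 3 → ℂ := fun i => conj (X i)

@[simp] theorem ofRealVec_apply (v : Fin 3 → ℝ) (i : Fin 3) : ofRealVec v i = (v i : ℂ) := rfl

@[simp] theorem conjVec_apply (X : Fin 3 → ℂ) (i : Fin 3) : conjVec X i = conj (X i) := rfl

@[simp] theorem conjVec_conjVec (X : Fin 3 → ℂ) : conjVec (conjVec X) = X := by ext i; simp

@[simp] theorem conjVec_ofRealVec (v : Fin 3 → ℝ) : conjVec (ofRealVec v) = ofRealVec v := by
  ext i; simp

theorem lorentz3_ofRealVec (x y : Fin 3 → ℝ) :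
    lorentz3 (ofRealVec x) (ofRealVec y) = ((lorentz3 x y : ℝ) : ℂ) := by
  simp [lorentz3]

theorem lorentz3_conjVec (X Y : Fin 3 → ℂ) :
    lorentz3 (conjVec X) (conjVec Y) = conj (lorentz3 X Y) := by
  simp [lorentz3]

theorem lorentz3_conjVec_ofRealVec (X : Fin 3 → ℂ) (v : Fin 3 → ℝ) :
    lorentz3 (conjVec X) (ofRealVec v) = conj (lorentz3 X (ofRealVec v)) := by
  rw [← lorentz3_conjVec, conjVec_ofRealVec]

theorem lorentz3_ofRealVec_conjVec (v : Fin 3 → ℝ) (X : Fin 3 → ℂ) :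
    lorentz3 (ofRealVec v) (conjVec X) = conj (lorentz3 (ofRealVec v) X) := by
  rw [← lorentz3_conjVec, conjVec_ofRealVec]

theorem conjVec_nullPart {j : ℂ} (hj : conj j = -j) (v : Fin 3 → ℝ) (X : Fin 3 → ℂ) :
    conjVec (nullPart j (ofRealVec v) X) = nullPart (-j) (ofRealVec v) (conjVec X) := by
  ext i
  fin_cases i <;> simp [nullPart, hj, map_ofNat]

/-- Componentwise `∂/∂z`. -/
def vdz (F : ℂ → Fin 3 → ℂ) (w : ℂ) : Fin 3 → ℂ := fun i => dz (fun y => F y i) w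

/-- Componentwise `∂/∂z̄`. -/
def vdzbar (F : ℂ → Fin 3 → ℂ) (w : ℂ) : Fin 3 → ℂ := fun i => dzbar (fun y => F y i) w

variable {F H : ℂ → Fin 3 → ℂ} {w : ℂ} {Ω : Set ℂ}

theorem dz_lorentz3 (hF : ∀ i, DifferentiableAt ℝ (fun y => F y i) w)
    (hH : ∀ i, DifferentiableAt ℝ (fun y => H y i) w) :
    dz (fun y => lorentz3 (F y) (H y)) w = lorentz3 (vdz F w) (H w) + lorentz3 (F w) (vdz H w) := by
  have h0 := (hF 0).fun_mul (hH 0)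
  have h1 := (hF 1).fun_mul (hH 1)
  have h2 := (hF 2).fun_mul (hH 2)
  simp only [lorentz3, vdz]
  rw [dz_add (h0.fun_neg.fun_add h1) h2, dz_add h0.fun_neg h1, dz_neg, dz_mul (hF 0) (hH 0),
    dz_mul (hF 1) (hH 1), dz_mul (hF 2) (hH 2)]
  ring

theorem dzbar_lorentz3 (hF : ∀ i, DifferentiableAt ℝ (fun y => F y i) w)
    (hH : ∀ i, DifferentiableAt ℝ (fun y => H y i) w) :
    dzbar (fun y => lorentz3 (F y) (H y)) w
      = lorentz3 (vdzbar F w) (H w) + lorentz3 (F w) (vdzbar H w) := by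
  have h0 := (hF 0).fun_mul (hH 0)
  have h1 := (hF 1).fun_mul (hH 1)
  have h2 := (hF 2).fun_mul (hH 2)
  simp only [lorentz3, vdzbar]
  rw [dzbar_add (h0.fun_neg.fun_add h1) h2, dzbar_add h0.fun_neg h1, dzbar_neg,
    dzbar_mul (hF 0) (hH 0), dzbar_mul (hF 1) (hH 1), dzbar_mul (hF 2) (hH 2)]
  ring

theorem vdzbar_nullPart (j : ℂ) (hF : ∀ i, DifferentiableAt ℝ (fun y => F y i) w)
    (hH : ∀ i, DifferentiableAt ℝ (fun y => H y i) w) (i : Fin 3) :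
    vdzbar (fun y => nullPart j (F y) (H y)) w i
      = (vdzbar H w i - j * (lcross (vdzbar F w) (H w) i + lcross (F w) (vdzbar H w) i)) / 2 := by
  -- All three components have this shape. The sign in the time component of the cross product is
  -- taken care of by using `(k, l) = (2, 1)` there.
  have key : ∀ k l m : Fin 3, dzbar (fun y => (H y m - j * (F y k * H y l - F y l * H y k)) / 2) w
      = (dzbar (fun y => H y m) w - j * ((dzbar (fun y => F y k) w * H w l
        + F w k * dzbar (fun y => H y l) w) - (dzbar (fun y => F y l) w * H w k
        + F w l * dzbar (fun y => H y k) w))) / 2 := by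
    intro k l m
    have e : (fun y => (H y m - j * (F y k * H y l - F y l * H y k)) / 2)
        = fun y => (1 / 2 : ℂ) * (H y m - j * (F y k * H y l - F y l * H y k)) := by
      ext y; ring
    have d1 := (hF k).fun_mul (hH l)
    have d2 := (hF l).fun_mul (hH k)
    rw [e, dzbar_const_mul _ ((hH m).fun_sub ((d1.fun_sub d2).const_mul j)),
      dzbar_sub (hH m) ((d1.fun_sub d2).const_mul j), dzbar_const_mul _ (d1.fun_sub d2),
      dzbar_sub d1 d2, dzbar_mul (hF k) (hH l), dzbar_mul (hF l) (hH k)]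
    ring
  fin_cases i
  · have e : (fun y => nullPart j (F y) (H y) 0)
        = fun y => (H y 0 - j * (F y 2 * H y 1 - F y 1 * H y 2)) / 2 := by
      ext y; simp [nullPart]
    show dzbar (fun y => nullPart j (F y) (H y) 0) w
      = (vdzbar H w 0 - j * (lcross (vdzbar F w) (H w) 0 + lcross (F w) (vdzbar H w) 0)) / 2
    rw [e, key]
    simp only [vdzbar, lcross_zero_apply]; ring
  · show dzbar (fun y => (H y 1 - j * (F y 2 * H y 0 - F y 0 * H y 2)) / 2) w
      = (vdzbar H w 1 - j * (lcross (vdzbar F w) (H w) 1 + lcross (F w) (vdzbar H w) 1)) / 2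
    rw [key]
    simp only [vdzbar, lcross_one_apply]; ring
  · show dzbar (fun y => (H y 2 - j * (F y 0 * H y 1 - F y 1 * H y 0)) / 2) w
      = (vdzbar H w 2 - j * (lcross (vdzbar F w) (H w) 2 + lcross (F w) (vdzbar H w) 2)) / 2
    rw [key]
    simp only [vdzbar, lcross_two_apply]; ring

theorem vdz_conjVec (F : ℂ → Fin 3 → ℂ) (w : ℂ) :
    vdz (fun y => conjVec (F y)) w = conjVec (vdzbar F w) := by
  ext i; exact dz_conj _ _

theorem vdzbar_conjVec (F : ℂ → Fin 3 → ℂ) (w : ℂ) :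
    vdzbar (fun y => conjVec (F y)) w = conjVec (vdz F w) := by
  ext i; exact dzbar_conj _ _

theorem vdzbar_ofRealVec (g : ℂ → Fin 3 → ℝ) (w : ℂ) :
    vdzbar (fun y => ofRealVec (g y)) w = conjVec (vdz (fun y => ofRealVec (g y)) w) := by
  ext i; exact dzbar_ofReal _ _

theorem ContDiffOn.lorentz3 (hF : ∀ i, ContDiffOn ℝ ∞ (fun y => F y i) Ω)
    (hH : ∀ i, ContDiffOn ℝ ∞ (fun y => H y i) Ω) :
    ContDiffOn ℝ ∞ (fun y => _root_.lorentz3 (F y) (H y)) Ω := by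
  unfold _root_.lorentz3
  exact (((hF 0).mul (hH 0)).neg.add ((hF 1).mul (hH 1))).add ((hF 2).mul (hH 2))

theorem ContDiffOn.nullPart (j : ℂ) (hF : ∀ i, ContDiffOn ℝ ∞ (fun y => F y i) Ω)
    (hH : ∀ i, ContDiffOn ℝ ∞ (fun y => H y i) Ω) (i : Fin 3) :
    ContDiffOn ℝ ∞ (fun y => _root_.nullPart j (F y) (H y) i) Ω := by
  have hc : ContDiffOn ℝ ∞ (fun y => lcross (F y) (H y) i) Ω := by
    fin_cases i
    · exact (((hF 1).mul (hH 2)).sub ((hF 2).mul (hH 1))).neg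
    · exact ((hF 2).mul (hH 0)).sub ((hF 0).mul (hH 2))
    · exact ((hF 0).mul (hH 1)).sub ((hF 1).mul (hH 0))
  exact ((hH i).sub (contDiffOn_const.mul hc)).div_const 2

end VectorWirtinger

/-! ### Isotropic parts of a harmonic map and the Bochner formula -/

section LocalHarmonic

open ComplexConjugate

/-- A smooth harmonic map from an open subset of `ℂ` to the hyperboloid `⟨g, g⟩ = -1`. -/
structure IsLocalHarmonic (Ω : Set ℂ) (g : ℂ → Fin 3 → ℝ) : Prop where
  isOpen : IsOpen Ω
  smooth : ∀ i, ContDiffOn ℝ ∞ (fun w => g w i) Ω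
  unit : ∀ w ∈ Ω, lorentz3 (g w) (g w) = -1
  harmonic : ∀ w ∈ Ω, vdzbar (vdz fun y => ofRealVec (g y)) w
    = lorentz3 (vdz (fun y => ofRealVec (g y)) w) (vdzbar (fun y => ofRealVec (g y)) w)
      • ofRealVec (g w)

/-- An isotropic part of `g_z`. -/
def isoPart (j : ℂ) (g : ℂ → Fin 3 → ℝ) (w : ℂ) : Fin 3 → ℂ :=
  nullPart j (ofRealVec (g w)) (vdz (fun y => ofRealVec (g y)) w)

/-- The squared length of an isotropic part of `g_z`. -/
def isoNorm (j : ℂ) (g : ℂ → Fin 3 → ℝ) (w : ℂ) : ℝ :=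
  (lorentz3 (isoPart j g w) (conjVec (isoPart j g w))).re

theorem ofReal_isoNorm (j : ℂ) (g : ℂ → Fin 3 → ℝ) (w : ℂ) :
    (isoNorm j g w : ℂ) = lorentz3 (isoPart j g w) (conjVec (isoPart j g w)) := by
  have h : conj (lorentz3 (isoPart j g w) (conjVec (isoPart j g w)))
      = lorentz3 (isoPart j g w) (conjVec (isoPart j g w)) := by
    rw [← lorentz3_conjVec, conjVec_conjVec, lorentz3_comm]
  exact Complex.conj_eq_iff_re.1 h

theorem isoPart_add_isoPart_neg (j : ℂ) (g : ℂ → Fin 3 → ℝ) (w : ℂ) :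
    isoPart j g w + isoPart (-j) g w = vdz (fun y => ofRealVec (g y)) w :=
  nullPart_add_nullPart_neg _ _ _

namespace IsLocalHarmonic

variable {Ω : Set ℂ} {g : ℂ → Fin 3 → ℝ} {w : ℂ} {j : ℂ}

theorem contDiffOn_ofRealVec (h : IsLocalHarmonic Ω g) (i : Fin 3) :
    ContDiffOn ℝ ∞ (fun w => ofRealVec (g w) i) Ω := (h.smooth i).ofReal

theorem contDiffOn_vdz (h : IsLocalHarmonic Ω g) (i : Fin 3) :
    ContDiffOn ℝ ∞ (fun w => vdz (fun y => ofRealVec (g y)) w i) Ω :=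
  (h.contDiffOn_ofRealVec i).dz h.isOpen

theorem contDiffOn_isoPart (h : IsLocalHarmonic Ω g) (j : ℂ) (i : Fin 3) :
    ContDiffOn ℝ ∞ (fun w => isoPart j g w i) Ω :=
  ContDiffOn.nullPart j h.contDiffOn_ofRealVec h.contDiffOn_vdz i

theorem contDiffOn_isoNorm (h : IsLocalHarmonic Ω g) (j : ℂ) :
    ContDiffOn ℝ ∞ (isoNorm j g) Ω :=
  Complex.reCLM.contDiff.comp_contDiffOn (ContDiffOn.lorentz3 (h.contDiffOn_isoPart j)
    fun i => (h.contDiffOn_isoPart j i).conj)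

theorem diff_ofRealVec (h : IsLocalHarmonic Ω g) (hw : w ∈ Ω) (i : Fin 3) :
    DifferentiableAt ℝ (fun w => ofRealVec (g w) i) w :=
  (h.contDiffOn_ofRealVec i).differentiableAt_of_isOpen h.isOpen hw

theorem diff_vdz (h : IsLocalHarmonic Ω g) (hw : w ∈ Ω) (i : Fin 3) :
    DifferentiableAt ℝ (fun w => vdz (fun y => ofRealVec (g y)) w i) w :=
  (h.contDiffOn_vdz i).differentiableAt_of_isOpen h.isOpen hw

theorem diff_isoPart (h : IsLocalHarmonic Ω g) (hw : w ∈ Ω) (j : ℂ) (i : Fin 3) :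
    DifferentiableAt ℝ (fun w => isoPart j g w i) w :=
  (h.contDiffOn_isoPart j i).differentiableAt_of_isOpen h.isOpen hw

theorem diff_conj_isoPart (h : IsLocalHarmonic Ω g) (hw : w ∈ Ω) (j : ℂ) (i : Fin 3) :
    DifferentiableAt ℝ (fun w => conjVec (isoPart j g w) i) w :=
  differentiableAt_conj (h.diff_isoPart hw j i)

theorem lorentz3_ofRealVec_self (h : IsLocalHarmonic Ω g) (hw : w ∈ Ω) :
    lorentz3 (ofRealVec (g w)) (ofRealVec (g w)) = -1 := by
  rw [lorentz3_ofRealVec, h.unit w hw]; simp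

theorem lorentz3_vdz (h : IsLocalHarmonic Ω g) (hw : w ∈ Ω) :
    lorentz3 (ofRealVec (g w)) (vdz (fun y => ofRealVec (g y)) w) = 0 := by
  have h1 : dz (fun y => lorentz3 (ofRealVec (g y)) (ofRealVec (g y))) w = 0 := by
    rw [dz_congr (g := fun _ => -1) ?_, dz_const]
    filter_upwards [h.isOpen.mem_nhds hw] with y hy
    exact h.lorentz3_ofRealVec_self hy
  rw [dz_lorentz3 (h.diff_ofRealVec hw) (h.diff_ofRealVec hw), lorentz3_comm] at h1
  linear_combination h1 / 2

theorem lorentz3_conj_vdz (h : IsLocalHarmonic Ω g) (hw : w ∈ Ω) :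
    lorentz3 (ofRealVec (g w)) (conjVec (vdz (fun y => ofRealVec (g y)) w)) = 0 := by
  rw [lorentz3_ofRealVec_conjVec, h.lorentz3_vdz hw, map_zero]

theorem lorentz3_isoPart_self (h : IsLocalHarmonic Ω g) (hj : j ^ 2 = -1) (hw : w ∈ Ω) :
    lorentz3 (isoPart j g w) (isoPart j g w) = 0 :=
  lorentz3_nullPart_same hj (h.lorentz3_ofRealVec_self hw) (h.lorentz3_vdz hw)

theorem lorentz3_conj_isoPart_self (h : IsLocalHarmonic Ω g) (hj : j ^ 2 = -1) (hw : w ∈ Ω) :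
    lorentz3 (conjVec (isoPart j g w)) (conjVec (isoPart j g w)) = 0 := by
  rw [lorentz3_conjVec, h.lorentz3_isoPart_self hj hw, map_zero]

theorem lorentz3_isoPart_ofRealVec (h : IsLocalHarmonic Ω g) (hw : w ∈ Ω) (j : ℂ) :
    lorentz3 (isoPart j g w) (ofRealVec (g w)) = 0 :=
  lorentz3_nullPart_self (h.lorentz3_vdz hw)

theorem lorentz3_conj_isoPart_ofRealVec (h : IsLocalHarmonic Ω g) (hw : w ∈ Ω) (j : ℂ) :
    lorentz3 (conjVec (isoPart j g w)) (ofRealVec (g w)) = 0 := by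
  rw [lorentz3_conjVec_ofRealVec, h.lorentz3_isoPart_ofRealVec hw, map_zero]

theorem lorentz3_isoPart_neg (h : IsLocalHarmonic Ω g) (hj : j ^ 2 = -1) (hw : w ∈ Ω) :
    lorentz3 (isoPart j g w) (isoPart (-j) g w)
      = lorentz3 (vdz (fun y => ofRealVec (g y)) w) (vdz (fun y => ofRealVec (g y)) w) / 2 :=
  lorentz3_nullPart_neg hj (h.lorentz3_ofRealVec_self hw) (h.lorentz3_vdz hw)

theorem lorentz3_isoPart_neg_conj (h : IsLocalHarmonic Ω g) (hj : j ^ 2 = -1) (hjc : conj j = -j)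
    (hw : w ∈ Ω) : lorentz3 (isoPart (-j) g w) (conjVec (isoPart j g w)) = 0 := by
  rw [isoPart, isoPart, conjVec_nullPart hjc]
  exact lorentz3_nullPart_same (by rw [neg_sq, hj]) (h.lorentz3_ofRealVec_self hw)
    (h.lorentz3_vdz hw)

theorem lorentz3_isoPart_conj_neg (h : IsLocalHarmonic Ω g) (hj : j ^ 2 = -1) (hjc : conj j = -j)
    (hw : w ∈ Ω) : lorentz3 (isoPart j g w) (conjVec (isoPart (-j) g w)) = 0 := by
  have := h.lorentz3_isoPart_neg_conj (j := -j) (by rw [neg_sq, hj]) (by rw [map_neg, hjc]) hw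
  rwa [neg_neg] at this

theorem isoNorm_add (h : IsLocalHarmonic Ω g) (hj : j ^ 2 = -1) (hjc : conj j = -j) (hw : w ∈ Ω) :
    (isoNorm j g w : ℂ) + isoNorm (-j) g w = lorentz3 (vdz (fun y => ofRealVec (g y)) w)
      (conjVec (vdz (fun y => ofRealVec (g y)) w)) := by
  rw [ofReal_isoNorm, ofReal_isoNorm, isoPart, isoPart, conjVec_nullPart hjc,
    conjVec_nullPart (by rw [map_neg, hjc]), neg_neg]
  exact nullPart_norms_add hj (h.lorentz3_ofRealVec_self hw) (h.lorentz3_vdz hw)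

theorem isoNorm_mul (h : IsLocalHarmonic Ω g) (hj : j ^ 2 = -1) (hjc : conj j = -j) (hw : w ∈ Ω) :
    isoNorm j g w * isoNorm (-j) g w
      = ‖lorentz3 (vdz (fun y => ofRealVec (g y)) w) (vdz (fun y => ofRealVec (g y)) w)‖ ^ 2
        / 4 := by
  have h1 : ((isoNorm j g w * isoNorm (-j) g w : ℝ) : ℂ)
      = ((‖lorentz3 (vdz (fun y => ofRealVec (g y)) w) (vdz (fun y => ofRealVec (g y)) w)‖ ^ 2
        / 4 : ℝ) : ℂ) := by
    push_cast
    rw [← Complex.mul_conj', ← lorentz3_conjVec, ofReal_isoNorm, ofReal_isoNorm, isoPart, isoPart,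
      conjVec_nullPart hjc, conjVec_nullPart (by rw [map_neg, hjc]), neg_neg]
    exact nullPart_norms_mul hj (h.lorentz3_ofRealVec_self hw) (h.lorentz3_vdz hw)
      (h.lorentz3_conj_vdz hw)
  exact_mod_cast h1

/-- `P_z̄ = ⟨P, P̄⟩ g`. -/
theorem vdzbar_isoPart (h : IsLocalHarmonic Ω g) (hj : j ^ 2 = -1) (hjc : conj j = -j)
    (hw : w ∈ Ω) : vdzbar (isoPart j g) w = (isoNorm j g w : ℂ) • ofRealVec (g w) := by
  ext i
  have h1 := vdzbar_nullPart j (h.diff_ofRealVec hw) (h.diff_vdz hw) i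
  have h2 : vdzbar (isoPart j g) w i = vdzbar (fun y => nullPart j (ofRealVec (g y))
      (vdz (fun y => ofRealVec (g y)) y)) w i := rfl
  -- By harmonicity `g_{zz̄}` is a multiple of `g`, so its cross product with `g` is zero. What
  -- remains, `g_z̄ × g_z`, is also a multiple of `g`, both factors being orthogonal to `g`.
  rw [h2, h1, h.harmonic w hw, vdzbar_ofRealVec, ofReal_isoNorm, isoPart, conjVec_nullPart hjc,
    lorentz3_nullPart_neg' hj (h.lorentz3_ofRealVec_self hw) (h.lorentz3_vdz hw),
    lcross_eq_of_orthogonal (h.lorentz3_ofRealVec_self hw) (h.lorentz3_vdz hw)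
      (h.lorentz3_conj_vdz hw)]
  have h3 : ∀ c : ℂ, lcross (ofRealVec (g w)) (c • ofRealVec (g w)) i = 0 := by
    intro c
    fin_cases i <;> simp <;> ring
  rw [h3]
  simp only [Pi.smul_apply, smul_eq_mul]
  ring

theorem vdz_conj_isoPart (h : IsLocalHarmonic Ω g) (hj : j ^ 2 = -1) (hjc : conj j = -j)
    (hw : w ∈ Ω) :
    vdz (fun y => conjVec (isoPart j g y)) w = (isoNorm j g w : ℂ) • ofRealVec (g w) := by
  rw [vdz_conjVec, h.vdzbar_isoPart hj hjc hw]
  ext i; simp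

theorem lorentz3_vdz_isoPart (h : IsLocalHarmonic Ω g) (hj : j ^ 2 = -1)
    (hw : w ∈ Ω) : lorentz3 (vdz (isoPart j g) w) (isoPart j g w) = 0 := by
  have h1 : dz (fun y => lorentz3 (isoPart j g y) (isoPart j g y)) w = 0 := by
    rw [dz_congr (g := fun _ => 0) ?_, dz_const]
    filter_upwards [h.isOpen.mem_nhds hw] with y hy
    exact h.lorentz3_isoPart_self hj hy
  rw [dz_lorentz3 (h.diff_isoPart hw j) (h.diff_isoPart hw j),
    lorentz3_comm (isoPart j g w)] at h1
  linear_combination h1 / 2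

theorem lorentz3_vdz_isoPart_ofRealVec (h : IsLocalHarmonic Ω g) (hj : j ^ 2 = -1)
    (hw : w ∈ Ω) : lorentz3 (vdz (isoPart j g) w) (ofRealVec (g w))
      = -(lorentz3 (vdz (fun y => ofRealVec (g y)) w) (vdz (fun y => ofRealVec (g y)) w) / 2) := by
  have h1 : dz (fun y => lorentz3 (isoPart j g y) (ofRealVec (g y))) w = 0 := by
    rw [dz_congr (g := fun _ => 0) ?_, dz_const]
    filter_upwards [h.isOpen.mem_nhds hw] with y hy
    exact h.lorentz3_isoPart_ofRealVec hy j
  rw [dz_lorentz3 (h.diff_isoPart hw j) (h.diff_ofRealVec hw)] at h1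
  have h2 : lorentz3 (isoPart j g w) (vdz (fun y => ofRealVec (g y)) w)
      = lorentz3 (vdz (fun y => ofRealVec (g y)) w) (vdz (fun y => ofRealVec (g y)) w) / 2 := by
    conv_lhs => rw [← isoPart_add_isoPart_neg j g w]
    rw [lorentz3_add_right, h.lorentz3_isoPart_self hj hw, h.lorentz3_isoPart_neg hj hw, zero_add]
  rw [h2] at h1
  linear_combination h1

/-- The `z`-derivative of `P̄` is a multiple of `g`, hence orthogonal to `P`; only `P_z`
contributes. -/
theorem dz_isoNorm (h : IsLocalHarmonic Ω g) (hj : j ^ 2 = -1) (hjc : conj j = -j) (hw : w ∈ Ω) :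
    dz (fun y => (isoNorm j g y : ℂ)) w
      = lorentz3 (vdz (isoPart j g) w) (conjVec (isoPart j g w)) := by
  have e : (fun y => (isoNorm j g y : ℂ))
      = fun y => lorentz3 (isoPart j g y) (conjVec (isoPart j g y)) := by
    ext y; exact ofReal_isoNorm j g y
  rw [e, dz_lorentz3 (h.diff_isoPart hw j) (h.diff_conj_isoPart hw j),
    h.vdz_conj_isoPart hj hjc hw, lorentz3_smul_right, h.lorentz3_isoPart_ofRealVec hw]
  ring

/-- `P_z = (log A)_z P + ½⟨g_z, g_z⟩ g` where `A = ⟨P, P̄⟩` does not vanish. -/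
theorem vdz_isoPart (h : IsLocalHarmonic Ω g) (hj : j ^ 2 = -1) (hjc : conj j = -j) (hw : w ∈ Ω)
    (hA : isoNorm j g w ≠ 0) : vdz (isoPart j g) w
      = (dz (fun y => (isoNorm j g y : ℂ)) w / isoNorm j g w) • isoPart j g w
        + (lorentz3 (vdz (fun y => ofRealVec (g y)) w) (vdz (fun y => ofRealVec (g y)) w) / 2)
          • ofRealVec (g w) := by
  ext i
  rw [frame_expand (Complex.ofReal_ne_zero.2 hA) (h.lorentz3_isoPart_self hj hw)
    (h.lorentz3_conj_isoPart_self hj hw) (ofReal_isoNorm j g w).symm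
    (h.lorentz3_isoPart_ofRealVec hw j) (h.lorentz3_conj_isoPart_ofRealVec hw j)
    (h.lorentz3_ofRealVec_self hw) (vdz (isoPart j g) w) i, h.lorentz3_vdz_isoPart hj hw,
    h.lorentz3_vdz_isoPart_ofRealVec hj hw, h.dz_isoNorm hj hjc hw]
  simp only [Pi.add_apply, Pi.smul_apply, smul_eq_mul]
  ring

/-- Both `P'` and `P̄` lie in the second isotropic line of the tangent plane. The factor is read off
from `⟨P, P'⟩ = ½⟨g_z, g_z⟩`. -/
theorem isoPart_neg (h : IsLocalHarmonic Ω g) (hj : j ^ 2 = -1) (hjc : conj j = -j) (hw : w ∈ Ω)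
    (hA : isoNorm j g w ≠ 0) : isoPart (-j) g w
      = (lorentz3 (vdz (fun y => ofRealVec (g y)) w) (vdz (fun y => ofRealVec (g y)) w)
          / (2 * isoNorm j g w)) • conjVec (isoPart j g w) := by
  ext i
  rw [frame_expand (Complex.ofReal_ne_zero.2 hA) (h.lorentz3_isoPart_self hj hw)
    (h.lorentz3_conj_isoPart_self hj hw) (ofReal_isoNorm j g w).symm
    (h.lorentz3_isoPart_ofRealVec hw j) (h.lorentz3_conj_isoPart_ofRealVec hw j)
    (h.lorentz3_ofRealVec_self hw) (isoPart (-j) g w) i, h.lorentz3_isoPart_neg_conj hj hjc hw,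
    lorentz3_comm (isoPart (-j) g w) (isoPart j g w), h.lorentz3_isoPart_neg hj hw,
    h.lorentz3_isoPart_ofRealVec hw]
  simp only [Pi.smul_apply, smul_eq_mul]
  ring

/-- The Bochner formula `(log A)_{z z̄} = A - |⟨g_z, g_z⟩|² / (4 A)`. -/
theorem dzbar_dz_log_isoNorm (h : IsLocalHarmonic Ω g) (hj : j ^ 2 = -1) (hjc : conj j = -j)
    (hw : w ∈ Ω) (hA : isoNorm j g w ≠ 0) :
    dzbar (dz fun y => (Real.log (isoNorm j g y) : ℂ)) w = (isoNorm j g w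
      - ‖lorentz3 (vdz (fun y => ofRealVec (g y)) w) (vdz (fun y => ofRealVec (g y)) w)‖ ^ 2
        / (4 * isoNorm j g w) : ℝ) := by
  have hAd : ∀ y ∈ Ω, DifferentiableAt ℝ (isoNorm j g) y := fun y hy =>
    (h.contDiffOn_isoNorm j).differentiableAt_of_isOpen h.isOpen hy
  have hne : ∀ᶠ y in 𝓝 w, isoNorm j g y ≠ 0 :=
    (hAd w hw).continuousAt.eventually_ne hA
  have e1 : (dz fun y => (Real.log (isoNorm j g y) : ℂ)) =ᶠ[𝓝 w]
      fun y => ((isoNorm j g y)⁻¹ : ℝ) * dz (fun y => (isoNorm j g y : ℂ)) y := by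
    filter_upwards [h.isOpen.mem_nhds hw, hne] with y hy hy'
    exact dz_ofReal_comp (hAd y hy) (Real.hasDerivAt_log hy')
  have hAs : ContDiffOn ℝ ∞ (fun y => (isoNorm j g y : ℂ)) Ω := (h.contDiffOn_isoNorm j).ofReal
  have hdA : DifferentiableAt ℝ (dz fun y => (isoNorm j g y : ℂ)) w :=
    (hAs.dz h.isOpen).differentiableAt_of_isOpen h.isOpen hw
  have hinv : DifferentiableAt ℝ (fun y => (isoNorm j g y)⁻¹) w := (hAd w hw).inv hA
  have e2 : dzbar (fun y => (((isoNorm j g y)⁻¹ : ℝ) : ℂ)) w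
      = (-((isoNorm j g w) ^ 2)⁻¹ : ℝ) * conj (dz (fun y => (isoNorm j g y : ℂ)) w) := by
    rw [dzbar_ofReal, dz_ofReal_comp (φ := fun x => x⁻¹) (hAd w hw) (hasDerivAt_inv hA), map_mul,
      Complex.conj_ofReal]
  rw [dzbar_congr e1, dzbar_mul (differentiableAt_ofReal hinv) hdA, e2]
  -- the second derivative of `A`
  have e3 : (dz fun y => (isoNorm j g y : ℂ)) =ᶠ[𝓝 w]
      fun y => lorentz3 (vdz (isoPart j g) y) (conjVec (isoPart j g y)) := by
    filter_upwards [h.isOpen.mem_nhds hw] with y hy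
    exact h.dz_isoNorm hj hjc hy
  have hPzd : ∀ i, DifferentiableAt ℝ (fun y => vdz (isoPart j g) y i) w := fun i =>
    ((h.contDiffOn_isoPart j i).dz h.isOpen).differentiableAt_of_isOpen h.isOpen hw
  -- Commuting the derivatives gives `P_{zz̄} = (A g)_z`, so no third derivative of `g` enters.
  have e4 : vdzbar (vdz (isoPart j g)) w
      = dz (fun y => (isoNorm j g y : ℂ)) w • ofRealVec (g w)
        + (isoNorm j g w : ℂ) • vdz (fun y => ofRealVec (g y)) w := by
    ext i
    have hc : ContDiffAt ℝ 2 (fun y => isoPart j g y i) w :=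
      ((h.contDiffOn_isoPart j i).contDiffAt (h.isOpen.mem_nhds hw)).of_le ENat.LEInfty.out
    have h1 : vdzbar (vdz (isoPart j g)) w i = dz (dzbar fun y => isoPart j g y i) w :=
      (dz_dzbar_comm hc).symm
    have h2 : (dzbar fun y => isoPart j g y i) =ᶠ[𝓝 w]
        fun y => (isoNorm j g y : ℂ) * ofRealVec (g y) i := by
      filter_upwards [h.isOpen.mem_nhds hw] with y hy
      exact congrFun (h.vdzbar_isoPart hj hjc hy) i
    rw [h1, dz_congr h2, dz_mul (differentiableAt_ofReal (hAd w hw)) (h.diff_ofRealVec hw i)]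
    rfl
  have hAc : (isoNorm j g w : ℂ) ≠ 0 := Complex.ofReal_ne_zero.2 hA
  have e5 : lorentz3 (vdz (fun y => ofRealVec (g y)) w) (conjVec (isoPart j g w))
      = isoNorm j g w := by
    rw [← isoPart_add_isoPart_neg j g w, lorentz3_add_left, h.lorentz3_isoPart_neg_conj hj hjc hw,
      ← ofReal_isoNorm, add_zero]
  set q := lorentz3 (vdz (fun y => ofRealVec (g y)) w) (vdz (fun y => ofRealVec (g y)) w) with hq
  set D := dz (fun y => (isoNorm j g y : ℂ)) w with hD
  have e6 : lorentz3 (vdz (isoPart j g) w) (conjVec (vdz (isoPart j g) w))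
      = D * conj D / isoNorm j g w - q * conj q / 4 := by
    have hc : conjVec (vdz (isoPart j g) w) = (conj D / isoNorm j g w) • conjVec (isoPart j g w)
        + (conj q / 2) • ofRealVec (g w) := by
      rw [h.vdz_isoPart hj hjc hw hA]
      ext i
      simp [hD, hq, map_ofNat]
    rw [hc, h.vdz_isoPart hj hjc hw hA]
    simp only [lorentz3_add_left, lorentz3_add_right, lorentz3_smul_left, lorentz3_smul_right,
      lorentz3_comm (ofRealVec (g w)) (conjVec (isoPart j g w)),
      h.lorentz3_conj_isoPart_ofRealVec hw, h.lorentz3_isoPart_ofRealVec hw,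
      h.lorentz3_ofRealVec_self hw, ← ofReal_isoNorm, ← hD, ← hq]
    field_simp
    ring
  have e7 : dzbar (dz fun y => (isoNorm j g y : ℂ)) w
      = (isoNorm j g w : ℂ) ^ 2 + (D * conj D / isoNorm j g w - q * conj q / 4) := by
    rw [dzbar_congr e3, dzbar_lorentz3 hPzd (h.diff_conj_isoPart hw j),
      e4, vdzbar_conjVec, e6, lorentz3_add_left, lorentz3_smul_left, lorentz3_smul_left, e5,
      lorentz3_comm, h.lorentz3_conj_isoPart_ofRealVec hw]
    ring
  rw [e7]
  push_cast
  rw [← Complex.mul_conj']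
  field_simp
  ring

end IsLocalHarmonic

end LocalHarmonic

/-! ### The linear system and its integrability -/

section LinearSystem

open ComplexConjugate

/-- The endomorphism `(N, h) ↦ (⟨N, b⟩ a - ⟨N, a⟩ b, ⟨N, b⟩)` of `𝕃⁴`. -/
def wedgeEnd (b a : Fin 3 → ℝ) : Mink4 →L[ℝ] Mink4 :=
  LinearMap.toContinuousLinearMap
    { toFun := fun y => (lorentz3 y.1 b • a - lorentz3 y.1 a • b, lorentz3 y.1 b)
      map_add' := fun x y => by
        ext i <;> simp [lorentz3] <;> ring
      map_smul' := fun c y => by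
        ext i <;> simp [lorentz3] <;> ring }

@[simp] theorem wedgeEnd_apply (b a : Fin 3 → ℝ) (y : Mink4) :
    wedgeEnd b a y = (lorentz3 y.1 b • a - lorentz3 y.1 a • b, lorentz3 y.1 b) := rfl

/-- The connection form of the linear system satisfied by the surfaces with hyperbolic Gauss map
`g`. -/
def theta (j : ℂ) (g : ℂ → Fin 3 → ℝ) (w : ℂ) : ℂ →L[ℝ] Mink4 →L[ℝ] Mink4 :=
  LinearMap.toContinuousLinearMap
    { toFun := fun v => wedgeEnd (fun i => 4 * (isoPart j g w i * v).re) (g w)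
      map_add' := fun u v => by
        ext y i <;> simp [lorentz3] <;> ring
      map_smul' := fun c v => by
        ext y i <;> simp [lorentz3] <;> ring }

theorem theta_apply (j : ℂ) (g : ℂ → Fin 3 → ℝ) (w v : ℂ) (y : Mink4) :
    theta j g w v y = wedgeEnd (fun i => 4 * (isoPart j g w i * v).re) (g w) y := rfl

/-- The vector `2⟨V, P⟩ a - 2⟨V, a⟩ P`. -/
def wedgeVec (P a V : Fin 3 → ℂ) : Fin 3 → ℂ :=
  (2 * lorentz3 V P) • a - (2 * lorentz3 V a) • P

/-- The real connection form is twice the real part of a form of type (1,0). Read this way, the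
system is `N_z = 2⟨N, P⟩ g - 2⟨N, g⟩ P`, `h_z = 2⟨N, P⟩`. -/
theorem theta_apply_fst (j : ℂ) (g : ℂ → Fin 3 → ℝ) (w v : ℂ) (y : Mink4) (i : Fin 3) :
    (theta j g w v y).1 i
      = 2 * (wedgeVec (isoPart j g w) (ofRealVec (g w)) (ofRealVec y.1) i * v).re := by
  simp only [theta_apply, wedgeEnd_apply, wedgeVec, lorentz3, ofRealVec_apply, Pi.sub_apply,
    Pi.smul_apply, smul_eq_mul]
  simp
  ring

theorem theta_apply_snd (j : ℂ) (g : ℂ → Fin 3 → ℝ) (w v : ℂ) (y : Mink4) :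
    (theta j g w v y).2 = 2 * (2 * lorentz3 (ofRealVec y.1) (isoPart j g w) * v).re := by
  simp only [theta_apply, wedgeEnd_apply, lorentz3, ofRealVec_apply]
  simp
  ring

theorem ofRealVec_theta_apply_fst (j : ℂ) (g : ℂ → Fin 3 → ℝ) (w v : ℂ) (y : Mink4) :
    ofRealVec (theta j g w v y).1
      = v • wedgeVec (isoPart j g w) (ofRealVec (g w)) (ofRealVec y.1)
        + conj v • conjVec (wedgeVec (isoPart j g w) (ofRealVec (g w)) (ofRealVec y.1)) := by
  ext i
  rw [ofRealVec_apply, theta_apply_fst]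
  simp only [Pi.add_apply, Pi.smul_apply, smul_eq_mul, conjVec_apply]
  rw [← map_mul, Complex.add_conj, mul_comm v]

theorem wedgeVec_add (P a V V' : Fin 3 → ℂ) :
    wedgeVec P a (V + V') = wedgeVec P a V + wedgeVec P a V' := by
  ext i; simp only [wedgeVec, lorentz3_add_left, Pi.add_apply, Pi.sub_apply, Pi.smul_apply,
    smul_eq_mul]; ring

theorem wedgeVec_smul (P a V : Fin 3 → ℂ) (c : ℂ) :
    wedgeVec P a (c • V) = c • wedgeVec P a V := by
  ext i; simp only [wedgeVec, lorentz3_smul_left, Pi.sub_apply, Pi.smul_apply,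
    smul_eq_mul]; ring

theorem dz_ofReal_of_hasFDerivAt {f : ℂ → ℝ} {f' : ℂ →L[ℝ] ℝ} {w m : ℂ} (hf : HasFDerivAt f f' w)
    (h : ∀ v, f' v = 2 * (m * v).re) : dz (fun y => (f y : ℂ)) w = m := by
  simp only [dz, fderiv_ofReal_apply hf.differentiableAt, hf.fderiv, h]
  apply Complex.ext <;> simp

/-- The linear system in terms of Wirtinger derivatives. -/
theorem vdz_of_hasFDerivAt_theta {j : ℂ} {g : ℂ → Fin 3 → ℝ} {w : ℂ} {ψ : ℂ → Mink4}
    (h : HasFDerivAt ψ ((theta j g w).flip (ψ w)) w) :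
    vdz (fun y => ofRealVec (ψ y).1) w
        = wedgeVec (isoPart j g w) (ofRealVec (g w)) (ofRealVec (ψ w).1) ∧
      dz (fun y => ((ψ y).2 : ℂ)) w = 2 * lorentz3 (ofRealVec (ψ w).1) (isoPart j g w) := by
  refine ⟨?_, ?_⟩
  · ext i
    have h1 := (hasFDerivAt_pi'.1 h.fst) i
    exact dz_ofReal_of_hasFDerivAt h1 fun v => theta_apply_fst j g w v (ψ w) i
  · exact dz_ofReal_of_hasFDerivAt h.snd fun v => theta_apply_snd j g w v (ψ w)

theorem hasFDerivAt_theta_of_vdz {j : ℂ} {g : ℂ → Fin 3 → ℝ} {w : ℂ} {ψ : ℂ → Mink4}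
    (hψ : DifferentiableAt ℝ ψ w)
    (h1 : vdz (fun y => ofRealVec (ψ y).1) w
        = wedgeVec (isoPart j g w) (ofRealVec (g w)) (ofRealVec (ψ w).1))
    (h2 : dz (fun y => ((ψ y).2 : ℂ)) w = 2 * lorentz3 (ofRealVec (ψ w).1) (isoPart j g w)) :
    HasFDerivAt ψ ((theta j g w).flip (ψ w)) w := by
  have hd := hψ.hasFDerivAt
  have : fderiv ℝ ψ w = (theta j g w).flip (ψ w) := by
    ext v
    · rename_i i
      have e1 : (fderiv ℝ ψ w v).1 i = fderiv ℝ (fun y => (ψ y).1 i) w v := by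
        rw [((hasFDerivAt_pi'.1 hd.fst) i).fderiv]; rfl
      have e2 := congrFun h1 i
      have e3 : vdz (fun y => ofRealVec (ψ y).1) w i = dz (fun y => ((ψ y).1 i : ℂ)) w := rfl
      rw [e3] at e2
      rw [e1, fderiv_real_eq_two_re ((hasFDerivAt_pi'.1 hd.fst) i).differentiableAt, e2]
      exact (theta_apply_fst j g w v (ψ w) i).symm
    · have e1 : (fderiv ℝ ψ w v).2 = fderiv ℝ (fun y => (ψ y).2) w v := by
        rw [hd.snd.fderiv]; rfl
      rw [e1, fderiv_real_eq_two_re hd.snd.differentiableAt, h2]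
      exact (theta_apply_snd j g w v (ψ w)).symm
  rwa [this] at hd

/-- The antisymmetric part in `v` and `k` is a multiple of `Im (m' + b)`. Integrability of the
system is thus reduced to the reality of one number per component: `m'` will be the `z̄`-derivative
of the coefficient and `b` the quadratic term of the connection. -/
theorem two_re_symm {m m' a b k v : ℂ} (h : (m' + b).im = 0) :
    2 * ((m * v + m' * conj v) * k).re + 2 * ((v * a + conj v * b) * k).re
      = 2 * ((m * k + m' * conj k) * v).re + 2 * ((k * a + conj k * b) * v).re := by
  simp only [Complex.add_im] at h
  simp only [Complex.mul_re, Complex.add_re, Complex.mul_im, Complex.add_im, Complex.conj_re,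
    Complex.conj_im]
  linear_combination (4 * (k.re * v.im - v.re * k.im)) * h

namespace IsLocalHarmonic

variable {Ω : Set ℂ} {g : ℂ → Fin 3 → ℝ} {w : ℂ} {j : ℂ}

theorem contDiffOn_lorentz3_isoPart (h : IsLocalHarmonic Ω g) (j : ℂ) (V : Fin 3 → ℂ) :
    ContDiffOn ℝ ∞ (fun w => lorentz3 V (isoPart j g w)) Ω :=
  ContDiffOn.lorentz3 (fun _ => contDiffOn_const) (h.contDiffOn_isoPart j)

theorem contDiffOn_wedgeVec (h : IsLocalHarmonic Ω g) (j : ℂ) (V : Fin 3 → ℂ) (i : Fin 3) :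
    ContDiffOn ℝ ∞ (fun w => wedgeVec (isoPart j g w) (ofRealVec (g w)) V i) Ω := by
  have h1 := h.contDiffOn_lorentz3_isoPart j V
  have h2 : ContDiffOn ℝ ∞ (fun w => lorentz3 V (ofRealVec (g w))) Ω :=
    ContDiffOn.lorentz3 (fun _ => contDiffOn_const) h.contDiffOn_ofRealVec
  exact ((contDiffOn_const.mul h1).mul (h.contDiffOn_ofRealVec i)).sub
    ((contDiffOn_const.mul h2).mul (h.contDiffOn_isoPart j i))

theorem contDiffOn_theta (h : IsLocalHarmonic Ω g) (j : ℂ) : ContDiffOn ℝ ∞ (theta j g) Ω := by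
  rw [contDiffOn_clm_apply]
  intro v
  rw [contDiffOn_clm_apply]
  intro y
  have e : (fun w => theta j g w v y) = fun w =>
      ((fun i => 2 * (wedgeVec (isoPart j g w) (ofRealVec (g w)) (ofRealVec y.1) i * v).re),
        2 * (2 * lorentz3 (ofRealVec y.1) (isoPart j g w) * v).re) := by
    ext w i
    · exact theta_apply_fst j g w v y i
    · exact theta_apply_snd j g w v y
  rw [e]
  refine ContDiffOn.prodMk (contDiffOn_pi.2 fun i => ?_) ?_
  · exact contDiffOn_const.mul (Complex.reCLM.contDiff.comp_contDiffOn
      ((h.contDiffOn_wedgeVec j _ i).mul contDiffOn_const))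
  · exact contDiffOn_const.mul (Complex.reCLM.contDiff.comp_contDiffOn
      ((contDiffOn_const.mul (h.contDiffOn_lorentz3_isoPart j _)).mul contDiffOn_const))

theorem fderiv_two_re_mul {m : ℂ → ℂ} (hm : DifferentiableAt ℝ m w) (k v : ℂ) :
    fderiv ℝ (fun y => 2 * (m y * k).re) w v
      = 2 * ((dz m w * v + dzbar m w * conj v) * k).re := by
  have h1 : HasFDerivAt (fun y => (m y * k).re)
      (Complex.reCLM.comp ((fderiv ℝ m w).smulRight k)) w := by
    have := Complex.reCLM.hasFDerivAt.comp w (hm.hasFDerivAt.mul_const' k)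
    exact this
  rw [(h1.const_mul 2).fderiv, ← fderiv_eq_dz_add_dzbar]
  simp

theorem dzbar_lorentz3_isoPart (h : IsLocalHarmonic Ω g) (hj : j ^ 2 = -1) (hjc : conj j = -j)
    (hw : w ∈ Ω) (V : Fin 3 → ℂ) : dzbar (fun y => lorentz3 V (isoPart j g y)) w
      = isoNorm j g w * lorentz3 V (ofRealVec (g w)) := by
  rw [dzbar_lorentz3 (F := fun _ => V) (fun _ => differentiableAt_const _) (h.diff_isoPart hw j),
    h.vdzbar_isoPart hj hjc hw, lorentz3_smul_right]
  have : vdzbar (fun _ => V) w = 0 := by ext i; simp [vdzbar]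
  rw [this]
  simp [lorentz3]

/-- The conjugate of `P'` is a multiple of `P`, so the two vectors may be exchanged. -/
theorem lorentz3_isoPart_mul_conj_neg (h : IsLocalHarmonic Ω g) (hj : j ^ 2 = -1)
    (hjc : conj j = -j) (hw : w ∈ Ω) (hA : isoNorm j g w ≠ 0) (V : Fin 3 → ℂ) (i : Fin 3) :
    lorentz3 V (isoPart j g w) * conj (isoPart (-j) g w i)
      = lorentz3 V (conjVec (isoPart (-j) g w)) * isoPart j g w i := by
  rw [h.isoPart_neg hj hjc hw hA]
  have e : ∀ c : ℂ, conjVec (c • conjVec (isoPart j g w)) = conj c • isoPart j g w := by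
    intro c; ext k; simp
  rw [e, lorentz3_smul_right]
  simp only [Pi.smul_apply, smul_eq_mul, conjVec_apply, map_mul, Complex.conj_conj]
  ring

/-- By `P_z̄ = A g`, the two terms in which `P` is differentiated are both `2A⟨V, g⟩ g` and cancel.
-/
theorem dzbar_wedgeVec (h : IsLocalHarmonic Ω g) (hj : j ^ 2 = -1) (hjc : conj j = -j)
    (hw : w ∈ Ω) (V : Fin 3 → ℂ) (i : Fin 3) :
    dzbar (fun y => wedgeVec (isoPart j g y) (ofRealVec (g y)) V i) w
      = 2 * lorentz3 V (isoPart j g w) * conj (vdz (fun y => ofRealVec (g y)) w i)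
        - 2 * lorentz3 V (conjVec (vdz (fun y => ofRealVec (g y)) w)) * isoPart j g w i := by
  have d1 : DifferentiableAt ℝ (fun y => lorentz3 V (isoPart j g y)) w :=
    (h.contDiffOn_lorentz3_isoPart j V).differentiableAt_of_isOpen h.isOpen hw
  have d2 : DifferentiableAt ℝ (fun y => lorentz3 V (ofRealVec (g y))) w :=
    (ContDiffOn.lorentz3 (F := fun _ => V) (fun _ => contDiffOn_const) h.contDiffOn_ofRealVec
      ).differentiableAt_of_isOpen h.isOpen hw
  have d3 := h.diff_ofRealVec hw i
  have d4 := h.diff_isoPart hw j i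
  have e : (fun y => wedgeVec (isoPart j g y) (ofRealVec (g y)) V i)
      = fun y => 2 * lorentz3 V (isoPart j g y) * ofRealVec (g y) i
        - 2 * lorentz3 V (ofRealVec (g y)) * isoPart j g y i := rfl
  have e2 : dzbar (fun y => lorentz3 V (ofRealVec (g y))) w
      = lorentz3 V (conjVec (vdz (fun y => ofRealVec (g y)) w)) := by
    rw [dzbar_lorentz3 (F := fun _ => V) (fun _ => differentiableAt_const _) (h.diff_ofRealVec hw),
      vdzbar_ofRealVec]
    have : vdzbar (fun _ => V) w = 0 := by ext i; simp [vdzbar]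
    rw [this]
    simp [lorentz3]
  have e3 : dzbar (fun y => ofRealVec (g y) i) w = conj (vdz (fun y => ofRealVec (g y)) w i) :=
    congrFun (vdzbar_ofRealVec g w) i
  have e4 : dzbar (fun y => isoPart j g y i) w = isoNorm j g w * ofRealVec (g w) i :=
    congrFun (h.vdzbar_isoPart hj hjc hw) i
  rw [e, dzbar_sub ((d1.const_mul 2).fun_mul d3) ((d2.const_mul 2).fun_mul d4),
    dzbar_mul (d1.const_mul 2) d3, dzbar_mul (d2.const_mul 2) d4, dzbar_const_mul _ d1,
    dzbar_const_mul _ d2, h.dzbar_lorentz3_isoPart hj hjc hw, e2, e3, e4]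
  ring

/-- The linear system of the surfaces with hyperbolic Gauss map `g` is integrable. -/
theorem theta_flat (h : IsLocalHarmonic Ω g) (hj : j ^ 2 = -1) (hjc : conj j = -j)
    (hw : w ∈ Ω) (hA : isoNorm j g w ≠ 0) (v k : ℂ) (y : Mink4) :
    fderiv ℝ (theta j g) w v k y + theta j g w k (theta j g w v y)
      = fderiv ℝ (theta j g) w k v y + theta j g w v (theta j g w k y) := by
  have hd : DifferentiableAt ℝ (theta j g) w :=
    (h.contDiffOn_theta j).differentiableAt_of_isOpen h.isOpen hw
  have e0 : ∀ b : ℂ, ∃ L : ℂ →L[ℝ] Mink4, HasFDerivAt (fun u => theta j g u b y) L w ∧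
      ∀ a, L a = fderiv ℝ (theta j g) w a b y := fun b => by
    refine ⟨_, (hd.hasFDerivAt.clm_apply (hasFDerivAt_const b w)).clm_apply
      (hasFDerivAt_const y w), fun a => ?_⟩
    simp
  set P := isoPart j g w with hP
  set G := ofRealVec (g w) with hG
  set N := ofRealVec y.1 with hN
  set M := wedgeVec P G N with hM
  have hPg : lorentz3 P G = 0 := h.lorentz3_isoPart_ofRealVec hw j
  have hPPc : lorentz3 (conjVec P) P = isoNorm j g w := by
    rw [lorentz3_comm, ofReal_isoNorm]
  have hgg : lorentz3 G G = -1 := h.lorentz3_ofRealVec_self hw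
  have hPcg : lorentz3 (conjVec P) G = 0 := h.lorentz3_conj_isoPart_ofRealVec hw j
  have hMc : conjVec M = (2 * lorentz3 N (conjVec P)) • G - (2 * lorentz3 N G) • conjVec P := by
    have c1 : conj (lorentz3 N P) = lorentz3 N (conjVec P) :=
      (lorentz3_ofRealVec_conjVec y.1 P).symm
    have c2 : conj (lorentz3 N G) = lorentz3 N G := by
      rw [hN, hG, lorentz3_ofRealVec, Complex.conj_ofReal]
    have c3 : ∀ i, conj (G i) = G i := fun i => Complex.conj_ofReal _
    ext i
    simp only [hM, wedgeVec, conjVec_apply, Pi.sub_apply, Pi.smul_apply, smul_eq_mul, map_sub,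
      map_mul, map_ofNat, c1, c2, c3]
  have hMcP : lorentz3 (conjVec M) P = -(2 * lorentz3 N G * isoNorm j g w) := by
    rw [hMc, lorentz3_sub_left, lorentz3_smul_left, lorentz3_smul_left, lorentz3_comm G P, hPg,
      hPPc]; ring
  have hMcG : lorentz3 (conjVec M) G = -(2 * lorentz3 N (conjVec P)) := by
    rw [hMc, lorentz3_sub_left, lorentz3_smul_left, lorentz3_smul_left, hgg, hPcg]; ring
  have hNG : (lorentz3 N G) = ((lorentz3 y.1 (g w) : ℝ) : ℂ) := lorentz3_ofRealVec _ _
  refine Prod.ext (funext fun i => ?_) ?_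
  · have hm : DifferentiableAt ℝ (fun u => wedgeVec (isoPart j g u) (ofRealVec (g u)) N i) w :=
      (h.contDiffOn_wedgeVec j N i).differentiableAt_of_isOpen h.isOpen hw
    have e1 : ∀ a b : ℂ, (fderiv ℝ (theta j g) w a b y).1 i
        = 2 * ((dz (fun u => wedgeVec (isoPart j g u) (ofRealVec (g u)) N i) w * a
          + dzbar (fun u => wedgeVec (isoPart j g u) (ofRealVec (g u)) N i) w * conj a) * b).re := by
      intro a b
      rw [← fderiv_two_re_mul hm b a]
      obtain ⟨L, hL, hLa⟩ := e0 b
      have e2 := (hasFDerivAt_pi'.1 hL.fst) i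
      have e3 : (fun u => (theta j g u b y).1 i)
          = fun u => 2 * (wedgeVec (isoPart j g u) (ofRealVec (g u)) N i * b).re := by
        ext u; exact theta_apply_fst j g u b y i
      rw [← e3, e2.fderiv, ← hLa]
      rfl
    have e4 : ∀ a b : ℂ, (theta j g w b (theta j g w a y)).1 i
        = 2 * ((a * wedgeVec P G M i + conj a * wedgeVec P G (conjVec M) i) * b).re := by
      intro a b
      rw [theta_apply_fst, ofRealVec_theta_apply_fst, wedgeVec_add, wedgeVec_smul, wedgeVec_smul]
      simp only [Pi.add_apply, Pi.smul_apply, smul_eq_mul, hM, hP, hG, hN]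
    show (fderiv ℝ (theta j g) w v k y).1 i + (theta j g w k (theta j g w v y)).1 i
      = (fderiv ℝ (theta j g) w k v y).1 i + (theta j g w v (theta j g w k y)).1 i
    rw [e1, e1, e4, e4]
    refine two_re_symm ?_
    rw [h.dzbar_wedgeVec hj hjc hw]
    have hpar := h.lorentz3_isoPart_mul_conj_neg hj hjc hw hA N i
    have hX := isoPart_add_isoPart_neg j g w
    have hXc : conjVec (vdz (fun y => ofRealVec (g y)) w)
        = conjVec P + conjVec (isoPart (-j) g w) := by
      rw [← hX]; ext i; simp [hP]
    have hXi : conj (vdz (fun y => ofRealVec (g y)) w i)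
        = conj (P i) + conj (isoPart (-j) g w i) := congrFun hXc i
    rw [hXi, hXc, lorentz3_add_right]
    -- The contributions of `P'` cancel because its conjugate is parallel to `P`. The rest is a
    -- number plus its conjugate, and a real term.
    have hfin : 2 * lorentz3 N (isoPart j g w) * (conj (P i) + conj (isoPart (-j) g w i))
        - 2 * (lorentz3 N (conjVec P) + lorentz3 N (conjVec (isoPart (-j) g w))) * isoPart j g w i
        + wedgeVec P G (conjVec M) i
        = 2 * (lorentz3 N P * conj (P i) + conj (lorentz3 N P * conj (P i)))
          - 4 * isoNorm j g w * (lorentz3 y.1 (g w) : ℝ) * (g w i : ℝ) := by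
      have c1 : conj (lorentz3 N P) = lorentz3 N (conjVec P) :=
        (lorentz3_ofRealVec_conjVec y.1 P).symm
      rw [map_mul, c1, Complex.conj_conj]
      simp only [wedgeVec, Pi.sub_apply, Pi.smul_apply, smul_eq_mul, hMcP, hMcG]
      rw [← hNG]
      have hGi : ((g w i : ℝ) : ℂ) = G i := rfl
      rw [hGi]
      rw [← hP] at hpar ⊢
      linear_combination 2 * hpar
    rw [hfin, Complex.add_conj]
    have : (2 * ((2 * (lorentz3 N P * conj (P i)).re : ℝ) : ℂ)
          - 4 * isoNorm j g w * (lorentz3 y.1 (g w) : ℝ) * (g w i : ℝ))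
        = ((2 * (2 * (lorentz3 N P * conj (P i)).re)
          - 4 * isoNorm j g w * lorentz3 y.1 (g w) * g w i : ℝ) : ℂ) := by
      push_cast; ring
    rw [this, Complex.ofReal_im]
  · have hm0 : DifferentiableAt ℝ (fun u => lorentz3 N (isoPart j g u)) w :=
      (h.contDiffOn_lorentz3_isoPart j N).differentiableAt_of_isOpen h.isOpen hw
    have hm : DifferentiableAt ℝ (fun u => 2 * lorentz3 N (isoPart j g u)) w := hm0.const_mul 2
    have e1 : ∀ a b : ℂ, (fderiv ℝ (theta j g) w a b y).2
        = 2 * ((dz (fun u => 2 * lorentz3 N (isoPart j g u)) w * a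
          + dzbar (fun u => 2 * lorentz3 N (isoPart j g u)) w * conj a) * b).re := by
      intro a b
      rw [← fderiv_two_re_mul hm b a]
      obtain ⟨L, hL, hLa⟩ := e0 b
      have e2 := hL.snd
      have e3 : (fun u => (theta j g u b y).2)
          = fun u => 2 * (2 * lorentz3 N (isoPart j g u) * b).re := by
        ext u; exact theta_apply_snd j g u b y
      rw [← e3, e2.fderiv, ← hLa]
      rfl
    have e4 : ∀ a b : ℂ, (theta j g w b (theta j g w a y)).2
        = 2 * ((a * (2 * lorentz3 M P) + conj a * (2 * lorentz3 (conjVec M) P)) * b).re := by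
      intro a b
      rw [theta_apply_snd, ofRealVec_theta_apply_fst, lorentz3_add_left, lorentz3_smul_left,
        lorentz3_smul_left]
      congr 3
      simp only [hM, hP, hG, hN]
      ring
    show (fderiv ℝ (theta j g) w v k y).2 + (theta j g w k (theta j g w v y)).2
      = (fderiv ℝ (theta j g) w k v y).2 + (theta j g w v (theta j g w k y)).2
    rw [e1, e1, e4, e4]
    refine two_re_symm ?_
    rw [dzbar_const_mul _ hm0, h.dzbar_lorentz3_isoPart hj hjc hw, hMcP, hNG]
    have : (2 * ((isoNorm j g w : ℂ) * ((lorentz3 y.1 (g w) : ℝ) : ℂ))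
        + 2 * -(2 * ((lorentz3 y.1 (g w) : ℝ) : ℂ) * isoNorm j g w))
        = ((-2 * (isoNorm j g w * lorentz3 y.1 (g w)) : ℝ) : ℂ) := by
      push_cast; ring
    rw [this, Complex.ofReal_im]

end IsLocalHarmonic

end LinearSystem

/-! ### Change of conformal parameter -/

section ConformalParameters

open ComplexConjugate

variable {S : Type*} [TopologicalSpace S]

/-- A map on a surface, read in a parameter. -/
def readParam {α : Type*} (e : OpenPartialHomeomorph S ℂ) (f : S → α) : ℂ → α :=
  fun w => f (e.symm w)

/-- The derivative of the change of parameters from `e` to `e'` at the point `x`. -/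
def transitionDeriv (e e' : OpenPartialHomeomorph S ℂ) (x : S) : ℂ :=
  deriv (fun y => e' (e.symm y)) (e x)

variable {e e' : OpenPartialHomeomorph S ℂ} {x : S}

theorem readParam_apply {α : Type*} (f : S → α) (hx : x ∈ e.source) :
    readParam e f (e x) = f x := by rw [readParam, e.left_inv hx]

theorem readParam_eventuallyEq {α : Type*} (f : S → α) (hx : x ∈ e.source) (hx' : x ∈ e'.source) :
    readParam e f =ᶠ[𝓝 (e x)] fun y => readParam e' f (e' (e.symm y)) := by
  have h1 : ∀ᶠ y in 𝓝 (e x), e.symm y ∈ e'.source := by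
    refine (e.continuousAt_symm (e.map_source hx)).eventually_mem ?_
    rw [e.left_inv hx]
    exact e'.open_source.mem_nhds hx'
  filter_upwards [h1] with y hy
  rw [readParam, readParam, e'.left_inv hy]

theorem eventually_nhds_iff_param {p : S → Prop} {w : ℂ} (hw : w ∈ e.target) :
    (∀ᶠ y in 𝓝 (e.symm w), p y) ↔ ∀ᶠ y in 𝓝 w, p (e.symm y) := by
  have := e.symm.map_nhds_eq (x := w) hw
  rw [← this]; rfl

theorem frequently_nhds_iff_param {p : S → Prop} {w : ℂ} (hw : w ∈ e.target) :
    (∃ᶠ y in 𝓝 (e.symm w), p y) ↔ ∃ᶠ y in 𝓝 w, p (e.symm y) := by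
  have := e.symm.map_nhds_eq (x := w) hw
  rw [← this]; rfl

variable [ChartedSpace ℂ S]

theorem contDiffAt_transition (he : e ∈ conformalParams S) (he' : e' ∈ conformalParams S)
    (hx : x ∈ e.source) (hx' : x ∈ e'.source) :
    ContDiffAt ℂ ω (fun y => e' (e.symm y)) (e x) := by
  have h1 : ContMDiffAt (modelWithCornersSelf ℂ ℂ) (modelWithCornersSelf ℂ ℂ) ω e.symm (e x) :=
    (contMDiffOn_symm_of_mem_maximalAtlas he).contMDiffAt (e.open_target.mem_nhds (e.map_source hx))
  have h2 : ContMDiffAt (modelWithCornersSelf ℂ ℂ) (modelWithCornersSelf ℂ ℂ) ω e'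
      (e.symm (e x)) := by
    rw [e.left_inv hx]
    exact (contMDiffOn_of_mem_maximalAtlas he').contMDiffAt (e'.open_source.mem_nhds hx')
  exact (h2.comp (e x) h1).contDiffAt

theorem hasDerivAt_transition (he : e ∈ conformalParams S) (he' : e' ∈ conformalParams S)
    (hx : x ∈ e.source) (hx' : x ∈ e'.source) :
    HasDerivAt (fun y => e' (e.symm y)) (transitionDeriv e e' x) (e x) :=
  ((contDiffAt_transition he he' hx hx').differentiableAt (by simp)).hasDerivAt

theorem transitionDeriv_mul (he : e ∈ conformalParams S) (he' : e' ∈ conformalParams S)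
    (hx : x ∈ e.source) (hx' : x ∈ e'.source) :
    transitionDeriv e' e x * transitionDeriv e e' x = 1 := by
  have h1 := hasDerivAt_transition he he' hx hx'
  have h2 := hasDerivAt_transition he' he hx' hx
  have h2' : HasDerivAt (fun y => e (e'.symm y)) (transitionDeriv e' e x) (e' (e.symm (e x))) := by
    rwa [e.left_inv hx]
  have h3 := h2'.comp (e x) h1
  have h4 : ((fun y => e (e'.symm y)) ∘ fun y => e' (e.symm y)) =ᶠ[𝓝 (e x)] id := by
    filter_upwards [readParam_eventuallyEq e hx hx',
      e.open_target.mem_nhds (e.map_source hx)] with y hy hyt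
    exact hy.symm.trans (e.right_inv hyt)
  exact (h3.congr_of_eventuallyEq h4.symm).unique (hasDerivAt_id _)

theorem transitionDeriv_ne_zero (he : e ∈ conformalParams S) (he' : e' ∈ conformalParams S)
    (hx : x ∈ e.source) (hx' : x ∈ e'.source) : transitionDeriv e e' x ≠ 0 :=
  right_ne_zero_of_mul_eq_one (transitionDeriv_mul he he' hx hx')

variable {F : Type*} [NormedAddCommGroup F] [NormedSpace ℝ F]

theorem ContDiffAt.readParam_transition {n : ℕ∞} {f : S → F} (he : e ∈ conformalParams S)
    (he' : e' ∈ conformalParams S) (hx : x ∈ e.source) (hx' : x ∈ e'.source)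
    (h : ContDiffAt ℝ n (readParam e' f) (e' x)) : ContDiffAt ℝ n (readParam e f) (e x) := by
  have h1 : ContDiffAt ℝ n (fun y => e' (e.symm y)) (e x) :=
    ((contDiffAt_transition he he' hx hx').restrict_scalars ℝ).of_le le_top
  have h2 : ContDiffAt ℝ n (readParam e' f) ((fun y => e' (e.symm y)) (e x)) := by
    simpa only [e.left_inv hx] using h
  have h3 := h2.comp (e x) h1
  rw [Function.comp_def] at h3
  exact h3.congr_of_eventuallyEq (readParam_eventuallyEq f hx hx')

theorem HasFDerivAt.readParam_transition {f : S → F} {f' : ℂ →L[ℝ] F}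
    (he : e ∈ conformalParams S) (he' : e' ∈ conformalParams S) (hx : x ∈ e.source)
    (hx' : x ∈ e'.source) (h : HasFDerivAt (readParam e' f) f' (e' x)) :
    HasFDerivAt (readParam e f) (f'.comp ((ContinuousLinearMap.toSpanSingleton ℂ
      (transitionDeriv e e' x)).restrictScalars ℝ)) (e x) := by
  have h1 : HasFDerivAt (fun y => e' (e.symm y)) ((ContinuousLinearMap.toSpanSingleton ℂ
      (transitionDeriv e e' x)).restrictScalars ℝ) (e x) :=
    (hasDerivAt_transition he he' hx hx').hasFDerivAt.restrictScalars ℝ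
  have h2 : HasFDerivAt (readParam e' f) f' ((fun y => e' (e.symm y)) (e x)) := by
    simpa only [e.left_inv hx] using h
  have h3 := h2.comp (e x) h1
  rw [Function.comp_def] at h3
  exact h3.congr_of_eventuallyEq (readParam_eventuallyEq f hx hx')

theorem fderiv_readParam_transition {f : S → F} (he : e ∈ conformalParams S)
    (he' : e' ∈ conformalParams S) (hx : x ∈ e.source) (hx' : x ∈ e'.source)
    (h : DifferentiableAt ℝ (readParam e' f) (e' x)) (v : ℂ) :
    fderiv ℝ (readParam e f) (e x) v
      = fderiv ℝ (readParam e' f) (e' x) (v * transitionDeriv e e' x) := by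
  rw [(h.hasFDerivAt.readParam_transition he he' hx hx').fderiv]
  simp

/-- Transition maps are holomorphic, so the chain rule does not mix `∂/∂z` with `∂/∂z̄`. -/
theorem dz_readParam_transition {f : S → ℂ} (he : e ∈ conformalParams S)
    (he' : e' ∈ conformalParams S) (hx : x ∈ e.source) (hx' : x ∈ e'.source)
    (h : DifferentiableAt ℝ (readParam e' f) (e' x)) :
    dz (readParam e f) (e x) = dz (readParam e' f) (e' x) * transitionDeriv e e' x := by
  have key : ∀ v, fderiv ℝ (readParam e f) (e x) v
      = dz (readParam e' f) (e' x) * (v * transitionDeriv e e' x)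
        + dzbar (readParam e' f) (e' x) * conj (v * transitionDeriv e e' x) := fun v => by
    rw [fderiv_readParam_transition he he' hx hx' h, fderiv_eq_dz_add_dzbar]
  rw [dz, key, key]
  simp only [map_mul, Complex.conj_I, map_one]
  linear_combination (-(dz (readParam e' f) (e' x)) * transitionDeriv e e' x / 2
    + dzbar (readParam e' f) (e' x) * conj (transitionDeriv e e' x) / 2) * Complex.I_sq

variable [IsManifold (modelWithCornersSelf ℂ ℂ) ω S]

theorem chartAt_mem_conformalParams (x : S) : chartAt ℂ x ∈ conformalParams S :=
  IsManifold.chart_mem_maximalAtlas x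

/-- Smoothness on the manifold is tested in the preferred chart; transitions of the holomorphic
atlas carry the test to an arbitrary conformal parameter. -/
theorem contMDiffAt_iff_readParam {n : ℕ∞} {f : S → F} (he : e ∈ conformalParams S)
    (hx : x ∈ e.source) :
    ContMDiffAt (modelWithCornersSelf ℝ ℂ) (modelWithCornersSelf ℝ F) n f x
      ↔ ContDiffAt ℝ n (readParam e f) (e x) := by
  have hc := chartAt_mem_conformalParams x
  have hxc := mem_chart_source ℂ x
  have h0 : ContMDiffAt (modelWithCornersSelf ℝ ℂ) (modelWithCornersSelf ℝ F) n f x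
      ↔ ContDiffAt ℝ n (readParam (chartAt ℂ x) f) (chartAt ℂ x x) := by
    rw [contMDiffAt_iff]
    have e1 : (ContDiffWithinAt ℝ n (extChartAt (modelWithCornersSelf ℝ F) (f x) ∘ f ∘
        (extChartAt (modelWithCornersSelf ℝ ℂ) x).symm) (range (modelWithCornersSelf ℝ ℂ))
        (extChartAt (modelWithCornersSelf ℝ ℂ) x x))
        ↔ ContDiffAt ℝ n (readParam (chartAt ℂ x) f) (chartAt ℂ x x) := by
      simp only [modelWithCornersSelf_coe, range_id, contDiffWithinAt_univ]
      rfl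
    rw [e1]
    refine and_iff_right_of_imp fun h => ?_
    have h1 : ContinuousAt (readParam (chartAt ℂ x) f ∘ chartAt ℂ x) x :=
      ContinuousAt.comp h.continuousAt ((chartAt ℂ x).continuousAt hxc)
    refine h1.congr ?_
    filter_upwards [(chartAt ℂ x).open_source.mem_nhds hxc] with y hy
    exact readParam_apply f hy
  rw [h0]
  exact ⟨fun h => h.readParam_transition he hc hx hxc, fun h => h.readParam_transition hc he hxc hx⟩

theorem contMDiff_iff_readParam {n : ℕ∞} {f : S → F} :
    ContMDiff (modelWithCornersSelf ℝ ℂ) (modelWithCornersSelf ℝ F) n f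
      ↔ ∀ e ∈ conformalParams S, ContDiffOn ℝ n (readParam e f) e.target := by
  constructor
  · intro h e he w hw
    have := (contMDiffAt_iff_readParam he (e.map_target hw)).1 (h (e.symm w))
    rw [e.right_inv hw] at this
    exact this.contDiffWithinAt
  · intro h x
    have hxc := mem_chart_source ℂ x
    refine (contMDiffAt_iff_readParam (chartAt_mem_conformalParams x) hxc).2 ?_
    exact (h _ (chartAt_mem_conformalParams x)).contDiffAt
      ((chartAt ℂ x).open_target.mem_nhds (mem_chart_target ℂ x))

theorem isRegularPt_iff {f : S → Fin 3 → ℝ} (he : e ∈ conformalParams S) (hx : x ∈ e.source)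
    (h : DifferentiableAt ℝ (readParam e f) (e x)) :
    IsRegularPt f x ↔ ∀ v : ℂ, fderiv ℝ (readParam e f) (e x) v = 0 → v = 0 := by
  have hc := chartAt_mem_conformalParams x
  have hxc := mem_chart_source ℂ x
  have hd : DifferentiableAt ℝ (readParam (chartAt ℂ x) f) (chartAt ℂ x x) :=
    (h.hasFDerivAt.readParam_transition hc he hxc hx).differentiableAt
  have hm : MDifferentiableAt (modelWithCornersSelf ℝ ℂ) (modelWithCornersSelf ℝ (Fin 3 → ℝ))
      f x := by
    rw [mdifferentiableAt_iff]
    refine ⟨?_, ?_⟩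
    · have h1 : ContinuousAt (readParam (chartAt ℂ x) f ∘ chartAt ℂ x) x :=
        ContinuousAt.comp hd.continuousAt ((chartAt ℂ x).continuousAt hxc)
      refine h1.congr ?_
      filter_upwards [(chartAt ℂ x).open_source.mem_nhds hxc] with y hy
      exact readParam_apply f hy
    · simp only [modelWithCornersSelf_coe, range_id, differentiableWithinAt_univ]
      exact hd
  have e1 : ∀ v : ℂ, mfderiv (modelWithCornersSelf ℝ ℂ) (modelWithCornersSelf ℝ (Fin 3 → ℝ)) f x v
      = fderiv ℝ (readParam (chartAt ℂ x) f) (chartAt ℂ x x) v := by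
    intro v
    simp only [mfderiv, hm, modelWithCornersSelf_coe, range_id, fderivWithin_univ]
    rfl
  have e2 : IsRegularPt f x
      ↔ ∀ v : ℂ, fderiv ℝ (readParam (chartAt ℂ x) f) (chartAt ℂ x x) v = 0 → v = 0 := by
    rw [IsRegularPt, injective_iff_map_eq_zero]
    exact forall_congr' fun v => by
      have := e1 v
      constructor <;> intro H hv
      · exact H (this.trans hv)
      · exact H (this.symm.trans hv)
  rw [e2]
  have k := transitionDeriv_mul hc he hxc hx
  have k1 := transitionDeriv_ne_zero hc he hxc hx
  have k2 := transitionDeriv_ne_zero he hc hx hxc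
  constructor
  · intro H v hv
    have := H (v * transitionDeriv e (chartAt ℂ x) x) (by
      rwa [← fderiv_readParam_transition he hc hx hxc hd])
    exact (mul_eq_zero.1 this).resolve_right k2
  · intro H v hv
    have := H (v * transitionDeriv (chartAt ℂ x) e x) (by
      rwa [← fderiv_readParam_transition hc he hxc hx h])
    exact (mul_eq_zero.1 this).resolve_right k1

variable {G : S → Fin 3 → ℝ}

theorem IsHarmonicMap.contDiffOn_readParam (hG : IsHarmonicMap G) (he : e ∈ conformalParams S) :
    ContDiffOn ℝ ∞ (readParam e G) e.target :=
  contMDiff_iff_readParam.1 hG.smooth e he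

theorem IsHarmonicMap.isLocalHarmonic (hG : IsHarmonicMap G) (he : e ∈ conformalParams S) :
    IsLocalHarmonic e.target (readParam e G) where
  isOpen := e.open_target
  smooth i := contDiffOn_pi.1 (hG.contDiffOn_readParam he) i
  unit _ _ := (hG.mem_hypPlane _).1
  harmonic w hw := funext fun i => hG.harmonic e he w hw i

theorem IsHarmonicMap.vdz_transition (hG : IsHarmonicMap G) (he : e ∈ conformalParams S)
    (he' : e' ∈ conformalParams S) (hx : x ∈ e.source) (hx' : x ∈ e'.source) :
    vdz (fun y => ofRealVec (readParam e G y)) (e x)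
      = transitionDeriv e e' x • vdz (fun y => ofRealVec (readParam e' G y)) (e' x) := by
  ext i
  rw [Pi.smul_apply, smul_eq_mul, mul_comm]
  exact dz_readParam_transition (f := fun x => (G x i : ℂ)) he he' hx hx'
    ((hG.isLocalHarmonic he').diff_ofRealVec (e'.map_source hx') i)

theorem IsHarmonicMap.isoPart_transition (hG : IsHarmonicMap G) (he : e ∈ conformalParams S)
    (he' : e' ∈ conformalParams S) (hx : x ∈ e.source) (hx' : x ∈ e'.source) (j : ℂ) :
    isoPart j (readParam e G) (e x)
      = transitionDeriv e e' x • isoPart j (readParam e' G) (e' x) := by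
  rw [isoPart, isoPart, hG.vdz_transition he he' hx hx', readParam_apply G hx,
    readParam_apply G hx', nullPart_smul]

theorem IsHarmonicMap.isoNorm_transition (hG : IsHarmonicMap G) (he : e ∈ conformalParams S)
    (he' : e' ∈ conformalParams S) (hx : x ∈ e.source) (hx' : x ∈ e'.source) (j : ℂ) :
    isoNorm j (readParam e G) (e x)
      = isoNorm j (readParam e' G) (e' x) * ‖transitionDeriv e e' x‖ ^ 2 := by
  have h1 : ((isoNorm j (readParam e G) (e x) : ℝ) : ℂ)
      = ((isoNorm j (readParam e' G) (e' x) * ‖transitionDeriv e e' x‖ ^ 2 : ℝ) : ℂ) := by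
    rw [ofReal_isoNorm, hG.isoPart_transition he he' hx hx', Complex.ofReal_mul, ofReal_isoNorm,
      Complex.ofReal_pow, ← Complex.mul_conj']
    have : conjVec (transitionDeriv e e' x • isoPart j (readParam e' G) (e' x))
        = conj (transitionDeriv e e' x) • conjVec (isoPart j (readParam e' G) (e' x)) := by
      ext i; simp
    rw [this, lorentz3_smul_left, lorentz3_smul_right]
    ring
  exact_mod_cast h1

/-- Since `P` scales like a (1,0)-form, the connection is a globally defined one-form, and the
linear system has a meaning on the surface. -/
theorem IsHarmonicMap.theta_transition (hG : IsHarmonicMap G) (he : e ∈ conformalParams S)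
    (he' : e' ∈ conformalParams S) (hx : x ∈ e.source) (hx' : x ∈ e'.source) (j v : ℂ) :
    theta j (readParam e G) (e x) v
      = theta j (readParam e' G) (e' x) (v * transitionDeriv e e' x) := by
  refine ContinuousLinearMap.ext fun y => ?_
  rw [theta_apply, theta_apply, hG.isoPart_transition he he' hx hx', readParam_apply G hx,
    readParam_apply G hx']
  congr 2
  ext i
  simp only [Pi.smul_apply, smul_eq_mul]
  ring_nf

end ConformalParameters

/-! ### Comparing the isotropic lengths with the metric -/

section LocalWeierstrass

open ComplexConjugate

/-- The scalar product is positive definite on the complement of a timelike vector. The Lagrange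
identity exhibits `x₀² + (x₁g₂ - x₂g₁)²` as zero, which settles `x₀` and then the other coordinates.
-/
theorem eq_zero_of_lorentz3_eq_zero {g x : Fin 3 → ℝ} (hg : lorentz3 g g = -1)
    (hxg : lorentz3 x g = 0) (hx : lorentz3 x x = 0) : x = 0 := by
  simp only [lorentz3] at hg hxg hx
  have h1 : x 0 ^ 2 + (x 1 * g 2 - x 2 * g 1) ^ 2 = 0 := by
    have hg' : g 0 ^ 2 = 1 + g 1 ^ 2 + g 2 ^ 2 := by linarith
    have hx' : x 1 ^ 2 + x 2 ^ 2 = x 0 ^ 2 := by linarith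
    have hxg' : x 1 * g 1 + x 2 * g 2 = x 0 * g 0 := by linarith
    linear_combination (-(x 0 ^ 2)) * hg' + (g 1 ^ 2 + g 2 ^ 2) * hx'
      - (x 1 * g 1 + x 2 * g 2 + x 0 * g 0) * hxg'
  have h0 : x 0 = 0 := by
    have : x 0 ^ 2 = 0 := by nlinarith [sq_nonneg (x 0), sq_nonneg (x 1 * g 2 - x 2 * g 1)]
    exact pow_eq_zero_iff (by norm_num) |>.1 this
  rw [h0] at hx
  have h2 : x 1 ^ 2 = 0 := by nlinarith [sq_nonneg (x 1), sq_nonneg (x 2)]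
  have h3 : x 2 ^ 2 = 0 := by nlinarith [sq_nonneg (x 1), sq_nonneg (x 2)]
  ext i
  fin_cases i
  · exact h0
  · exact pow_eq_zero_iff (by norm_num) |>.1 h2
  · exact pow_eq_zero_iff (by norm_num) |>.1 h3

theorem lorentz3_two_re (X Y : Fin 3 → ℂ) (v v' : ℂ) :
    lorentz3 (fun i => 2 * (X i * v).re) (fun i => 2 * (Y i * v').re)
      = 2 * (lorentz3 X Y * (v * v')).re + 2 * (lorentz3 X (conjVec Y) * (v * conj v')).re := by
  simp [lorentz3]
  ring

/-- A harmonic map of a domain of `ℂ`, together with the coefficient of a metric that belongs to its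
Weierstrass data. -/
structure IsLocalWeierstrass (Ω : Set ℂ) (g : ℂ → Fin 3 → ℝ) (t : ℂ → ℝ) : Prop where
  isLocalHarmonic : IsLocalHarmonic Ω g
  smooth : ContDiffOn ℝ ∞ t Ω
  pos : ∀ w ∈ Ω, 0 < t w
  metric : ∀ w ∈ Ω, ∀ v : ℂ, lorentz3 (fderiv ℝ g w v) (fderiv ℝ g w v)
    = 2 * (lorentz3 (vdz (fun y => ofRealVec (g y)) w) (vdz (fun y => ofRealVec (g y)) w)
        * v ^ 2).re
      + (t w / 2 + 2 * ‖lorentz3 (vdz (fun y => ofRealVec (g y)) w)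
        (vdz (fun y => ofRealVec (g y)) w)‖ ^ 2 / t w) * ‖v‖ ^ 2

theorem fderiv_apply_eq_two_re {g : ℂ → Fin 3 → ℝ} {w : ℂ} (hg : DifferentiableAt ℝ g w) (v : ℂ) :
    fderiv ℝ g w v = fun i => 2 * (vdz (fun y => ofRealVec (g y)) w i * v).re := by
  ext i
  have h1 := hasFDerivAt_pi'.1 hg.hasFDerivAt i
  have h2 : fderiv ℝ g w v i = fderiv ℝ (fun y => g y i) w v := by rw [h1.fderiv]; rfl
  rw [h2, fderiv_real_eq_two_re h1.differentiableAt]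
  rfl

theorem IsLocalHarmonic.differentiableAt {Ω : Set ℂ} {g : ℂ → Fin 3 → ℝ} {w : ℂ}
    (h : IsLocalHarmonic Ω g) (hw : w ∈ Ω) : DifferentiableAt ℝ g w :=
  differentiableAt_pi.2 fun i => (h.smooth i).differentiableAt_of_isOpen h.isOpen hw

theorem IsLocalHarmonic.lorentz3_fderiv_self {Ω : Set ℂ} {g : ℂ → Fin 3 → ℝ} {w : ℂ}
    (h : IsLocalHarmonic Ω g) (hw : w ∈ Ω) (v : ℂ) : lorentz3 (fderiv ℝ g w v) (g w) = 0 := by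
  have h1 : ((lorentz3 (fderiv ℝ g w v) (g w) : ℝ) : ℂ) = 0 := by
    rw [← lorentz3_ofRealVec, fderiv_apply_eq_two_re (h.differentiableAt hw)]
    have e : ofRealVec (fun i => 2 * (vdz (fun y => ofRealVec (g y)) w i * v).re)
        = v • vdz (fun y => ofRealVec (g y)) w
          + conj v • conjVec (vdz (fun y => ofRealVec (g y)) w) := by
      ext i
      simp only [ofRealVec_apply, Pi.add_apply, Pi.smul_apply, smul_eq_mul, conjVec_apply]
      rw [← map_mul, Complex.add_conj, mul_comm v]
    rw [e, lorentz3_add_left, lorentz3_smul_left, lorentz3_smul_left, lorentz3_comm,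
      h.lorentz3_vdz hw, lorentz3_comm, h.lorentz3_conj_vdz hw]
    ring
  exact_mod_cast h1

theorem eq_of_frequently_eq {X Y : Type*} [TopologicalSpace X] [TopologicalSpace Y] [T2Space Y]
    {f g : X → Y} {x : X} (hf : ContinuousAt f x) (hg : ContinuousAt g x)
    (h : ∃ᶠ y in 𝓝 x, f y = g y) : f x = g x := by
  by_contra hne
  exact h ((hf.ne_iff_eventually_ne hg).1 hne)

namespace IsLocalWeierstrass

variable {Ω : Set ℂ} {g : ℂ → Fin 3 → ℝ} {t : ℂ → ℝ} {w : ℂ} {j : ℂ}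

theorem isoNorm_add_eq (h : IsLocalWeierstrass Ω g t) (hj : j ^ 2 = -1) (hjc : conj j = -j)
    (hw : w ∈ Ω) : isoNorm j g w + isoNorm (-j) g w
      = t w / 4 + ‖lorentz3 (vdz (fun y => ofRealVec (g y)) w)
        (vdz (fun y => ofRealVec (g y)) w)‖ ^ 2 / t w := by
  have h1 := h.metric w hw 1
  rw [fderiv_apply_eq_two_re (h.isLocalHarmonic.differentiableAt hw), lorentz3_two_re,
    ← h.isLocalHarmonic.isoNorm_add hj hjc hw] at h1
  simp at h1
  rw [mul_div_assoc] at h1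
  linarith

/-- The two isotropic lengths have the same sum and product as `t/4` and `|q|²/t`, where `q = ⟨g_z,
g_z⟩`; they are the roots of the same quadratic equation. -/
theorem isoNorm_eq_or (h : IsLocalWeierstrass Ω g t) (hj : j ^ 2 = -1) (hjc : conj j = -j)
    (hw : w ∈ Ω) : isoNorm j g w = t w / 4 ∨ isoNorm j g w
      = ‖lorentz3 (vdz (fun y => ofRealVec (g y)) w) (vdz (fun y => ofRealVec (g y)) w)‖ ^ 2
        / t w := by
  have h1 := h.isoNorm_add_eq hj hjc hw
  have h2 := h.isLocalHarmonic.isoNorm_mul hj hjc hw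
  have h3 := h.pos w hw
  set k := ‖lorentz3 (vdz (fun y => ofRealVec (g y)) w) (vdz (fun y => ofRealVec (g y)) w)‖ ^ 2
  have h4 : t w / 4 * (k / t w) = k / 4 := by field_simp
  have h5 : (isoNorm j g w - t w / 4) * (isoNorm j g w - k / t w) = 0 := by
    linear_combination h4 - h2 + isoNorm j g w * h1
  rcases mul_eq_zero.1 h5 with h6 | h6
  · exact Or.inl (by linarith)
  · exact Or.inr (by linarith)

/-- If `2|q| = t`, the induced form degenerates: a square root `v` of `-q̄` is a nonzero direction
of length zero, so `dg(v) = 0`. -/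
theorem norm_ne_of_regular (h : IsLocalWeierstrass Ω g t) (hw : w ∈ Ω)
    (hr : ∀ v, fderiv ℝ g w v = 0 → v = 0) :
    2 * ‖lorentz3 (vdz (fun y => ofRealVec (g y)) w) (vdz (fun y => ofRealVec (g y)) w)‖
      ≠ t w := by
  intro h1
  set q := lorentz3 (vdz (fun y => ofRealVec (g y)) w) (vdz (fun y => ofRealVec (g y)) w) with hq
  have h3 := h.pos w hw
  obtain ⟨v, hv⟩ := IsAlgClosed.exists_pow_nat_eq (-conj q) (n := 2) (by norm_num)
  have hvn : ‖v‖ ^ 2 = ‖q‖ := by rw [← norm_pow, hv, norm_neg, Complex.norm_conj]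
  have h4 : lorentz3 (fderiv ℝ g w v) (fderiv ℝ g w v) = 0 := by
    rw [h.metric w hw v, ← hq, hv, hvn, mul_neg, Complex.mul_conj', ← h1]
    have h5 : ‖q‖ ≠ 0 := by intro h0; rw [h0] at h1; linarith
    have : (-((‖q‖ : ℂ) ^ 2)).re = -‖q‖ ^ 2 := by
      rw [← Complex.ofReal_pow, Complex.neg_re, Complex.ofReal_re]
    rw [this]
    field_simp
    ring
  have h5 := hr v (eq_zero_of_lorentz3_eq_zero (h.isLocalHarmonic.unit w hw)
    (h.isLocalHarmonic.lorentz3_fderiv_self hw v) h4)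
  rw [h5] at hvn
  simp at hvn
  rw [← hvn] at h1
  linarith

theorem contDiffOn_hopf (h : IsLocalHarmonic Ω g) : ContDiffOn ℝ ∞ (fun w =>
    lorentz3 (vdz (fun y => ofRealVec (g y)) w) (vdz (fun y => ofRealVec (g y)) w)) Ω :=
  ContDiffOn.lorentz3 h.contDiffOn_vdz h.contDiffOn_vdz

theorem continuousAt_norm_sq_div (h : IsLocalWeierstrass Ω g t) (hw : w ∈ Ω) :
    ContinuousAt (fun w => ‖lorentz3 (vdz (fun y => ofRealVec (g y)) w)
      (vdz (fun y => ofRealVec (g y)) w)‖ ^ 2 / t w) w := by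
  have hn := h.isLocalHarmonic.isOpen.mem_nhds hw
  exact (((contDiffOn_hopf h.isLocalHarmonic).continuousOn.continuousAt hn).norm.pow 2).div
    (h.smooth.continuousOn.continuousAt hn) (h.pos w hw).ne'

/-- At a regular point the two possible values are different, and continuity prevents the length
from switching between them nearby. -/
theorem eventually_isoNorm_eq_of_regular (h : IsLocalWeierstrass Ω g t) (hj : j ^ 2 = -1)
    (hjc : conj j = -j) (hw : w ∈ Ω) (hr : ∀ v, fderiv ℝ g w v = 0 → v = 0)
    (hA : isoNorm j g w = t w / 4) : ∀ᶠ y in 𝓝 w, isoNorm j g y = t y / 4 := by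
  have hn := h.isLocalHarmonic.isOpen.mem_nhds hw
  have h1 : isoNorm j g w ≠ ‖lorentz3 (vdz (fun y => ofRealVec (g y)) w)
      (vdz (fun y => ofRealVec (g y)) w)‖ ^ 2 / t w := by
    have h2 := h.norm_ne_of_regular hw hr
    have h3 := h.pos w hw
    rw [hA]
    set q := lorentz3 (vdz (fun y => ofRealVec (g y)) w) (vdz (fun y => ofRealVec (g y)) w)
    intro h4
    apply h2
    have h5 : (2 * ‖q‖) ^ 2 = t w ^ 2 := by
      field_simp at h4
      linarith
    exact (pow_left_inj₀ (by positivity) h3.le (by norm_num)).1 h5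
  have h2 := (((h.isLocalHarmonic.contDiffOn_isoNorm j).continuousOn.continuousAt
    hn).ne_iff_eventually_ne (h.continuousAt_norm_sq_div hw)).1 h1
  filter_upwards [h2, hn] with y hy hyΩ
  exact (h.isoNorm_eq_or hj hjc hyΩ).resolve_right hy

theorem dzbar_dz_log_of_eventually (h : IsLocalWeierstrass Ω g t) (hj : j ^ 2 = -1)
    (hjc : conj j = -j) (hw : w ∈ Ω) (hA : ∀ᶠ y in 𝓝 w, isoNorm j g y = t y / 4) :
    dzbar (dz fun y => (Real.log (t y) : ℂ)) w = (t w / 4 - ‖lorentz3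
      (vdz (fun y => ofRealVec (g y)) w) (vdz (fun y => ofRealVec (g y)) w)‖ ^ 2 / t w : ℝ) := by
  have hpos := h.pos w hw
  have hAw := hA.self_of_nhds
  have h1 := h.isLocalHarmonic.dzbar_dz_log_isoNorm hj hjc hw (by rw [hAw]; positivity)
  rw [hAw] at h1
  have h2 : (fun y => dz (fun y => (Real.log (isoNorm j g y) : ℂ)) y)
      =ᶠ[𝓝 w] dz fun y => (Real.log (t y) : ℂ) := by
    filter_upwards [hA.eventually_nhds, h.isLocalHarmonic.isOpen.mem_nhds hw] with y hy hyΩ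
    have hty := h.pos y hyΩ
    have hd : DifferentiableAt ℝ (fun y => (Real.log (t y) : ℂ)) y :=
      differentiableAt_ofReal ((h.smooth.differentiableAt_of_isOpen
        h.isLocalHarmonic.isOpen hyΩ).log hty.ne')
    have h3 : (fun y => (Real.log (isoNorm j g y) : ℂ))
        =ᶠ[𝓝 y] fun y => (Real.log (t y) : ℂ) - (Real.log 4 : ℂ) := by
      filter_upwards [hy, h.isLocalHarmonic.isOpen.mem_nhds hyΩ] with z hz hzΩ
      rw [hz, Real.log_div (h.pos z hzΩ).ne' (by norm_num)]
      push_cast; ring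
    rw [dz_congr h3, dz_sub hd (differentiableAt_const _), dz_const, sub_zero]
  rw [← dzbar_congr h2, h1]
  congr 2
  field_simp

theorem contDiffOn_log (h : IsLocalWeierstrass Ω g t) :
    ContDiffOn ℝ ∞ (fun w => Real.log (t w)) Ω :=
  h.smooth.log fun w hw => (h.pos w hw).ne'

/-- The Gauss equation of the metric. -/
theorem dzbar_dz_log (h : IsLocalWeierstrass Ω g t) (hw : w ∈ Ω)
    (hr : ∃ᶠ y in 𝓝 w, ∀ v, fderiv ℝ g y v = 0 → v = 0) :
    dzbar (dz fun y => (Real.log (t y) : ℂ)) w = (t w / 4 - ‖lorentz3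
      (vdz (fun y => ofRealVec (g y)) w) (vdz (fun y => ofRealVec (g y)) w)‖ ^ 2 / t w : ℝ) := by
  have hn := h.isLocalHarmonic.isOpen.mem_nhds hw
  have hj : Complex.I ^ 2 = -1 := Complex.I_sq
  have hjc : conj Complex.I = -Complex.I := Complex.conj_I
  have h1 : ContinuousAt (dzbar (dz fun y => (Real.log (t y) : ℂ))) w :=
    ((h.contDiffOn_log.ofReal.dz h.isLocalHarmonic.isOpen).dzbar
      h.isLocalHarmonic.isOpen).continuousOn.continuousAt hn
  have h2 : ContinuousAt (fun w => ((t w / 4 - ‖lorentz3 (vdz (fun y => ofRealVec (g y)) w)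
      (vdz (fun y => ofRealVec (g y)) w)‖ ^ 2 / t w : ℝ) : ℂ)) w :=
    Complex.continuous_ofReal.continuousAt.comp
      (((h.smooth.continuousOn.continuousAt hn).div_const 4).sub (h.continuousAt_norm_sq_div hw))
  refine eq_of_frequently_eq h1 h2 ((hr.and_eventually hn).mono ?_)
  rintro y ⟨hy, hyΩ⟩
  have h3 := h.isoNorm_add_eq hj hjc hyΩ
  -- Whichever isotropic part has length `t/4` near the regular point, its Bochner formula gives the
  -- same equation for `t`. Density and continuity then remove the regularity assumption.
  rcases h.isoNorm_eq_or hj hjc hyΩ with h4 | h4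
  · exact h.dzbar_dz_log_of_eventually hj hjc hyΩ
      (h.eventually_isoNorm_eq_of_regular hj hjc hyΩ hy h4)
  · have hj' : (-Complex.I) ^ 2 = -1 := by rw [neg_sq, hj]
    have hjc' : conj (-Complex.I) = -(-Complex.I) := by rw [map_neg, hjc]
    exact h.dzbar_dz_log_of_eventually hj' hjc' hyΩ
      (h.eventually_isoNorm_eq_of_regular hj' hjc' hyΩ hy (by rw [h4] at h3; linarith))

/-- Subtracting the equation for `t` from the Bochner formula for `A`, the function `d = log A - log
(t/4)` satisfies `d_{zz̄} = (t/4)(e^d - 1) - k (e^{-d} - 1)` with `k = |q|²/t`. So `|d_{zz̄}| ≤ C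
|d|` locally, and unique continuation carries the equality `A = t/4` across singular points. -/
theorem eventually_isoNorm_eq_of_mem_closure (h : IsLocalWeierstrass Ω g t) (hj : j ^ 2 = -1)
    (hjc : conj j = -j) (hr : ∀ w ∈ Ω, ∃ᶠ y in 𝓝 w, ∀ v, fderiv ℝ g y v = 0 → v = 0)
    (hw : w ∈ Ω) (hc : ∃ᶠ x in 𝓝 w, ∀ᶠ y in 𝓝 x, isoNorm j g y = t y / 4) :
    ∀ᶠ y in 𝓝 w, isoNorm j g y = t y / 4 := by
  have hΩ := h.isLocalHarmonic.isOpen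
  have hn := hΩ.mem_nhds hw
  have hAc : ContinuousOn (isoNorm j g) Ω := (h.isLocalHarmonic.contDiffOn_isoNorm j).continuousOn
  have htc : ContinuousOn t Ω := h.smooth.continuousOn
  have hAw : isoNorm j g w = t w / 4 := eq_of_frequently_eq (hAc.continuousAt hn)
    ((htc.continuousAt hn).div_const 4) (hc.mono fun x hx => hx.self_of_nhds)
  have htw := h.pos w hw
  set k : ℂ → ℝ := fun w => ‖lorentz3 (vdz (fun y => ofRealVec (g y)) w)
    (vdz (fun y => ofRealVec (g y)) w)‖ ^ 2 / t w with hk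
  have hkc := h.continuousAt_norm_sq_div hw
  set d : ℂ → ℝ := fun y => Real.log (isoNorm j g y) - Real.log (t y / 4) with hd
  have hdw : d w = 0 := by simp only [hd, hAw, sub_self]
  have hApos : ∀ᶠ y in 𝓝 w, 0 < isoNorm j g y :=
    (hAc.continuousAt hn).eventually_const_lt (by rw [hAw]; positivity)
  have hdcont : ContinuousAt d w :=
    ((hAc.continuousAt hn).log (by rw [hAw]; positivity)).sub
      (((htc.continuousAt hn).div_const 4).log (by positivity))
  have hd1 : ∀ᶠ y in 𝓝 w, |d y| < 1 := by
    have : ContinuousAt (fun y => |d y|) w := hdcont.abs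
    exact this.eventually_lt_const (by simp [hdw])
  have hk1 : ∀ᶠ y in 𝓝 w, k y < k w + 1 := hkc.eventually_lt_const (lt_add_one _)
  have ht1 : ∀ᶠ y in 𝓝 w, t y < t w + 1 :=
    (htc.continuousAt hn).eventually_lt_const (lt_add_one _)
  obtain ⟨ρ, hρ, hball⟩ := Metric.eventually_nhds_iff_ball.1
    (hApos.and (hd1.and (hk1.and (ht1.and hn))))
  have hsub : Metric.ball w ρ ⊆ Ω := fun y hy => (hball y hy).2.2.2.2
  have hdsm : ContDiffOn ℝ ∞ d (Metric.ball w ρ) :=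
    (((h.isLocalHarmonic.contDiffOn_isoNorm j).mono hsub).log fun y hy => (hball y hy).1.ne').sub
      (((h.smooth.mono hsub).div_const 4).log fun y hy =>
        (div_pos (h.pos y (hsub hy)) (by norm_num)).ne')
  have hiff : ∀ y ∈ Metric.ball w ρ, d y = 0 ↔ isoNorm j g y = t y / 4 := fun y hy => by
    rw [hd]
    constructor
    · intro h0
      exact Real.log_injOn_pos (hball y hy).1
        (div_pos (h.pos y (hsub hy)) (by norm_num : (0 : ℝ) < 4)) (sub_eq_zero.1 h0)
    · intro h0
      simp only [h0, sub_self]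
  have hbnh : Metric.ball w ρ ∈ 𝓝 w := Metric.ball_mem_nhds w hρ
  have key : d =ᶠ[𝓝 w] 0 := by
    -- The constant collects the local bounds `t w + 1` and `k w + 1` and the inequality `|eˣ - 1| ≤
    -- 2|x|` for `|x| ≤ 1`.
    refine eventually_eq_zero_of_norm_dzbar_dz_le
      (C := (t w + 1) / 4 * 2 + (k w + 1) * 2) hρ hdsm ?_ ?_
    · intro z hz
      have hzΩ := hsub hz
      obtain ⟨hz1, hz2, hz3, hz4, -⟩ := hball z hz
      have htz := h.pos z hzΩ
      have hkz : 0 ≤ k z := by positivity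
      have hd0 : dzbar (dz fun y => (d y : ℂ)) z
          = ((t z / 4 * (Real.exp (d z) - 1) - k z * (Real.exp (-d z) - 1) : ℝ) : ℂ) := by
        have e1 : (dz fun y => (d y : ℂ)) =ᶠ[𝓝 z] fun y =>
            dz (fun y => (Real.log (isoNorm j g y) : ℂ)) y
              - dz (fun y => (Real.log (t y) : ℂ)) y := by
          filter_upwards [Metric.isOpen_ball.mem_nhds hz] with y hy
          have d1 : DifferentiableAt ℝ (fun y => (Real.log (isoNorm j g y) : ℂ)) y :=
            differentiableAt_ofReal (((h.isLocalHarmonic.contDiffOn_isoNorm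
              j).differentiableAt_of_isOpen hΩ (hsub hy)).log (hball y hy).1.ne')
          have d2 : DifferentiableAt ℝ (fun y => (Real.log (t y) : ℂ)) y :=
            differentiableAt_ofReal (h.contDiffOn_log.differentiableAt_of_isOpen hΩ (hsub hy))
          have e2 : (fun y => (d y : ℂ)) =ᶠ[𝓝 y] fun y =>
              (Real.log (isoNorm j g y) : ℂ) - ((Real.log (t y) : ℂ) - (Real.log 4 : ℂ)) := by
            filter_upwards [hΩ.mem_nhds (hsub hy)] with u hu
            rw [hd]
            simp only
            rw [Real.log_div (h.pos u hu).ne' (by norm_num)]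
            push_cast; ring
          rw [dz_congr e2, dz_sub d1 (d2.sub_const _), dz_sub d2 (differentiableAt_const _),
            dz_const, sub_zero]
        have hsm1 : ContDiffOn ℝ ∞ (fun y => (Real.log (isoNorm j g y) : ℂ)) (Metric.ball w ρ) :=
          (((h.isLocalHarmonic.contDiffOn_isoNorm j).mono hsub).log
            fun y hy => (hball y hy).1.ne').ofReal
        have d1 := (hsm1.dz Metric.isOpen_ball).differentiableAt_of_isOpen Metric.isOpen_ball hz
        have d2 := (h.contDiffOn_log.ofReal.dz hΩ).differentiableAt_of_isOpen hΩ hzΩ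
        have hexp : isoNorm j g z = t z / 4 * Real.exp (d z) := by
          rw [hd]
          simp only
          rw [Real.exp_sub, Real.exp_log hz1, Real.exp_log (by positivity)]
          field_simp
        rw [dzbar_congr e1, dzbar_sub d1 d2,
          h.isLocalHarmonic.dzbar_dz_log_isoNorm hj hjc hzΩ hz1.ne', h.dzbar_dz_log hzΩ (hr z hzΩ),
          ← Complex.ofReal_sub, hexp, Real.exp_neg]
        congr 1
        rw [hk]
        have := (Real.exp_pos (d z)).ne'
        field_simp
        ring
      rw [hd0, Complex.norm_real, Real.norm_eq_abs]
      have b1 := Real.abs_exp_sub_one_le hz2.le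
      have b2 := Real.abs_exp_sub_one_le (x := -d z) (by rw [abs_neg]; exact hz2.le)
      rw [abs_neg] at b2
      calc |t z / 4 * (Real.exp (d z) - 1) - k z * (Real.exp (-d z) - 1)|
          ≤ |t z / 4 * (Real.exp (d z) - 1)| + |k z * (Real.exp (-d z) - 1)| := abs_sub _ _
        _ = t z / 4 * |Real.exp (d z) - 1| + k z * |Real.exp (-d z) - 1| := by
            rw [abs_mul, abs_mul, abs_of_pos (by positivity : 0 < t z / 4), abs_of_nonneg hkz]
        _ ≤ (t w + 1) / 4 * (2 * |d z|) + (k w + 1) * (2 * |d z|) := by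
            gcongr
        _ = ((t w + 1) / 4 * 2 + (k w + 1) * 2) * |d z| := by ring
    · rw [mem_closure_iff_frequently]
      refine (hc.and_eventually hbnh).mono ?_
      rintro x ⟨hx, hxb⟩
      filter_upwards [hx, Metric.isOpen_ball.mem_nhds hxb] with y hy hyb
      exact (hiff y hyb).2 hy
  filter_upwards [key, hbnh] with y hy hyb
  exact (hiff y hyb).1 hy

end IsLocalWeierstrass

end LocalWeierstrass

/-! ### Global choice of the isotropic part and global solutions -/

section GlobalSystem

open ComplexConjugate

variable {S : Type*} [TopologicalSpace S] [ChartedSpace ℂ S]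
  [IsManifold (modelWithCornersSelf ℂ ℂ) ω S] {G : S → Fin 3 → ℝ}
  {Q : OpenPartialHomeomorph S ℂ → ℂ → ℂ} {τ : OpenPartialHomeomorph S ℂ → ℂ → ℝ}

theorem IsWeierstrassData.isLocalWeierstrass (hG : IsHarmonicMap G)
    (hW : IsWeierstrassData G (fun e w => -Q e w) (fun e w => 2 * τ e w))
    {e : OpenPartialHomeomorph S ℂ} (he : e ∈ conformalParams S) :
    IsLocalWeierstrass e.target (readParam e G) (τ e) where
  isLocalHarmonic := hG.isLocalHarmonic he
  smooth := by
    have h := (contDiffOn_const (c := (1 / 2 : ℝ))).mul (hW.isConformalMetric.smooth e he)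
    refine h.congr fun w _ => ?_
    ring
  pos w hw := by
    have := hW.isConformalMetric.pos e he w hw
    linarith
  metric w hw v := by
    have h1 := hW.metric e he w hw v
    have h2 : -Q e w = lorentz3 (vdz (fun y => ofRealVec (readParam e G y)) w)
      (vdz (fun y => ofRealVec (readParam e G y)) w) := hW.hopf e he w hw
    have h3 := hW.isConformalMetric.pos e he w hw
    rw [← h2]
    refine h1.trans ?_
    have h4 : τ e w ≠ 0 := by intro h; rw [h] at h3; linarith
    congr 2
    field_simp
    ring

omit [IsManifold (modelWithCornersSelf ℂ ℂ) ω S] in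
theorem IsWeierstrassData.transition
    (hW : IsWeierstrassData G (fun e w => -Q e w) (fun e w => 2 * τ e w))
    {e e' : OpenPartialHomeomorph S ℂ} (he : e ∈ conformalParams S) (he' : e' ∈ conformalParams S)
    {x : S} (hx : x ∈ e.source) (hx' : x ∈ e'.source) :
    τ e (e x) = τ e' (e' x) * ‖transitionDeriv e e' x‖ ^ 2 := by
  have h : 2 * τ e (e x) = 2 * τ e' (e' x) * ‖transitionDeriv e e' x‖ ^ 2 :=
    hW.isConformalMetric.transform e he e' he' x ⟨hx, hx'⟩
  linarith

theorem isRegularPt_iff_of_isHarmonicMap (hG : IsHarmonicMap G) {e : OpenPartialHomeomorph S ℂ}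
    (he : e ∈ conformalParams S) {w : ℂ} (hw : w ∈ e.target) :
    IsRegularPt G (e.symm w) ↔ ∀ v : ℂ, fderiv ℝ (readParam e G) w v = 0 → v = 0 := by
  have h := isRegularPt_iff (f := G) he (e.map_target hw)
  rw [e.right_inv hw] at h
  exact h ((hG.isLocalHarmonic he).differentiableAt hw)

omit [IsManifold (modelWithCornersSelf ℂ ℂ) ω S] in
theorem frequently_isRegularPt (hsing : interior {x : S | ¬ IsRegularPt G x} = ∅) (x : S) :
    ∃ᶠ y in 𝓝 x, IsRegularPt G y := by
  intro h
  have h1 : x ∈ interior {x : S | ¬ IsRegularPt G x} := mem_interior_iff_mem_nhds.2 h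
  rw [hsing] at h1
  exact h1

theorem frequently_regular_param (hG : IsHarmonicMap G)
    (hsing : interior {x : S | ¬ IsRegularPt G x} = ∅) {e : OpenPartialHomeomorph S ℂ}
    (he : e ∈ conformalParams S) {w : ℂ} (hw : w ∈ e.target) :
    ∃ᶠ y in 𝓝 w, ∀ v : ℂ, fderiv ℝ (readParam e G) y v = 0 → v = 0 := by
  have h1 := (frequently_nhds_iff_param hw).1 (frequently_isRegularPt hsing (e.symm w))
  exact (h1.and_eventually (e.open_target.mem_nhds hw)).mono fun y hy =>
    (isRegularPt_iff_of_isHarmonicMap hG he hy.2).1 hy.1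

/-- One of the two isotropic parts of `G_z` has the length prescribed by the metric, globally. -/
theorem exists_isoNorm_eq [PreconnectedSpace S] (hG : IsHarmonicMap G)
    (hW : IsWeierstrassData G (fun e w => -Q e w) (fun e w => 2 * τ e w))
    (hsing : interior {x : S | ¬ IsRegularPt G x} = ∅) {z₀ : S} (hz₀ : IsRegularPt G z₀) :
    ∃ j : ℂ, j ^ 2 = -1 ∧ conj j = -j ∧ ∀ e ∈ conformalParams S, ∀ w ∈ e.target,
      isoNorm j (readParam e G) w = τ e w / 4 := by
  set p : ℂ → S → Prop := fun j x => isoNorm j (readParam (chartAt ℂ x) G) (chartAt ℂ x x)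
    = τ (chartAt ℂ x) (chartAt ℂ x x) / 4 with hp
  have hinv : ∀ (j : ℂ) (e : OpenPartialHomeomorph S ℂ), e ∈ conformalParams S → ∀ x ∈ e.source,
      (p j x ↔ isoNorm j (readParam e G) (e x) = τ e (e x) / 4) := by
    intro j e he x hx
    have hc := chartAt_mem_conformalParams x
    have hxc := mem_chart_source ℂ x
    have hne : ‖transitionDeriv e (chartAt ℂ x) x‖ ^ 2 ≠ 0 :=
      pow_ne_zero _ (norm_ne_zero_iff.2 (transitionDeriv_ne_zero he hc hx hxc))
    rw [hG.isoNorm_transition he hc hx hxc, hW.transition he hc hx hxc, mul_div_right_comm,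
      mul_left_inj' hne]
  have hinv' : ∀ (j : ℂ) (e : OpenPartialHomeomorph S ℂ), e ∈ conformalParams S →
      ∀ w ∈ e.target, (p j (e.symm w) ↔ isoNorm j (readParam e G) w = τ e w / 4) := by
    intro j e he w hw
    have := hinv j e he (e.symm w) (e.map_target hw)
    rwa [e.right_inv hw] at this
  have hmain : ∀ j : ℂ, j ^ 2 = -1 → conj j = -j → p j z₀ → ∀ x, p j x := by
    intro j hj hjc hjz
    -- The equality is required in a neighbourhood, so openness is automatic. Closedness is unique
    -- continuation, and nonemptiness comes from the regular point `z₀`.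
    set K : Set S := {x | ∀ᶠ y in 𝓝 x, p j y} with hK
    have hKchart : ∀ e ∈ conformalParams S, ∀ w ∈ e.target, (e.symm w ∈ K
        ↔ ∀ᶠ y in 𝓝 w, isoNorm j (readParam e G) y = τ e y / 4) := by
      intro e he w hw
      rw [hK, mem_ofPred_eq, eventually_nhds_iff_param hw]
      refine eventually_congr ?_
      filter_upwards [e.open_target.mem_nhds hw] with y hy
      exact hinv' j e he y hy
    have hopen : IsOpen K := isOpen_setOfPred_eventually_nhds
    have hclosed : IsClosed K := by
      refine isClosed_of_closure_subset fun x hx => ?_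
      set e := chartAt ℂ x with he
      have hec : e ∈ conformalParams S := chartAt_mem_conformalParams x
      have hw : e x ∈ e.target := mem_chart_target ℂ x
      have hxe : e.symm (e x) = x := e.left_inv (mem_chart_source ℂ x)
      rw [mem_closure_iff_frequently, ← hxe, frequently_nhds_iff_param hw] at hx
      rw [← hxe, hKchart e hec _ hw]
      refine (hW.isLocalWeierstrass hG hec).eventually_isoNorm_eq_of_mem_closure hj hjc
        (fun w hw => frequently_regular_param hG hsing hec hw) hw ?_
      exact (hx.and_eventually (e.open_target.mem_nhds hw)).mono fun y hy =>
        (hKchart e hec y hy.2).1 hy.1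
    have hz : z₀ ∈ K := by
      set e := chartAt ℂ z₀ with he
      have hec : e ∈ conformalParams S := chartAt_mem_conformalParams z₀
      have hw : e z₀ ∈ e.target := mem_chart_target ℂ z₀
      have hxe : e.symm (e z₀) = z₀ := e.left_inv (mem_chart_source ℂ z₀)
      rw [← hxe, hKchart e hec _ hw]
      refine (hW.isLocalWeierstrass hG hec).eventually_isoNorm_eq_of_regular hj hjc hw ?_ hjz
      rw [← isRegularPt_iff_of_isHarmonicMap hG hec hw, hxe]
      exact hz₀
    have hun : K = univ := IsClopen.eq_univ ⟨hclosed, hopen⟩ ⟨z₀, hz⟩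
    intro x
    have hx : x ∈ K := hun ▸ mem_univ x
    exact hx.self_of_nhds
  have hw : chartAt ℂ z₀ z₀ ∈ (chartAt ℂ z₀).target := mem_chart_target ℂ z₀
  have hL := hW.isLocalWeierstrass hG (chartAt_mem_conformalParams z₀)
  have hI := Complex.I_sq
  have hIc := Complex.conj_I
  have hI' : (-Complex.I) ^ 2 = -1 := by rw [neg_sq, hI]
  have hIc' : conj (-Complex.I) = -(-Complex.I) := by rw [map_neg, hIc]
  -- At `z₀` one of the two lengths is `τ/4`. If it is not that of `j = i`, the known sum of the
  -- lengths gives it to `j = -i`.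
  rcases hL.isoNorm_eq_or hI hIc hw with h1 | h1
  · exact ⟨Complex.I, hI, hIc, fun e he w hw =>
      (hinv' _ e he w hw).1 (hmain _ hI hIc h1 _)⟩
  · have h2 := hL.isoNorm_add_eq hI hIc hw
    exact ⟨-Complex.I, hI', hIc', fun e he w hw =>
      (hinv' _ e he w hw).1 (hmain _ hI' hIc' (by simp only [hp]; linarith) _)⟩

/-- `ψ` solves the linear system of the surfaces with hyperbolic Gauss map `G` at the point `x`. -/
def SolvesLinearAt (j : ℂ) (G : S → Fin 3 → ℝ) (x : S) (ψ : S → Mink4) : Prop :=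
  ∀ e ∈ conformalParams S, x ∈ e.source →
    HasFDerivAt (readParam e ψ) ((theta j (readParam e G) (e x)).flip (ψ x)) (e x)

theorem solvesLinearAt_of_param (hG : IsHarmonicMap G) {j : ℂ} {x : S} {ψ : S → Mink4}
    {e : OpenPartialHomeomorph S ℂ} (he : e ∈ conformalParams S) (hx : x ∈ e.source)
    (h : HasFDerivAt (readParam e ψ) ((theta j (readParam e G) (e x)).flip (ψ x)) (e x)) :
    SolvesLinearAt j G x ψ := by
  intro e' he' hx'
  refine (h.readParam_transition he' he hx' hx).congr_fderiv ?_
  refine ContinuousLinearMap.ext fun v => ?_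
  simp [hG.theta_transition he' he hx' hx]

omit [IsManifold (modelWithCornersSelf ℂ ℂ) ω S] in
theorem SolvesLinearAt.congr {j : ℂ} {x : S} {ψ φ : S → Mink4} (h : ψ =ᶠ[𝓝 x] φ)
    (hψ : SolvesLinearAt j G x ψ) : SolvesLinearAt j G x φ := by
  intro e he hx
  rw [← h.self_of_nhds]
  refine (hψ e he hx).congr_of_eventuallyEq ?_
  have h1 : ∀ᶠ y in 𝓝 (e.symm (e x)), ψ y = φ y := by rw [e.left_inv hx]; exact h
  rw [eventually_nhds_iff_param (e.map_source hx)] at h1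
  exact h1.mono fun y hy => hy.symm

theorem exists_local_solvesLinearAt (hG : IsHarmonicMap G) {j : ℂ} (hj : j ^ 2 = -1)
    (hjc : conj j = -j)
    (hA : ∀ e ∈ conformalParams S, ∀ w ∈ e.target, isoNorm j (readParam e G) w ≠ 0) (x : S)
    {W : Set S} (hW : W ∈ 𝓝 x) : ∃ U ⊆ W, IsOpen U ∧ x ∈ U ∧
      (∀ y ∈ U, ∀ v, ∃ f, f y = v ∧ ∀ z ∈ U, SolvesLinearAt j G z f) ∧
      ∀ f g, (∀ z ∈ U, SolvesLinearAt j G z f) → (∀ z ∈ U, SolvesLinearAt j G z g) →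
        ∀ y ∈ U, f y = g y → EqOn f g U := by
  set e := chartAt ℂ x
  have he : e ∈ conformalParams S := chartAt_mem_conformalParams x
  have hx : x ∈ e.source := mem_chart_source ℂ x
  have hw : e x ∈ e.target := mem_chart_target ℂ x
  have hL := hG.isLocalHarmonic he
  have hsm := hL.contDiffOn_theta j
  obtain ⟨r, hr, hsol⟩ := exists_forall_mem_ball_hasFDerivAt_of_flat
    (Ω := theta j (readParam e G)) (x₀ := e x)
    ((hsm.contDiffAt (e.open_target.mem_nhds hw)).of_le ENat.LEInfty.out) (by
      filter_upwards [e.open_target.mem_nhds hw] with w hw v k y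
      exact hL.theta_flat hj hjc hw (hA e he w hw) v k y)
  have hnhds : e.target ∩ e.symm ⁻¹' W ∈ 𝓝 (e x) := by
    refine inter_mem (e.open_target.mem_nhds hw) ?_
    exact (e.continuousAt_symm hw).preimage_mem_nhds (by rwa [e.left_inv hx])
  obtain ⟨ρ, hρ, hball⟩ := Metric.mem_nhds_iff.1 hnhds
  set r' := min r ρ
  have hr' : r' ∈ Ioc 0 r := ⟨lt_min hr hρ, min_le_left _ _⟩
  have hsub : Metric.ball (e x) r' ⊆ e.target ∩ e.symm ⁻¹' W :=
    (Metric.ball_subset_ball (min_le_right _ _)).trans hball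
  refine ⟨e.source ∩ e ⁻¹' Metric.ball (e x) r', ?_, ?_, ⟨hx, Metric.mem_ball_self hr'.1⟩, ?_, ?_⟩
  · rintro y ⟨hy, hyb⟩
    have := (hsub hyb).2
    rwa [mem_preimage, e.left_inv hy] at this
  · exact e.isOpen_inter_preimage Metric.isOpen_ball
  · rintro y ⟨hy, hyb⟩ v
    obtain ⟨Y, hY1, hY2⟩ := hsol r' hr' (e y) hyb v
    refine ⟨fun z => Y (e z), hY1, ?_⟩
    rintro z ⟨hz, hzb⟩
    refine solvesLinearAt_of_param hG he hz ?_
    refine (hY2 (e z) hzb).congr_of_eventuallyEq ?_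
    filter_upwards [e.open_target.mem_nhds (e.map_source hz)] with u hu
    rw [readParam, e.right_inv hu]
  · rintro f g hf hg y ⟨hy, hyb⟩ hfg
    have hsolve : ∀ f : S → Mink4,
        (∀ z ∈ e.source ∩ e ⁻¹' Metric.ball (e x) r', SolvesLinearAt j G z f) →
        ∀ w ∈ Metric.ball (e x) r', HasFDerivAt (readParam e f)
          ((theta j (readParam e G) w).flip (readParam e f w)) w := by
      intro f hf w hwb
      have hwt := (hsub hwb).1
      have := hf (e.symm w) ⟨e.map_target hwt, by rwa [mem_preimage, e.right_inv hwt]⟩ e he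
        (e.map_target hwt)
      rwa [e.right_inv hwt] at this
    have h1 : EqOn (readParam e f) (readParam e g) (Metric.ball (e x) r') :=
      eqOn_of_hasFDerivAt_linear (convex_ball _ _)
        (hsm.continuousOn.mono fun w hw => (hsub hw).1) (hsolve f hf) (hsolve g hg) hyb (by
          rw [readParam_apply f hy, readParam_apply g hy, hfg])
    rintro z ⟨hz, hzb⟩
    have := h1 hzb
    rwa [readParam_apply f hz, readParam_apply g hz] at this

theorem exists_solvesLinear [SimplyConnectedSpace S] (hG : IsHarmonicMap G) {j : ℂ}
    (hj : j ^ 2 = -1) (hjc : conj j = -j)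
    (hA : ∀ e ∈ conformalParams S, ∀ w ∈ e.target, isoNorm j (readParam e G) w ≠ 0) (x₀ : S)
    (y₀ : Mink4) : ∃ ψ : S → Mink4, ψ x₀ = y₀ ∧ ∀ x, SolvesLinearAt j G x ψ := by
  have : LocallyPathConnectedSpace S := ChartedSpace.locallyPathConnectedSpace ℂ S
  exact exists_global_solution_of_local (SolvesLinearAt j G)
    (fun x f g h hf => hf.congr h)
    (fun x W hW => exists_local_solvesLinearAt hG hj hjc hA x hW) x₀ y₀

/-- On each local neighbourhood `U` the two solutions agree everywhere or nowhere, so the set of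
agreement is open and closed. -/
theorem eq_of_solvesLinear [PreconnectedSpace S] (hG : IsHarmonicMap G) {j : ℂ}
    (hj : j ^ 2 = -1) (hjc : conj j = -j)
    (hA : ∀ e ∈ conformalParams S, ∀ w ∈ e.target, isoNorm j (readParam e G) w ≠ 0)
    {ψ φ : S → Mink4} (hψ : ∀ x, SolvesLinearAt j G x ψ) (hφ : ∀ x, SolvesLinearAt j G x φ)
    {x₀ : S} (h : ψ x₀ = φ x₀) : ψ = φ := by
  have hloc : ∀ x, ∃ U, IsOpen U ∧ x ∈ U ∧ ∀ y ∈ U, ψ y = φ y → EqOn ψ φ U := fun x => by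
    obtain ⟨U, -, h1, h2, -, h3⟩ := exists_local_solvesLinearAt hG hj hjc hA x univ_mem
    exact ⟨U, h1, h2, h3 ψ φ (fun z _ => hψ z) fun z _ => hφ z⟩
  have hopen : IsOpen {x | ψ x = φ x} := by
    refine isOpen_iff_mem_nhds.2 fun x hx => ?_
    obtain ⟨U, hU, hxU, hE⟩ := hloc x
    exact mem_of_superset (hU.mem_nhds hxU) (hE x hxU hx)
  have hclosed : IsClosed {x | ψ x = φ x} := by
    refine ⟨isOpen_iff_mem_nhds.2 fun x hx => ?_⟩
    obtain ⟨U, hU, hxU, hE⟩ := hloc x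
    exact mem_of_superset (hU.mem_nhds hxU) fun y hyU hy => hx (hE y hyU hy hxU)
  have := IsClopen.eq_univ ⟨hclosed, hopen⟩ ⟨x₀, h⟩
  ext1 x
  have hx : x ∈ {x | ψ x = φ x} := this.symm ▸ mem_univ x
  exact hx

end GlobalSystem

/-! ### Fundamental forms through Wirtinger derivatives -/

section Forms

open ComplexConjugate

/-- Reversed Cauchy–Schwarz inequality for timelike vectors on the same sheet. It makes the angle
function positive, and later separates the sheets. -/
theorem one_le_neg_lorentz3 {x y : Fin 3 → ℝ} (hx : x ∈ hypPlane) (hy : y ∈ hypPlane) :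
    1 ≤ -lorentz3 x y := by
  obtain ⟨hx1, hx2⟩ := hx
  obtain ⟨hy1, hy2⟩ := hy
  simp only [lorentz3] at *
  have h1 : (1 + x 1 * y 1 + x 2 * y 2) ^ 2 ≤ (x 0 * y 0) ^ 2 := by
    have e1 : x 0 ^ 2 = 1 + x 1 ^ 2 + x 2 ^ 2 := by linarith
    have e2 : y 0 ^ 2 = 1 + y 1 ^ 2 + y 2 ^ 2 := by linarith
    rw [mul_pow, e1, e2]
    nlinarith [sq_nonneg (x 1 - y 1), sq_nonneg (x 2 - y 2), sq_nonneg (x 1 * y 2 - x 2 * y 1)]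
  have h2 := abs_le_of_sq_le_sq' h1 (mul_pos hx2 hy2).le
  linarith [h2.2]

variable {ψ η : ℂ → Mink4} {w : ℂ}

theorem fderiv_apply_fst (hψ : DifferentiableAt ℝ ψ w) (v : ℂ) :
    (fderiv ℝ ψ w v).1 = fun i => 2 * (vdz (fun y => ofRealVec (ψ y).1) w i * v).re := by
  have h1 : (fderiv ℝ ψ w v).1 = fderiv ℝ (fun y => (ψ y).1) w v := by
    rw [hψ.hasFDerivAt.fst.fderiv]; rfl
  rw [h1, fderiv_apply_eq_two_re hψ.hasFDerivAt.fst.differentiableAt]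

theorem fderiv_apply_snd (hψ : DifferentiableAt ℝ ψ w) (v : ℂ) :
    (fderiv ℝ ψ w v).2 = 2 * (dz (fun y => ((ψ y).2 : ℂ)) w * v).re := by
  have h1 : (fderiv ℝ ψ w v).2 = fderiv ℝ (fun y => (ψ y).2) w v := by
    rw [hψ.hasFDerivAt.snd.fderiv]; rfl
  rw [h1, fderiv_real_eq_two_re hψ.hasFDerivAt.snd.differentiableAt]

/-- `⟨ψ_z, η_z⟩`, complex bilinearly. -/
def pairDz (ψ η : ℂ → Mink4) (w : ℂ) : ℂ :=
  lorentz3 (vdz (fun y => ofRealVec (ψ y).1) w) (vdz (fun y => ofRealVec (η y).1) w)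
    + dz (fun y => ((ψ y).2 : ℂ)) w * dz (fun y => ((η y).2 : ℂ)) w

/-- `⟨ψ_z, η_z̄⟩`, complex bilinearly. -/
def pairDzbar (ψ η : ℂ → Mink4) (w : ℂ) : ℂ :=
  lorentz3 (vdz (fun y => ofRealVec (ψ y).1) w) (conjVec (vdz (fun y => ofRealVec (η y).1) w))
    + dz (fun y => ((ψ y).2 : ℂ)) w * conj (dz (fun y => ((η y).2 : ℂ)) w)

theorem lorentz4_fderiv (hψ : DifferentiableAt ℝ ψ w) (hη : DifferentiableAt ℝ η w) (v v' : ℂ) :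
    lorentz4 (fderiv ℝ ψ w v) (fderiv ℝ η w v')
      = 2 * (pairDz ψ η w * (v * v')).re + 2 * (pairDzbar ψ η w * (v * conj v')).re := by
  rw [lorentz4, fderiv_apply_fst hψ, fderiv_apply_fst hη, fderiv_apply_snd hψ,
    fderiv_apply_snd hη, lorentz3_two_re, pairDz, pairDzbar]
  simp only [Complex.mul_re, Complex.mul_im, Complex.add_re, Complex.add_im, Complex.conj_re,
    Complex.conj_im]
  ring

theorem pairDzbar_self_im (ψ : ℂ → Mink4) (w : ℂ) : (pairDzbar ψ ψ w).im = 0 := by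
  simp [pairDzbar, lorentz3]
  ring

/-- Testing with `v = 1, i, 1 + i` determines a real quadratic form on `ℂ`. -/
theorem pairDz_eq_zero_of_conformal (hψ : DifferentiableAt ℝ ψ w) {l : ℝ}
    (h : ∀ v, lorentz4 (fderiv ℝ ψ w v) (fderiv ℝ ψ w v) = l * ‖v‖ ^ 2) :
    pairDz ψ ψ w = 0 ∧ pairDzbar ψ ψ w = (l / 2 : ℝ) := by
  have h0 := pairDzbar_self_im ψ w
  have h1 := h 1
  have h2 := h Complex.I
  have h3 := h (1 + Complex.I)
  have hn : ‖(1 : ℂ) + Complex.I‖ ^ 2 = 2 := by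
    rw [← Complex.normSq_eq_norm_sq]; simp [Complex.normSq_apply]; norm_num
  rw [lorentz4_fderiv hψ hψ] at h1 h2 h3
  rw [hn] at h3
  simp [h0] at h1 h2 h3
  refine ⟨Complex.ext ?_ ?_, Complex.ext ?_ ?_⟩
  · simp; linarith
  · simp; linarith
  · simp; linarith
  · simp [h0]

end Forms

/-! ### Mean curvature in a conformal parameter -/

section MeanCurvature

open ComplexConjugate

variable {S : Type*} [TopologicalSpace S] {e : OpenPartialHomeomorph S ℂ} {ψ η : S → Mink4} {w : ℂ}

theorem firstForm_eq (hψ : DifferentiableAt ℝ (readParam e ψ) w)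
    (h : pairDz (readParam e ψ) (readParam e ψ) w = 0) (v v' : ℂ) :
    firstForm e ψ w v v'
      = 2 * (pairDzbar (readParam e ψ) (readParam e ψ) w).re * (v * conj v').re := by
  have h1 := lorentz4_fderiv hψ hψ v v'
  rw [h] at h1
  refine h1.trans ?_
  rw [Complex.mul_re (pairDzbar _ _ _), pairDzbar_self_im]
  simp
  ring

theorem conformalFactor_eq (hψ : DifferentiableAt ℝ (readParam e ψ) w)
    (h : pairDz (readParam e ψ) (readParam e ψ) w = 0) :
    conformalFactor e ψ w = 2 * (pairDzbar (readParam e ψ) (readParam e ψ) w).re := by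
  rw [conformalFactor, firstForm_eq hψ h]; simp

/-- When the first form is a multiple of `|dz|²`, the trace removes the `dz²` and `dz̄²` parts of
the second form. Only the mixed products `⟨ψ_z, η_z̄⟩` and `⟨ψ_z, ψ_z̄⟩` survive. -/
theorem meanCurvature_eq (hψ : DifferentiableAt ℝ (readParam e ψ) w)
    (hη : DifferentiableAt ℝ (readParam e η) w)
    (h : pairDz (readParam e ψ) (readParam e ψ) w = 0)
    (hb : (pairDzbar (readParam e ψ) (readParam e ψ) w).re ≠ 0) :
    meanCurvature e ψ η w = -(pairDzbar (readParam e ψ) (readParam e η) w).re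
      / (pairDzbar (readParam e ψ) (readParam e ψ) w).re := by
  have h1 : secondForm e ψ η w 1 1 + secondForm e ψ η w Complex.I Complex.I
      = -4 * (pairDzbar (readParam e ψ) (readParam e η) w).re := by
    have e1 : secondForm e ψ η w 1 1 = _ := congrArg Neg.neg (lorentz4_fderiv hψ hη 1 1)
    have e2 : secondForm e ψ η w Complex.I Complex.I = _ :=
      congrArg Neg.neg (lorentz4_fderiv hψ hη Complex.I Complex.I)
    rw [e1, e2]
    simp
    ring
  rw [meanCurvature, firstForm_eq hψ h, firstForm_eq hψ h, firstForm_eq hψ h]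
  set b := (pairDzbar (readParam e ψ) (readParam e ψ) w).re
  have h2 : (Complex.I * conj Complex.I).re = 1 := by simp
  have h3 : ((1 : ℂ) * conj Complex.I).re = 0 := by simp
  have h4 : ((1 : ℂ) * conj (1 : ℂ)).re = 1 := by simp
  rw [h2, h3, h4]
  rw [div_eq_div_iff (by ring_nf; positivity) hb]
  linear_combination 2 * b ^ 2 * h1

end MeanCurvature

/-! ### Geometry of the solutions of the linear system -/

section LocalSurface

open ComplexConjugate

/-- A solution with values in `ℍ² × ℝ` of the linear system of the surfaces with hyperbolic Gauss
map `g`, on a domain of `ℂ`. -/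
structure IsLocalSurface (j : ℂ) (Ω : Set ℂ) (g : ℂ → Fin 3 → ℝ) (ψ : ℂ → Mink4) : Prop where
  isLocalHarmonic : IsLocalHarmonic Ω g
  sq_eq : j ^ 2 = -1
  conj_eq : conj j = -j
  isoNorm_pos : ∀ w ∈ Ω, 0 < isoNorm j g w
  hasFDerivAt : ∀ w ∈ Ω, HasFDerivAt ψ ((theta j g w).flip (ψ w)) w
  mem_hypPlane : ∀ w ∈ Ω, (ψ w).1 ∈ hypPlane
  gauss_mem_hypPlane : ∀ w ∈ Ω, g w ∈ hypPlane

/-- The inverse `-⟨N, g⟩` of the angle function. -/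
def invAngle (g : ℂ → Fin 3 → ℝ) (ψ : ℂ → Mink4) (w : ℂ) : ℝ := -lorentz3 (ψ w).1 (g w)

theorem ContDiffOn.lorentz3_real {Ω : Set ℂ} {F H : ℂ → Fin 3 → ℝ}
    (hF : ∀ i, ContDiffOn ℝ ∞ (fun y => F y i) Ω) (hH : ∀ i, ContDiffOn ℝ ∞ (fun y => H y i) Ω) :
    ContDiffOn ℝ ∞ (fun y => _root_.lorentz3 (F y) (H y)) Ω := by
  unfold _root_.lorentz3
  exact (((hF 0).mul (hH 0)).neg.add ((hF 1).mul (hH 1))).add ((hF 2).mul (hH 2))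

theorem lorentz3_gauss (g : ℂ → Fin 3 → ℝ) (ψ : ℂ → Mink4) (w : ℂ) :
    lorentz3 (ofRealVec (ψ w).1) (ofRealVec (g w)) = -(invAngle g ψ w : ℂ) := by
  rw [lorentz3_ofRealVec, invAngle]; push_cast; ring

/-- The unit normal `(1/s)(g, 1) - (N, 0)` of the surface. -/
def gaussNormal (g : ℂ → Fin 3 → ℝ) (ψ : ℂ → Mink4) (w : ℂ) : Mink4 :=
  (fun i => (invAngle g ψ w)⁻¹ * g w i - (ψ w).1 i, (invAngle g ψ w)⁻¹)

theorem ofRealVec_gaussNormal (g : ℂ → Fin 3 → ℝ) (ψ : ℂ → Mink4) (w : ℂ) :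
    ofRealVec (gaussNormal g ψ w).1
      = ((invAngle g ψ w)⁻¹ : ℂ) • ofRealVec (g w) - ofRealVec (ψ w).1 := by
  ext i; simp [gaussNormal]

/-- The derivative of the factor `1/s` multiplies `⟨ψ_z, (g, 1)⟩`, which the hypothesis says is
zero, so that derivative never has to be computed. -/
theorem pairDzbar_gaussNormal_of_orthogonal {g : ℂ → Fin 3 → ℝ} {ψ : ℂ → Mink4} {w : ℂ}
    (hψ : ∀ i, DifferentiableAt ℝ (fun y => (ψ y).1 i) w)
    (hg : ∀ i, DifferentiableAt ℝ (fun y => g y i) w) (hs : invAngle g ψ w ≠ 0)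
    (h : lorentz3 (vdz (fun y => ofRealVec (ψ y).1) w) (ofRealVec (g w))
      = -dz (fun y => ((ψ y).2 : ℂ)) w) :
    pairDzbar ψ (gaussNormal g ψ) w = (invAngle g ψ w : ℂ)⁻¹
        * lorentz3 (vdz (fun y => ofRealVec (ψ y).1) w)
          (conjVec (vdz (fun y => ofRealVec (g y)) w))
      - lorentz3 (vdz (fun y => ofRealVec (ψ y).1) w)
          (conjVec (vdz (fun y => ofRealVec (ψ y).1) w)) := by
  have ds0 : DifferentiableAt ℝ (invAngle g ψ) w :=
    (((((hψ 0).mul (hg 0)).neg.add ((hψ 1).mul (hg 1))).add ((hψ 2).mul (hg 2)))).neg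
  have ds : DifferentiableAt ℝ (fun y => (((invAngle g ψ y)⁻¹ : ℝ) : ℂ)) w :=
    differentiableAt_ofReal (ds0.inv hs)
  set σ := dz (fun y => (((invAngle g ψ y)⁻¹ : ℝ) : ℂ)) w with hσ
  have e1 : vdz (fun y => ofRealVec (gaussNormal g ψ y).1) w = σ • ofRealVec (g w)
      + ((invAngle g ψ w)⁻¹ : ℂ) • vdz (fun y => ofRealVec (g y)) w
      - vdz (fun y => ofRealVec (ψ y).1) w := by
    ext i
    have e0 : (fun y => ofRealVec (gaussNormal g ψ y).1 i) = fun y =>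
        (((invAngle g ψ y)⁻¹ : ℝ) : ℂ) * ofRealVec (g y) i - ofRealVec (ψ y).1 i := by
      ext y; simp [gaussNormal]
    have dg : DifferentiableAt ℝ (fun y => ofRealVec (g y) i) w := differentiableAt_ofReal (hg i)
    have dψ : DifferentiableAt ℝ (fun y => ofRealVec (ψ y).1 i) w := differentiableAt_ofReal (hψ i)
    simp only [vdz]
    rw [e0, dz_sub (ds.fun_mul dg) dψ, dz_mul ds dg]
    simp [vdz, hσ]
  have e2 : dz (fun y => ((gaussNormal g ψ y).2 : ℂ)) w = σ := rfl
  have e4 : conjVec (σ • ofRealVec (g w)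
      + ((invAngle g ψ w)⁻¹ : ℂ) • vdz (fun y => ofRealVec (g y)) w
      - vdz (fun y => ofRealVec (ψ y).1) w) = conj σ • ofRealVec (g w)
      + ((invAngle g ψ w)⁻¹ : ℂ) • conjVec (vdz (fun y => ofRealVec (g y)) w)
      - conjVec (vdz (fun y => ofRealVec (ψ y).1) w) := by
    ext i; simp
  rw [pairDzbar, e1, e2, e4, lorentz3_sub_right, lorentz3_add_right, lorentz3_smul_right,
    lorentz3_smul_right, h]
  ring

namespace IsLocalSurface

variable {j : ℂ} {Ω : Set ℂ} {g : ℂ → Fin 3 → ℝ} {ψ : ℂ → Mink4} {w : ℂ}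

theorem contDiffOn (h : IsLocalSurface j Ω g ψ) : ContDiffOn ℝ ∞ ψ Ω :=
  contDiffOn_of_hasFDerivAt_linear h.isLocalHarmonic.isOpen (h.isLocalHarmonic.contDiffOn_theta j)
    h.hasFDerivAt

theorem contDiffOn_fst (h : IsLocalSurface j Ω g ψ) (i : Fin 3) :
    ContDiffOn ℝ ∞ (fun w => (ψ w).1 i) Ω := contDiffOn_pi.1 h.contDiffOn.fst i

theorem contDiffOn_invAngle (h : IsLocalSurface j Ω g ψ) : ContDiffOn ℝ ∞ (invAngle g ψ) Ω :=
  (ContDiffOn.lorentz3_real h.contDiffOn_fst h.isLocalHarmonic.smooth).neg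

theorem differentiableAt (h : IsLocalSurface j Ω g ψ) (hw : w ∈ Ω) : DifferentiableAt ℝ ψ w :=
  (h.hasFDerivAt w hw).differentiableAt

theorem isoNorm_ne (h : IsLocalSurface j Ω g ψ) (hw : w ∈ Ω) : isoNorm j g w ≠ 0 :=
  (h.isoNorm_pos w hw).ne'

theorem diff_fst (h : IsLocalSurface j Ω g ψ) (hw : w ∈ Ω) (i : Fin 3) :
    DifferentiableAt ℝ (fun y => ofRealVec (ψ y).1 i) w :=
  differentiableAt_ofReal ((h.contDiffOn_fst i).differentiableAt_of_isOpen
    h.isLocalHarmonic.isOpen hw)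

theorem dz_height (h : IsLocalSurface j Ω g ψ) (hw : w ∈ Ω) :
    dz (fun y => ((ψ y).2 : ℂ)) w = 2 * lorentz3 (ofRealVec (ψ w).1) (isoPart j g w) :=
  (vdz_of_hasFDerivAt_theta (h.hasFDerivAt w hw)).2

theorem vdz_fst (h : IsLocalSurface j Ω g ψ) (hw : w ∈ Ω) :
    vdz (fun y => ofRealVec (ψ y).1) w = dz (fun y => ((ψ y).2 : ℂ)) w • ofRealVec (g w)
      + (2 * invAngle g ψ w : ℂ) • isoPart j g w := by
  rw [(vdz_of_hasFDerivAt_theta (h.hasFDerivAt w hw)).1, wedgeVec, ← h.dz_height hw,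
    lorentz3_gauss]
  ext i
  simp

theorem invAngle_pos (h : IsLocalSurface j Ω g ψ) (hw : w ∈ Ω) : 0 < invAngle g ψ w :=
  one_pos.trans_le (one_le_neg_lorentz3 (h.mem_hypPlane w hw) (h.gauss_mem_hypPlane w hw))

theorem lorentz3_conj_isoPart (h : IsLocalSurface j Ω g ψ) (hw : w ∈ Ω) :
    lorentz3 (ofRealVec (ψ w).1) (conjVec (isoPart j g w))
      = conj (dz (fun y => ((ψ y).2 : ℂ)) w) / 2 := by
  rw [lorentz3_ofRealVec_conjVec, h.dz_height hw]
  simp [map_ofNat]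

theorem fst_expand (h : IsLocalSurface j Ω g ψ) (hw : w ∈ Ω) : ofRealVec (ψ w).1
    = (invAngle g ψ w : ℂ) • ofRealVec (g w)
      + (conj (dz (fun y => ((ψ y).2 : ℂ)) w) / (2 * isoNorm j g w)) • isoPart j g w
      + (dz (fun y => ((ψ y).2 : ℂ)) w / (2 * isoNorm j g w)) • conjVec (isoPart j g w) := by
  have hA := Complex.ofReal_ne_zero.2 (h.isoNorm_ne hw)
  have hH := h.isLocalHarmonic
  ext i
  rw [frame_expand hA (hH.lorentz3_isoPart_self h.sq_eq hw)
    (hH.lorentz3_conj_isoPart_self h.sq_eq hw) (ofReal_isoNorm j g w).symm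
    (hH.lorentz3_isoPart_ofRealVec hw j) (hH.lorentz3_conj_isoPart_ofRealVec hw j)
    (hH.lorentz3_ofRealVec_self hw) (ofRealVec (ψ w).1) i, h.lorentz3_conj_isoPart hw,
    lorentz3_gauss, h.dz_height hw]
  simp only [Pi.add_apply, Pi.smul_apply, smul_eq_mul]
  field_simp
  ring

/-- This is `⟨N, N⟩ = -1` in the frame `g, P, P̄`, where `h_z = 2⟨N, P⟩` gives the isotropic
coordinates of `N`. -/
theorem sq_invAngle (h : IsLocalSurface j Ω g ψ) (hw : w ∈ Ω) : invAngle g ψ w ^ 2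
    = 1 + ‖dz (fun y => ((ψ y).2 : ℂ)) w‖ ^ 2 / (2 * isoNorm j g w) := by
  have hA := Complex.ofReal_ne_zero.2 (h.isoNorm_ne hw)
  have h1 : lorentz3 (ofRealVec (ψ w).1) (ofRealVec (ψ w).1) = -1 := by
    rw [lorentz3_ofRealVec, (h.mem_hypPlane w hw).1]; simp
  have h2 : lorentz3 (ofRealVec (ψ w).1) (ofRealVec (ψ w).1) = -(invAngle g ψ w : ℂ) ^ 2
      + dz (fun y => ((ψ y).2 : ℂ)) w * conj (dz (fun y => ((ψ y).2 : ℂ)) w)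
        / (2 * isoNorm j g w) := by
    have h0 : lorentz3 (ofRealVec (ψ w).1) (isoPart j g w)
        = dz (fun y => ((ψ y).2 : ℂ)) w / 2 := by rw [h.dz_height hw]; ring
    refine (congrArg (lorentz3 (ofRealVec (ψ w).1)) (h.fst_expand hw)).trans ?_
    rw [lorentz3_add_right, lorentz3_add_right, lorentz3_smul_right, lorentz3_smul_right,
      lorentz3_smul_right, lorentz3_gauss, h.lorentz3_conj_isoPart hw, h0]
    field_simp
    ring
  rw [h1, Complex.mul_conj'] at h2
  have h3 : ((invAngle g ψ w ^ 2 : ℝ) : ℂ)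
      = ((1 + ‖dz (fun y => ((ψ y).2 : ℂ)) w‖ ^ 2 / (2 * isoNorm j g w) : ℝ) : ℂ) := by
    push_cast
    linear_combination h2
  exact_mod_cast h3

theorem mul_conj_dz_height (h : IsLocalSurface j Ω g ψ) (hw : w ∈ Ω) :
    dz (fun y => ((ψ y).2 : ℂ)) w * conj (dz (fun y => ((ψ y).2 : ℂ)) w)
      = 2 * isoNorm j g w * ((invAngle g ψ w : ℂ) ^ 2 - 1) := by
  have hA := h.isoNorm_ne hw
  have h1 : ‖dz (fun y => ((ψ y).2 : ℂ)) w‖ ^ 2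
      = 2 * isoNorm j g w * (invAngle g ψ w ^ 2 - 1) := by
    rw [h.sq_invAngle hw]; field_simp; ring
  rw [Complex.mul_conj']
  exact_mod_cast h1

theorem conj_vdz_fst (h : IsLocalSurface j Ω g ψ) (hw : w ∈ Ω) :
    conjVec (vdz (fun y => ofRealVec (ψ y).1) w)
      = conj (dz (fun y => ((ψ y).2 : ℂ)) w) • ofRealVec (g w)
        + (2 * invAngle g ψ w : ℂ) • conjVec (isoPart j g w) := by
  rw [h.vdz_fst hw]
  ext i
  simp [map_ofNat]

theorem lorentz3_fst_vdz (h : IsLocalSurface j Ω g ψ) (hw : w ∈ Ω) :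
    lorentz3 (ofRealVec (ψ w).1) (vdz (fun y => ofRealVec (ψ y).1) w) = 0 := by
  rw [h.vdz_fst hw, lorentz3_add_right, lorentz3_smul_right, lorentz3_smul_right, lorentz3_gauss,
    h.dz_height hw]
  ring

theorem lorentz3_vdz_gauss (h : IsLocalSurface j Ω g ψ) (hw : w ∈ Ω) :
    lorentz3 (vdz (fun y => ofRealVec (ψ y).1) w) (ofRealVec (g w))
      = -dz (fun y => ((ψ y).2 : ℂ)) w := by
  rw [h.vdz_fst hw, lorentz3_add_left, lorentz3_smul_left, lorentz3_smul_left,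
    h.isLocalHarmonic.lorentz3_ofRealVec_self hw, h.isLocalHarmonic.lorentz3_isoPart_ofRealVec hw]
  ring

theorem lorentz3_vdz_isoPart (h : IsLocalSurface j Ω g ψ) (hw : w ∈ Ω) :
    lorentz3 (vdz (fun y => ofRealVec (ψ y).1) w) (isoPart j g w) = 0 := by
  rw [h.vdz_fst hw, lorentz3_add_left, lorentz3_smul_left, lorentz3_smul_left,
    lorentz3_comm (ofRealVec (g w)), h.isLocalHarmonic.lorentz3_isoPart_ofRealVec hw,
    h.isLocalHarmonic.lorentz3_isoPart_self h.sq_eq hw]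
  ring

theorem lorentz3_vdz_conj_isoPart (h : IsLocalSurface j Ω g ψ) (hw : w ∈ Ω) :
    lorentz3 (vdz (fun y => ofRealVec (ψ y).1) w) (conjVec (isoPart j g w))
      = 2 * invAngle g ψ w * isoNorm j g w := by
  rw [h.vdz_fst hw, lorentz3_add_left, lorentz3_smul_left, lorentz3_smul_left,
    lorentz3_comm (ofRealVec (g w)), h.isLocalHarmonic.lorentz3_conj_isoPart_ofRealVec hw,
    ← ofReal_isoNorm]
  ring

theorem pairDz_self (h : IsLocalSurface j Ω g ψ) (hw : w ∈ Ω) : pairDz ψ ψ w = 0 := by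
  rw [pairDz]
  conv_lhs => enter [1, 2]; rw [h.vdz_fst hw]
  rw [lorentz3_add_right, lorentz3_smul_right, lorentz3_smul_right, h.lorentz3_vdz_gauss hw,
    h.lorentz3_vdz_isoPart hw]
  ring

theorem lorentz3_vdz_conj_vdz (h : IsLocalSurface j Ω g ψ) (hw : w ∈ Ω) :
    lorentz3 (vdz (fun y => ofRealVec (ψ y).1) w) (conjVec (vdz (fun y => ofRealVec (ψ y).1) w))
      = -(dz (fun y => ((ψ y).2 : ℂ)) w * conj (dz (fun y => ((ψ y).2 : ℂ)) w))
        + 4 * (invAngle g ψ w : ℂ) ^ 2 * isoNorm j g w := by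
  rw [h.conj_vdz_fst hw, lorentz3_add_right, lorentz3_smul_right, lorentz3_smul_right,
    h.lorentz3_vdz_gauss hw, h.lorentz3_vdz_conj_isoPart hw]
  ring

theorem pairDzbar_self (h : IsLocalSurface j Ω g ψ) (hw : w ∈ Ω) :
    pairDzbar ψ ψ w = (4 * invAngle g ψ w ^ 2 * isoNorm j g w : ℝ) := by
  rw [pairDzbar, h.lorentz3_vdz_conj_vdz hw]
  push_cast
  ring

/-- Pairing `v N_z + v̄ N_z̄` with `P̄` eliminates `N_z̄`, as `⟨N_z, P⟩ = 0`, and leaves `2 s A v`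
with `s A ≠ 0`. -/
theorem injective_fderiv_fst (h : IsLocalSurface j Ω g ψ) (hw : w ∈ Ω) (v : ℂ)
    (hv : fderiv ℝ (fun y => (ψ y).1) w v = 0) : v = 0 := by
  have hd : DifferentiableAt ℝ (fun y => (ψ y).1) w :=
    (h.hasFDerivAt w hw).fst.differentiableAt
  rw [fderiv_apply_eq_two_re hd] at hv
  have e : v • vdz (fun y => ofRealVec (ψ y).1) w
      + conj v • conjVec (vdz (fun y => ofRealVec (ψ y).1) w) = 0 := by
    ext i
    have h1 : 2 * (vdz (fun y => ofRealVec (ψ y).1) w i * v).re = 0 := congrFun hv i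
    simp only [Pi.add_apply, Pi.smul_apply, smul_eq_mul, conjVec_apply]
    rw [← map_mul, Complex.add_conj, mul_comm v, h1]
    simp
  have h1 := congrArg (fun V => lorentz3 V (conjVec (isoPart j g w))) e
  rw [lorentz3_add_left, lorentz3_smul_left, lorentz3_smul_left, h.lorentz3_vdz_conj_isoPart hw,
    lorentz3_conjVec, h.lorentz3_vdz_isoPart hw, map_zero, mul_zero, add_zero] at h1
  have h2 : lorentz3 (0 : Fin 3 → ℂ) (conjVec (isoPart j g w)) = 0 := by simp [lorentz3]
  rw [h2] at h1
  have h3 := Complex.ofReal_ne_zero.2 (h.invAngle_pos hw).ne'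
  have h4 := Complex.ofReal_ne_zero.2 (h.isoNorm_ne hw)
  simpa [h3, h4] using h1

theorem contDiffOn_gaussNormal (h : IsLocalSurface j Ω g ψ) : ContDiffOn ℝ ∞ (gaussNormal g ψ) Ω := by
  have hs := h.contDiffOn_invAngle.inv fun w hw => (h.invAngle_pos hw).ne'
  exact (contDiffOn_pi.2 fun i =>
    (hs.mul (h.isLocalHarmonic.smooth i)).sub (h.contDiffOn_fst i)).prodMk hs

theorem lorentz4_gaussNormal (h : IsLocalSurface j Ω g ψ) (hw : w ∈ Ω) :
    lorentz4 (gaussNormal g ψ w) (gaussNormal g ψ w) = 1 := by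
  have h1 := (h.mem_hypPlane w hw).1
  have h2 := (h.gauss_mem_hypPlane w hw).1
  have h3 := (h.invAngle_pos hw).ne'
  have h4 : lorentz3 (ψ w).1 (g w) = -invAngle g ψ w := by simp [invAngle]
  have h5 : (invAngle g ψ w)⁻¹ * invAngle g ψ w = 1 := inv_mul_cancel₀ h3
  have e : lorentz4 (gaussNormal g ψ w) (gaussNormal g ψ w) = (invAngle g ψ w)⁻¹ ^ 2 * lorentz3 (g w) (g w)
      - 2 * (invAngle g ψ w)⁻¹ * lorentz3 (ψ w).1 (g w) + lorentz3 (ψ w).1 (ψ w).1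
      + (invAngle g ψ w)⁻¹ ^ 2 := by
    simp only [lorentz4, lorentz3, gaussNormal]; ring
  rw [e, h1, h2, h4]
  linear_combination 2 * h5

theorem lorentz4_gaussNormal_fst (h : IsLocalSurface j Ω g ψ) (hw : w ∈ Ω) :
    lorentz4 (gaussNormal g ψ w) ((ψ w).1, 0) = 0 := by
  have h1 := (h.mem_hypPlane w hw).1
  have h3 := (h.invAngle_pos hw).ne'
  have h4 : lorentz3 (ψ w).1 (g w) = -invAngle g ψ w := by simp [invAngle]
  have h5 : (invAngle g ψ w)⁻¹ * invAngle g ψ w = 1 := inv_mul_cancel₀ h3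
  have e : lorentz4 (gaussNormal g ψ w) ((ψ w).1, 0)
      = (invAngle g ψ w)⁻¹ * lorentz3 (ψ w).1 (g w) - lorentz3 (ψ w).1 (ψ w).1 := by
    simp only [lorentz4, lorentz3, gaussNormal]; ring
  rw [e, h1, h4]
  linear_combination -h5

theorem lorentz4_gaussNormal_fderiv (h : IsLocalSurface j Ω g ψ) (hw : w ∈ Ω) (v : ℂ) :
    lorentz4 (gaussNormal g ψ w) (fderiv ℝ ψ w v) = 0 := by
  have h1 : ((lorentz4 (gaussNormal g ψ w) (fderiv ℝ ψ w v) : ℝ) : ℂ) = 0 := by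
    have e : ofRealVec (fderiv ℝ ψ w v).1 = v • vdz (fun y => ofRealVec (ψ y).1) w
        + conj v • conjVec (vdz (fun y => ofRealVec (ψ y).1) w) := by
      ext i
      rw [fderiv_apply_fst (h.differentiableAt hw)]
      simp only [ofRealVec_apply, Pi.add_apply, Pi.smul_apply, smul_eq_mul, conjVec_apply]
      rw [← map_mul, Complex.add_conj, mul_comm v]
    have e2 : (((fderiv ℝ ψ w v).2 : ℝ) : ℂ) = v * dz (fun y => ((ψ y).2 : ℂ)) w
        + conj v * conj (dz (fun y => ((ψ y).2 : ℂ)) w) := by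
      rw [fderiv_apply_snd (h.differentiableAt hw), ← map_mul, Complex.add_conj, mul_comm v]
    rw [lorentz4, Complex.ofReal_add, ← lorentz3_ofRealVec, ofRealVec_gaussNormal, e,
      Complex.ofReal_mul, e2]
    rw [lorentz3_sub_left, lorentz3_smul_left, lorentz3_add_right, lorentz3_smul_right,
      lorentz3_smul_right, lorentz3_add_right, lorentz3_smul_right, lorentz3_smul_right,
      lorentz3_ofRealVec_conjVec, lorentz3_ofRealVec_conjVec, h.lorentz3_fst_vdz hw,
      lorentz3_comm (ofRealVec (g w)), h.lorentz3_vdz_gauss hw]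
    simp only [gaussNormal, map_neg, map_zero, Complex.ofReal_inv]
    ring
  exact_mod_cast h1

/-- The value is minus one half of `⟨ψ_z, ψ_z̄⟩`, and this is mean curvature one half. The second
isotropic part of `g_z` plays no role: its conjugate is orthogonal to both `g` and `P`, which span
`N_z`. -/
theorem pairDzbar_gaussNormal (h : IsLocalSurface j Ω g ψ) (hw : w ∈ Ω) :
    pairDzbar ψ (gaussNormal g ψ) w = (-(2 * invAngle g ψ w ^ 2 * isoNorm j g w) : ℝ) := by
  have hX := isoPart_add_isoPart_neg j g w
  have e3 : lorentz3 (vdz (fun y => ofRealVec (ψ y).1) w)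
      (conjVec (vdz (fun y => ofRealVec (g y)) w)) = 2 * invAngle g ψ w * isoNorm j g w := by
    have hXc : conjVec (vdz (fun y => ofRealVec (g y)) w)
        = conjVec (isoPart j g w) + conjVec (isoPart (-j) g w) := by
      rw [← hX]; ext i; simp
    rw [hXc, lorentz3_add_right, h.lorentz3_vdz_conj_isoPart hw, h.vdz_fst hw, lorentz3_add_left,
      lorentz3_smul_left, lorentz3_smul_left, lorentz3_comm (ofRealVec (g w)),
      h.isLocalHarmonic.lorentz3_conj_isoPart_ofRealVec hw,
      h.isLocalHarmonic.lorentz3_isoPart_conj_neg h.sq_eq h.conj_eq hw]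
    ring
  have h3 := Complex.ofReal_ne_zero.2 (h.invAngle_pos hw).ne'
  rw [pairDzbar_gaussNormal_of_orthogonal (fun i => (h.contDiffOn_fst i).differentiableAt_of_isOpen
      h.isLocalHarmonic.isOpen hw) (fun i => (h.isLocalHarmonic.smooth i).differentiableAt_of_isOpen
      h.isLocalHarmonic.isOpen hw) (h.invAngle_pos hw).ne' (h.lorentz3_vdz_gauss hw), e3,
    h.lorentz3_vdz_conj_vdz hw]
  have h4 := h.mul_conj_dz_height hw
  have h5 : (invAngle g ψ w : ℂ)⁻¹ * invAngle g ψ w = 1 := inv_mul_cancel₀ h3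
  push_cast
  linear_combination h4 + 2 * (isoNorm j g w : ℂ) * h5

theorem dzbar_dz_height (h : IsLocalSurface j Ω g ψ) (hw : w ∈ Ω) :
    dzbar (dz fun y => ((ψ y).2 : ℂ)) w = (2 * isoNorm j g w * invAngle g ψ w : ℝ) := by
  have e : (dz fun y => ((ψ y).2 : ℂ)) =ᶠ[𝓝 w] fun y =>
      2 * lorentz3 (ofRealVec (ψ y).1) (isoPart j g y) := by
    filter_upwards [h.isLocalHarmonic.isOpen.mem_nhds hw] with y hy
    exact h.dz_height hy
  have hd : DifferentiableAt ℝ (fun y => lorentz3 (ofRealVec (ψ y).1) (isoPart j g y)) w :=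
    (ContDiffOn.lorentz3 (fun i => (h.contDiffOn_fst i).ofReal)
      (h.isLocalHarmonic.contDiffOn_isoPart j)).differentiableAt_of_isOpen
      h.isLocalHarmonic.isOpen hw
  have e2 : vdzbar (fun y => ofRealVec (ψ y).1) w
      = conjVec (vdz (fun y => ofRealVec (ψ y).1) w) := vdzbar_ofRealVec (fun y => (ψ y).1) w
  rw [dzbar_congr e, dzbar_const_mul _ hd, dzbar_lorentz3 (h.diff_fst hw)
    (h.isLocalHarmonic.diff_isoPart hw j), e2, h.conj_vdz_fst hw,
    h.isLocalHarmonic.vdzbar_isoPart h.sq_eq h.conj_eq hw, lorentz3_smul_right, lorentz3_gauss,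
    lorentz3_add_left, lorentz3_smul_left, lorentz3_smul_left, lorentz3_comm (ofRealVec (g w)),
    h.isLocalHarmonic.lorentz3_isoPart_ofRealVec hw, lorentz3_comm (conjVec _), ← ofReal_isoNorm]
  push_cast
  ring

/-- In the derivative of `h_z = 2⟨N, P⟩` the term `⟨N_z, P⟩` is zero, and the formula for `P_z`
evaluates the other one. -/
theorem dz_dz_height (h : IsLocalSurface j Ω g ψ) (hw : w ∈ Ω) :
    dz (dz fun y => ((ψ y).2 : ℂ)) w
      = dz (fun y => (isoNorm j g y : ℂ)) w / isoNorm j g w * dz (fun y => ((ψ y).2 : ℂ)) w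
        - lorentz3 (vdz (fun y => ofRealVec (g y)) w) (vdz (fun y => ofRealVec (g y)) w)
          * invAngle g ψ w := by
  have e : (dz fun y => ((ψ y).2 : ℂ)) =ᶠ[𝓝 w] fun y =>
      2 * lorentz3 (ofRealVec (ψ y).1) (isoPart j g y) := by
    filter_upwards [h.isLocalHarmonic.isOpen.mem_nhds hw] with y hy
    exact h.dz_height hy
  have hd : DifferentiableAt ℝ (fun y => lorentz3 (ofRealVec (ψ y).1) (isoPart j g y)) w :=
    (ContDiffOn.lorentz3 (fun i => (h.contDiffOn_fst i).ofReal)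
      (h.isLocalHarmonic.contDiffOn_isoPart j)).differentiableAt_of_isOpen
      h.isLocalHarmonic.isOpen hw
  rw [dz_congr e, dz_const_mul _ hd, dz_lorentz3 (h.diff_fst hw)
    (h.isLocalHarmonic.diff_isoPart hw j), h.lorentz3_vdz_isoPart hw,
    h.isLocalHarmonic.vdz_isoPart h.sq_eq h.conj_eq hw (h.isoNorm_ne hw), lorentz3_add_right,
    lorentz3_smul_right, lorentz3_smul_right, lorentz3_gauss, h.dz_height hw]
  ring

end IsLocalSurface

end LocalSurface

/-! ### Recovering the projection from the height -/

section Reconstruction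

open ComplexConjugate

/-- Were `x` on the lower sheet, `-x` would be on the upper one, and the reversed Cauchy–Schwarz
inequality would give `⟨x, y⟩` the wrong sign. -/
theorem mem_hypPlane_of_lorentz3_neg {x y : Fin 3 → ℝ} (hx : lorentz3 x x = -1)
    (hy : y ∈ hypPlane) (h : lorentz3 x y < 0) : x ∈ hypPlane := by
  refine ⟨hx, ?_⟩
  by_contra h0
  have hx0 : x 0 ≠ 0 := by
    intro h1
    simp only [lorentz3, h1] at hx
    nlinarith [sq_nonneg (x 1), sq_nonneg (x 2)]
  have h1 : (-x) ∈ hypPlane := by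
    refine ⟨?_, ?_⟩
    · rw [← hx]; simp [lorentz3]
    · have := lt_of_le_of_ne (not_lt.1 h0) hx0
      simpa using this
  have h2 := one_le_neg_lorentz3 h1 hy
  have h3 : lorentz3 (-x) y = -lorentz3 x y := by simp [lorentz3]; ring
  linarith

/-- The point of `ℍ²` determined by the hyperbolic Gauss map and the differential `p` of the height
function. -/
def recon (j : ℂ) (g : ℂ → Fin 3 → ℝ) (p w : ℂ) : Fin 3 → ℝ := fun i =>
  Real.sqrt (1 + ‖p‖ ^ 2 / (2 * isoNorm j g w)) * g w i
    + (conj p * isoPart j g w i).re / isoNorm j g w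

theorem ofRealVec_recon (j : ℂ) (g : ℂ → Fin 3 → ℝ) (p w : ℂ) : ofRealVec (recon j g p w)
    = (Real.sqrt (1 + ‖p‖ ^ 2 / (2 * isoNorm j g w)) : ℂ) • ofRealVec (g w)
      + (conj p / (2 * isoNorm j g w)) • isoPart j g w
      + (p / (2 * isoNorm j g w)) • conjVec (isoPart j g w) := by
  ext i
  simp only [ofRealVec_apply, recon, Pi.add_apply, Pi.smul_apply, smul_eq_mul, conjVec_apply,
    Complex.ofReal_add, Complex.ofReal_mul, Complex.ofReal_div]
  rw [Complex.re_eq_add_conj, map_mul, Complex.conj_conj]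
  ring

namespace IsLocalSurface

variable {j : ℂ} {Ω : Set ℂ} {g : ℂ → Fin 3 → ℝ} {ψ : ℂ → Mink4} {w : ℂ}

theorem invAngle_eq_sqrt (h : IsLocalSurface j Ω g ψ) (hw : w ∈ Ω) : invAngle g ψ w
    = Real.sqrt (1 + ‖dz (fun y => ((ψ y).2 : ℂ)) w‖ ^ 2 / (2 * isoNorm j g w)) := by
  rw [← h.sq_invAngle hw, Real.sqrt_sq (h.invAngle_pos hw).le]

theorem fst_eq_recon (h : IsLocalSurface j Ω g ψ) (hw : w ∈ Ω) :
    (ψ w).1 = recon j g (dz (fun y => ((ψ y).2 : ℂ)) w) w := by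
  have h1 := h.fst_expand hw
  rw [h.invAngle_eq_sqrt hw, ← ofRealVec_recon] at h1
  ext i
  exact Complex.ofReal_injective (congrFun h1 i)

end IsLocalSurface

namespace IsLocalHarmonic

variable {Ω : Set ℂ} {g : ℂ → Fin 3 → ℝ} {w : ℂ} {j : ℂ}

theorem lorentz3_recon_ofRealVec (h : IsLocalHarmonic Ω g) (hw : w ∈ Ω) (p : ℂ) :
    lorentz3 (ofRealVec (recon j g p w)) (ofRealVec (g w))
      = -(Real.sqrt (1 + ‖p‖ ^ 2 / (2 * isoNorm j g w)) : ℂ) := by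
  rw [ofRealVec_recon, lorentz3_add_left, lorentz3_add_left, lorentz3_smul_left,
    lorentz3_smul_left, lorentz3_smul_left, h.lorentz3_ofRealVec_self hw,
    h.lorentz3_isoPart_ofRealVec hw, h.lorentz3_conj_isoPart_ofRealVec hw]
  ring

theorem lorentz3_recon_isoPart (h : IsLocalHarmonic Ω g) (hj : j ^ 2 = -1) (hw : w ∈ Ω)
    (hA : isoNorm j g w ≠ 0) (p : ℂ) :
    lorentz3 (ofRealVec (recon j g p w)) (isoPart j g w) = p / 2 := by
  have hA' := Complex.ofReal_ne_zero.2 hA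
  rw [ofRealVec_recon, lorentz3_add_left, lorentz3_add_left, lorentz3_smul_left,
    lorentz3_smul_left, lorentz3_smul_left, lorentz3_comm (ofRealVec (g w)),
    h.lorentz3_isoPart_self hj hw, h.lorentz3_isoPart_ofRealVec hw, lorentz3_comm (conjVec _),
    ← ofReal_isoNorm]
  field_simp
  ring

/-- The square root in `recon` is the coefficient of `g` that normalises the length to `-1`. Being
positive, it selects the sheet of `g`. -/
theorem recon_mem_hypPlane (h : IsLocalHarmonic Ω g) (hj : j ^ 2 = -1) (hw : w ∈ Ω)
    (hA : 0 < isoNorm j g w) (hg : g w ∈ hypPlane) (p : ℂ) : recon j g p w ∈ hypPlane := by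
  have hA' := Complex.ofReal_ne_zero.2 hA.ne'
  have hs : 0 < 1 + ‖p‖ ^ 2 / (2 * isoNorm j g w) := by positivity
  refine mem_hypPlane_of_lorentz3_neg ?_ hg ?_
  · have h1 : lorentz3 (ofRealVec (recon j g p w)) (ofRealVec (recon j g p w)) = -1 := by
      have h2 : lorentz3 (ofRealVec (recon j g p w)) (conjVec (isoPart j g w)) = conj p / 2 := by
        rw [lorentz3_ofRealVec_conjVec, h.lorentz3_recon_isoPart hj hw hA.ne', map_div₀,
          map_ofNat]
      refine (congrArg (lorentz3 (ofRealVec (recon j g p w))) (ofRealVec_recon j g p w)).trans ?_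
      rw [lorentz3_add_right, lorentz3_add_right, lorentz3_smul_right, lorentz3_smul_right,
        lorentz3_smul_right, h.lorentz3_recon_ofRealVec hw, h.lorentz3_recon_isoPart hj hw hA.ne',
        h2]
      have h3 : ((Real.sqrt (1 + ‖p‖ ^ 2 / (2 * isoNorm j g w)) : ℝ) : ℂ) ^ 2
          = 1 + p * conj p / (2 * isoNorm j g w) := by
        rw [← Complex.ofReal_pow, Real.sq_sqrt hs.le, Complex.mul_conj']
        push_cast; ring
      have h4 : conj p / (2 * isoNorm j g w) * (p / 2) + p / (2 * isoNorm j g w) * (conj p / 2)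
          = p * conj p / (2 * isoNorm j g w) := by ring
      linear_combination h4 - h3
    rw [lorentz3_ofRealVec] at h1
    exact_mod_cast h1
  · have h1 := h.lorentz3_recon_ofRealVec (j := j) hw p
    rw [lorentz3_ofRealVec] at h1
    have h2 : lorentz3 (recon j g p w) (g w)
        = -Real.sqrt (1 + ‖p‖ ^ 2 / (2 * isoNorm j g w)) := by exact_mod_cast h1
    rw [h2, neg_lt_zero]
    exact Real.sqrt_pos.2 hs

/-- A solution of the height system gives rise to a solution of the linear system. -/
theorem hasFDerivAt_theta_of_height (h : IsLocalHarmonic Ω g) (hj : j ^ 2 = -1)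
    (hjc : conj j = -j) (hw : w ∈ Ω) (hA : ∀ w ∈ Ω, 0 < isoNorm j g w) {f : ℂ → ℝ}
    (hf : ContDiffAt ℝ 2 f w)
    (hzz : dz (dz fun y => (f y : ℂ)) w
      = dz (fun y => (isoNorm j g y : ℂ)) w / isoNorm j g w * dz (fun y => (f y : ℂ)) w
        - lorentz3 (vdz (fun y => ofRealVec (g y)) w) (vdz (fun y => ofRealVec (g y)) w)
          * Real.sqrt (1 + ‖dz (fun y => (f y : ℂ)) w‖ ^ 2 / (2 * isoNorm j g w)))
    (hzzbar : dzbar (dz fun y => (f y : ℂ)) w = (2 * isoNorm j g w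
      * Real.sqrt (1 + ‖dz (fun y => (f y : ℂ)) w‖ ^ 2 / (2 * isoNorm j g w)) : ℝ)) :
    HasFDerivAt (fun y => (recon j g (dz (fun y => (f y : ℂ)) y) y, f y))
      ((theta j g w).flip (recon j g (dz (fun y => (f y : ℂ)) w) w, f w)) w := by
  have hAw := hA w hw
  have hA' := Complex.ofReal_ne_zero.2 hAw.ne'
  have hfd : DifferentiableAt ℝ f w := hf.differentiableAt (by norm_num)
  have hfC : ContDiffAt ℝ 2 (fun y => (f y : ℂ)) w :=
    Complex.ofRealCLM.contDiff.contDiffAt.comp w hf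
  set p : ℂ → ℂ := dz fun y => (f y : ℂ) with hp
  have dp : DifferentiableAt ℝ p w := by
    have h1 : DifferentiableAt ℝ (fun y => fderiv ℝ (fun y => (f y : ℂ)) y 1) w :=
      differentiableAt_fderiv_apply hfC 1
    have h2 : DifferentiableAt ℝ (fun y => fderiv ℝ (fun y => (f y : ℂ)) y Complex.I) w :=
      differentiableAt_fderiv_apply hfC Complex.I
    have h3 := h1.fun_sub (h2.const_mul Complex.I)
    have h4 : p = fun y => (2 : ℂ)⁻¹ * (fderiv ℝ (fun y => (f y : ℂ)) y 1
        - Complex.I * fderiv ℝ (fun y => (f y : ℂ)) y Complex.I) := by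
      ext y; simp only [hp, dz]; ring
    rw [h4]
    exact h3.const_mul _
  have dpc : DifferentiableAt ℝ (fun y => conj (p y)) w := differentiableAt_conj dp
  have dA : DifferentiableAt ℝ (isoNorm j g) w :=
    (h.contDiffOn_isoNorm j).differentiableAt_of_isOpen h.isOpen hw
  set r : ℂ → ℝ := fun y => (2 * isoNorm j g y)⁻¹ with hr
  have dr : DifferentiableAt ℝ r w := (dA.const_mul 2).inv (by positivity)
  have drC : DifferentiableAt ℝ (fun y => (r y : ℂ)) w := differentiableAt_ofReal dr
  have hrz : dz (fun y => (r y : ℂ)) w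
      = -(2 * (r w : ℂ) ^ 2) * dz (fun y => (isoNorm j g y : ℂ)) w := by
    have h1 : HasDerivAt (fun x : ℝ => (2 * x)⁻¹) (-(2 * r w ^ 2)) (isoNorm j g w) := by
      have h2 := ((hasDerivAt_id (isoNorm j g w)).const_mul 2).inv
        (by simpa using hAw.ne')
      refine h2.congr_deriv ?_
      simp only [hr, id]
      field_simp
    have h3 := dz_ofReal_comp dA h1
    rw [h3]
    push_cast
    ring
  set f2 : ℂ → ℝ := fun y => 1 + ‖p y‖ ^ 2 / (2 * isoNorm j g y) with hf2
  have hf2C : (fun y => (f2 y : ℂ)) = fun y => 1 + p y * conj (p y) * (r y : ℂ) := by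
    ext y
    simp only [hf2, hr, Complex.mul_conj']
    push_cast
    ring
  have hf2pos : 0 < f2 w := by simp only [hf2]; positivity
  have df2C : DifferentiableAt ℝ (fun y => (f2 y : ℂ)) w := by
    rw [hf2C]
    exact ((dp.fun_mul dpc).fun_mul drC).const_add 1
  have df2 : DifferentiableAt ℝ f2 w := by
    have := Complex.reCLM.differentiableAt.comp w df2C
    exact this
  set s : ℝ := Real.sqrt (f2 w) with hs
  have hspos : 0 < s := Real.sqrt_pos.2 hf2pos
  have hs' := Complex.ofReal_ne_zero.2 hspos.ne'
  have dsq : DifferentiableAt ℝ (fun y => (Real.sqrt (f2 y) : ℂ)) w :=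
    differentiableAt_ofReal (df2.sqrt hf2pos.ne')
  have hpcz : dz (fun y => conj (p y)) w = 2 * isoNorm j g w * s := by
    rw [dz_conj, hzzbar]
    simp only [Complex.conj_ofReal]
    push_cast
    rfl
  -- Derivative of `s² = 1 + p p̄ / (2A)`: the logarithmic derivative of `A` occurs in `p_z` and,
  -- with opposite sign, in the derivative of `1/(2A)`, and drops out.
  have hf2z : dz (fun y => (f2 y : ℂ)) w = s * (2 * isoNorm j g w * p w
      - lorentz3 (vdz (fun y => ofRealVec (g y)) w) (vdz (fun y => ofRealVec (g y)) w)
        * conj (p w)) * r w := by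
    rw [hf2C, dz_add (differentiableAt_const _) ((dp.fun_mul dpc).fun_mul drC), dz_const,
      dz_mul (dp.fun_mul dpc) drC, dz_mul dp dpc, hpcz, hzz, hrz]
    simp only [hr]
    push_cast
    field_simp
    ring
  have hsz : dz (fun y => (Real.sqrt (f2 y) : ℂ)) w = (2 * isoNorm j g w * p w
      - lorentz3 (vdz (fun y => ofRealVec (g y)) w) (vdz (fun y => ofRealVec (g y)) w)
        * conj (p w)) * r w / 2 := by
    rw [dz_ofReal_comp df2 (Real.hasDerivAt_sqrt hf2pos.ne'), hf2z, ← hs]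
    push_cast
    field_simp
  have hexp : ∀ i, (fun y => ofRealVec (recon j g (p y) y) i) = fun y =>
      (Real.sqrt (f2 y) : ℂ) * ofRealVec (g y) i + conj (p y) * (r y : ℂ) * isoPart j g y i
        + p y * (r y : ℂ) * conjVec (isoPart j g y) i := by
    intro i
    ext y
    rw [ofRealVec_recon]
    simp only [Pi.add_apply, Pi.smul_apply, smul_eq_mul, hr, hf2]
    push_cast
    ring
  have dg := fun i => h.diff_ofRealVec hw i
  have dP := fun i => h.diff_isoPart hw j i
  have dPc := fun i => h.diff_conj_isoPart hw j i
  have dt1 : ∀ i, DifferentiableAt ℝ (fun y => (Real.sqrt (f2 y) : ℂ) * ofRealVec (g y) i) w :=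
    fun i => dsq.fun_mul (dg i)
  have dt2 : ∀ i, DifferentiableAt ℝ (fun y => conj (p y) * (r y : ℂ) * isoPart j g y i) w :=
    fun i => (dpc.fun_mul drC).fun_mul (dP i)
  have dt3 : ∀ i, DifferentiableAt ℝ (fun y => p y * (r y : ℂ) * conjVec (isoPart j g y) i) w :=
    fun i => (dp.fun_mul drC).fun_mul (dPc i)
  have dN : ∀ i, DifferentiableAt ℝ (fun y => recon j g (p y) y i) w := fun i => by
    have h1 : DifferentiableAt ℝ (fun y => ofRealVec (recon j g (p y) y) i) w := by
      rw [hexp i]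
      exact ((dt1 i).fun_add (dt2 i)).fun_add (dt3 i)
    exact Complex.reCLM.differentiableAt.comp w h1
  have hψ : DifferentiableAt ℝ (fun y => (recon j g (p y) y, f y)) w :=
    (differentiableAt_pi.2 dN).prodMk hfd
  refine hasFDerivAt_theta_of_vdz hψ ?_ ?_
  · ext i
    have hX := congrFun (isoPart_add_isoPart_neg j g w) i
    have e1 : dz (fun y => ofRealVec (g y) i) w
        = isoPart j g w i + lorentz3 (vdz (fun y => ofRealVec (g y)) w)
          (vdz (fun y => ofRealVec (g y)) w) / (2 * isoNorm j g w) * conj (isoPart j g w i) := by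
      have h1 := congrFun (h.isoPart_neg hj hjc hw hAw.ne') i
      simp only [Pi.add_apply, Pi.smul_apply, smul_eq_mul, conjVec_apply] at hX h1
      rw [h1] at hX
      exact hX.symm
    have e2 := congrFun (h.vdz_isoPart hj hjc hw hAw.ne') i
    have e3 := congrFun (h.vdz_conj_isoPart hj hjc hw) i
    simp only [vdz, Pi.add_apply, Pi.smul_apply, smul_eq_mul] at e2 e3
    simp only [vdz]
    rw [hexp i, dz_add ((dt1 i).fun_add (dt2 i)) (dt3 i), dz_add (dt1 i) (dt2 i),
      dz_mul dsq (dg i), dz_mul (dpc.fun_mul drC) (dP i), dz_mul dpc drC,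
      dz_mul (dp.fun_mul drC) (dPc i), dz_mul dp drC, e1, e2, e3, hpcz, hzz, hrz, hsz, wedgeVec,
      h.lorentz3_recon_isoPart hj hw hAw.ne', h.lorentz3_recon_ofRealVec hw]
    have e4 : Real.sqrt (1 + ‖p w‖ ^ 2 / (2 * isoNorm j g w)) = s := rfl
    rw [e4]
    simp only [Pi.sub_apply, Pi.smul_apply, smul_eq_mul, hr, conjVec_apply]
    push_cast
    field_simp
    ring
  -- The height equation holds by construction: `recon` was built with `⟨N, P⟩ = p/2`. The two
  -- equations for `h` were needed only for `N_z`.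
  · show p w = 2 * lorentz3 (ofRealVec (recon j g (p w) w)) (isoPart j g w)
    rw [h.lorentz3_recon_isoPart hj hw hAw.ne']
    ring

/-- The explicit formula for the vertical projection. -/
theorem recon_eq_quotient (h : IsLocalHarmonic Ω g) (hj : j ^ 2 = -1) (hjc : conj j = -j)
    (hw : w ∈ Ω) (hA : 0 < isoNorm j g w) (p : ℂ) {Q : ℂ}
    (hQ : lorentz3 (vdz (fun y => ofRealVec (g y)) w) (vdz (fun y => ofRealVec (g y)) w) = -Q)
    (hne : 16 * isoNorm j g w ^ 2 - 4 * ‖Q‖ ^ 2 ≠ 0) (i : Fin 3) :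
    recon j g p w i = 4 * (vdz (fun y => ofRealVec (g y)) w i * (2 * conj Q * p
        + ((4 * isoNorm j g w : ℝ) : ℂ) * conj p)).re / (16 * isoNorm j g w ^ 2 - 4 * ‖Q‖ ^ 2)
      + g w i * Real.sqrt (1 + ‖p‖ ^ 2 / (2 * isoNorm j g w)) := by
  have hA' := Complex.ofReal_ne_zero.2 hA.ne'
  have hX := congrFun (isoPart_add_isoPart_neg j g w) i
  have h1 := congrFun (h.isoPart_neg hj hjc hw hA.ne') i
  simp only [Pi.add_apply, Pi.smul_apply, smul_eq_mul, conjVec_apply] at hX h1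
  rw [h1, hQ] at hX
  set P := isoPart j g w i with hP
  -- Insert `g_z = P - Q/(2A) P̄`. The bracket on the last line is a number minus its conjugate, so
  -- it has no real part; the real part of the others is `(4A - |Q|²/A) Re(p̄ P)`. The denominator
  -- `16A² - 4|Q|²` is `4A` times that factor.
  have e1 : vdz (fun y => ofRealVec (g y)) w i * (2 * conj Q * p
        + ((4 * isoNorm j g w : ℝ) : ℂ) * conj p)
      = ((4 * isoNorm j g w : ℝ) : ℂ) * (conj p * P)
        - ((‖Q‖ ^ 2 / isoNorm j g w : ℝ) : ℂ) * conj (conj p * P)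
        + (2 * conj Q * p * P - conj (2 * conj Q * p * P)) := by
    rw [← hX]
    have e2 : ((‖Q‖ ^ 2 / isoNorm j g w : ℝ) : ℂ) = Q * conj Q / isoNorm j g w := by
      rw [Complex.mul_conj']; push_cast; rfl
    rw [e2]
    simp only [map_mul, Complex.conj_conj, map_ofNat]
    push_cast
    field_simp
    ring
  have e2 : (vdz (fun y => ofRealVec (g y)) w i * (2 * conj Q * p
        + ((4 * isoNorm j g w : ℝ) : ℂ) * conj p)).re
      = (4 * isoNorm j g w - ‖Q‖ ^ 2 / isoNorm j g w) * (conj p * P).re := by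
    rw [e1, Complex.add_re, Complex.sub_re, Complex.sub_re, Complex.conj_re, Complex.re_ofReal_mul,
      Complex.re_ofReal_mul, Complex.conj_re]
    ring
  rw [e2, recon, ← hP]
  have e3 : 4 * ((4 * isoNorm j g w - ‖Q‖ ^ 2 / isoNorm j g w) * (conj p * P).re)
      / (16 * isoNorm j g w ^ 2 - 4 * ‖Q‖ ^ 2) = (conj p * P).re / isoNorm j g w := by
    rw [div_eq_div_iff hne hA.ne']
    field_simp
    ring
  rw [e3]
  ring

end IsLocalHarmonic

end Reconstruction

/-! ### Prescribed surfaces solve the linear system -/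

section PrescribedSurface

open ComplexConjugate

theorem eq_zero_of_two_re_mul {m : ℂ} (h : ∀ v : ℂ, 2 * (m * v).re = 0) : m = 0 := by
  have h1 := h 1
  have h2 := h Complex.I
  simp at h1 h2
  exact Complex.ext h1 h2

theorem im_dzbar_dz_ofReal {f : ℂ → ℝ} {w : ℂ} (hf : ContDiffAt ℝ 2 f w) :
    conj (dzbar (dz fun y => (f y : ℂ)) w) = dzbar (dz fun y => (f y : ℂ)) w := by
  have hfC : ContDiffAt ℝ 2 (fun y => (f y : ℂ)) w :=
    Complex.ofRealCLM.contDiff.contDiffAt.comp w hf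
  rw [← dz_conj]
  have e : (fun y => conj (dz (fun y => (f y : ℂ)) y)) = dzbar fun y => (f y : ℂ) := by
    ext y; rw [dzbar_ofReal]
  rw [e, dz_dzbar_comm hfC]

/-- A conformal surface of mean curvature one half with hyperbolic Gauss map `g` and
`4 isoNorm j g = λ u² / 2`, on a domain of `ℂ`. -/
structure IsLocalPrescribed (j : ℂ) (Ω : Set ℂ) (g : ℂ → Fin 3 → ℝ) (ψ : ℂ → Mink4) : Prop where
  isLocalHarmonic : IsLocalHarmonic Ω g
  sq_eq : j ^ 2 = -1
  conj_eq : conj j = -j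
  isoNorm_pos : ∀ w ∈ Ω, 0 < isoNorm j g w
  smooth : ContDiffOn ℝ ∞ ψ Ω
  mem_hypPlane : ∀ w ∈ Ω, (ψ w).1 ∈ hypPlane
  gauss_mem_hypPlane : ∀ w ∈ Ω, g w ∈ hypPlane
  conformal : ∀ w ∈ Ω, ∀ v, lorentz4 (fderiv ℝ ψ w v) (fderiv ℝ ψ w v)
    = 8 * isoNorm j g w * invAngle g ψ w ^ 2 * ‖v‖ ^ 2
  orth : ∀ w ∈ Ω, ∀ v, lorentz4 (gaussNormal g ψ w) (fderiv ℝ ψ w v) = 0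
  mean : ∀ w ∈ Ω, (pairDzbar ψ (gaussNormal g ψ) w).re = -(2 * isoNorm j g w * invAngle g ψ w ^ 2)

namespace IsLocalPrescribed

variable {j : ℂ} {Ω : Set ℂ} {g : ℂ → Fin 3 → ℝ} {ψ : ℂ → Mink4} {w : ℂ}

theorem contDiffOn_fst (h : IsLocalPrescribed j Ω g ψ) (i : Fin 3) :
    ContDiffOn ℝ ∞ (fun w => (ψ w).1 i) Ω := contDiffOn_pi.1 h.smooth.fst i

theorem contDiffOn_vdz (h : IsLocalPrescribed j Ω g ψ) (i : Fin 3) :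
    ContDiffOn ℝ ∞ (fun w => vdz (fun y => ofRealVec (ψ y).1) w i) Ω :=
  (h.contDiffOn_fst i).ofReal.dz h.isLocalHarmonic.isOpen

theorem contDiffOn_dz (h : IsLocalPrescribed j Ω g ψ) :
    ContDiffOn ℝ ∞ (dz fun y => ((ψ y).2 : ℂ)) Ω :=
  h.smooth.snd.ofReal.dz h.isLocalHarmonic.isOpen

theorem differentiableAt (h : IsLocalPrescribed j Ω g ψ) (hw : w ∈ Ω) :
    DifferentiableAt ℝ ψ w := h.smooth.differentiableAt_of_isOpen h.isLocalHarmonic.isOpen hw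

theorem diff_fst (h : IsLocalPrescribed j Ω g ψ) (hw : w ∈ Ω) (i : Fin 3) :
    DifferentiableAt ℝ (fun y => ofRealVec (ψ y).1 i) w :=
  differentiableAt_ofReal ((h.contDiffOn_fst i).differentiableAt_of_isOpen
    h.isLocalHarmonic.isOpen hw)

theorem invAngle_pos (h : IsLocalPrescribed j Ω g ψ) (hw : w ∈ Ω) : 0 < invAngle g ψ w :=
  one_pos.trans_le (one_le_neg_lorentz3 (h.mem_hypPlane w hw) (h.gauss_mem_hypPlane w hw))

theorem lorentz3_fst_vdz (h : IsLocalPrescribed j Ω g ψ) (hw : w ∈ Ω) :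
    lorentz3 (ofRealVec (ψ w).1) (vdz (fun y => ofRealVec (ψ y).1) w) = 0 := by
  have h1 : dz (fun y => lorentz3 (ofRealVec (ψ y).1) (ofRealVec (ψ y).1)) w = 0 := by
    rw [dz_congr (g := fun _ => -1) ?_, dz_const]
    filter_upwards [h.isLocalHarmonic.isOpen.mem_nhds hw] with y hy
    rw [lorentz3_ofRealVec, (h.mem_hypPlane y hy).1]
    simp
  rw [dz_lorentz3 (h.diff_fst hw) (h.diff_fst hw), lorentz3_comm] at h1
  linear_combination h1 / 2

theorem lorentz3_vdz_gauss (h : IsLocalPrescribed j Ω g ψ) (hw : w ∈ Ω) :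
    lorentz3 (vdz (fun y => ofRealVec (ψ y).1) w) (ofRealVec (g w))
      = -dz (fun y => ((ψ y).2 : ℂ)) w := by
  have h3 := Complex.ofReal_ne_zero.2 (h.invAngle_pos hw).ne'
  have h0 : lorentz3 (ofRealVec (gaussNormal g ψ w).1) (vdz (fun y => ofRealVec (ψ y).1) w)
      + (((invAngle g ψ w)⁻¹ : ℝ) : ℂ) * dz (fun y => ((ψ y).2 : ℂ)) w = 0 := by
    refine eq_zero_of_two_re_mul fun v => ?_
    have h1 := h.orth w hw v
    rw [lorentz4, fderiv_apply_fst (h.differentiableAt hw),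
      fderiv_apply_snd (h.differentiableAt hw)] at h1
    rw [← h1]
    simp [lorentz3, gaussNormal]
    ring
  rw [ofRealVec_gaussNormal, lorentz3_sub_left, lorentz3_smul_left, h.lorentz3_fst_vdz hw,
    lorentz3_comm] at h0
  push_cast at h0
  field_simp at h0
  linear_combination h0

theorem pairDz_self (h : IsLocalPrescribed j Ω g ψ) (hw : w ∈ Ω) :
    pairDz ψ ψ w = 0 ∧ pairDzbar ψ ψ w = (4 * isoNorm j g w * invAngle g ψ w ^ 2 : ℝ) := by
  have h1 := pairDz_eq_zero_of_conformal (h.differentiableAt hw) (h.conformal w hw)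
  refine ⟨h1.1, h1.2.trans ?_⟩
  congr 1
  ring

/-- Differentiating `⟨N_z, g⟩ = -h_z` expresses this product by `h_{zz̄}` and `N_{zz̄}`, which are
real. This is needed because the mean curvature only controls a real part. -/
theorem conj_lorentz3_vdz_gauss (h : IsLocalPrescribed j Ω g ψ) (hw : w ∈ Ω) :
    conj (lorentz3 (vdz (fun y => ofRealVec (ψ y).1) w)
        (conjVec (vdz (fun y => ofRealVec (g y)) w)))
      = lorentz3 (vdz (fun y => ofRealVec (ψ y).1) w)
        (conjVec (vdz (fun y => ofRealVec (g y)) w)) := by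
  have hΩ := h.isLocalHarmonic.isOpen
  have e : (fun y => lorentz3 (vdz (fun y => ofRealVec (ψ y).1) y) (ofRealVec (g y)))
      =ᶠ[𝓝 w] fun y => -dz (fun y => ((ψ y).2 : ℂ)) y := by
    filter_upwards [hΩ.mem_nhds hw] with y hy
    exact h.lorentz3_vdz_gauss hy
  have h1 := dzbar_congr e
  rw [dzbar_neg, dzbar_lorentz3
    (fun i => (h.contDiffOn_vdz i).differentiableAt_of_isOpen hΩ hw)
    (h.isLocalHarmonic.diff_ofRealVec hw), vdzbar_ofRealVec] at h1
  have h2 : lorentz3 (vdz (fun y => ofRealVec (ψ y).1) w)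
        (conjVec (vdz (fun y => ofRealVec (g y)) w))
      = -dzbar (dz fun y => ((ψ y).2 : ℂ)) w
        - lorentz3 (vdzbar (vdz fun y => ofRealVec (ψ y).1) w) (ofRealVec (g w)) := by
    linear_combination h1
  have h3 : conj (dzbar (dz fun y => ((ψ y).2 : ℂ)) w) = dzbar (dz fun y => ((ψ y).2 : ℂ)) w :=
    im_dzbar_dz_ofReal ((h.smooth.snd.contDiffAt (hΩ.mem_nhds hw)).of_le ENat.LEInfty.out)
  have h4 : conjVec (vdzbar (vdz fun y => ofRealVec (ψ y).1) w)
      = vdzbar (vdz fun y => ofRealVec (ψ y).1) w := by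
    ext i
    exact im_dzbar_dz_ofReal
      (((h.contDiffOn_fst i).contDiffAt (hΩ.mem_nhds hw)).of_le ENat.LEInfty.out)
  rw [h2, map_sub, map_neg, h3, ← lorentz3_conjVec, h4, conjVec_ofRealVec]

/-- The mean curvature condition, written with `η = (1/s)(g, 1) - (N, 0)` and solved for `⟨N_z,
g_z̄⟩`. -/
theorem lorentz3_vdz_gauss_add (h : IsLocalPrescribed j Ω g ψ) (hw : w ∈ Ω) :
    lorentz3 (vdz (fun y => ofRealVec (ψ y).1) w) (conjVec (vdz (fun y => ofRealVec (g y)) w))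
      = (invAngle g ψ w * (2 * isoNorm j g w * invAngle g ψ w ^ 2
        - ‖dz (fun y => ((ψ y).2 : ℂ)) w‖ ^ 2) : ℝ) := by
  have hΩ := h.isLocalHarmonic.isOpen
  have hs := (h.invAngle_pos hw).ne'
  have h1 := pairDzbar_gaussNormal_of_orthogonal
    (fun i => (h.contDiffOn_fst i).differentiableAt_of_isOpen hΩ hw)
    (fun i => (h.isLocalHarmonic.smooth i).differentiableAt_of_isOpen hΩ hw) hs
    (h.lorentz3_vdz_gauss hw)
  have h2 := (h.pairDz_self hw).2
  rw [pairDzbar, Complex.mul_conj'] at h2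
  have h3 := h.mean w hw
  have h4 := Complex.conj_eq_iff_re.1 (h.conj_lorentz3_vdz_gauss hw)
  set X := lorentz3 (vdz (fun y => ofRealVec (ψ y).1) w)
    (conjVec (vdz (fun y => ofRealVec (g y)) w))
  set Y := lorentz3 (vdz (fun y => ofRealVec (ψ y).1) w)
    (conjVec (vdz (fun y => ofRealVec (ψ y).1) w))
  have h5 : Y = ((4 * isoNorm j g w * invAngle g ψ w ^ 2
      - ‖dz (fun y => ((ψ y).2 : ℂ)) w‖ ^ 2 : ℝ) : ℂ) := by
    push_cast at h2 ⊢
    linear_combination h2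
  rw [h1, h5, ← h4, ← Complex.ofReal_inv, ← Complex.ofReal_mul, ← Complex.ofReal_sub,
    Complex.ofReal_re] at h3
  rw [← h4]
  congr 1
  field_simp at h3
  linear_combination h3

/-- Away from the points where the two isotropic parts of `g_z` have the same length, the surface
solves the linear system. -/
theorem vdz_fst_of_ne (h : IsLocalPrescribed j Ω g ψ) (hw : w ∈ Ω)
    (hne : ‖lorentz3 (vdz (fun y => ofRealVec (g y)) w) (vdz (fun y => ofRealVec (g y)) w)‖
      ≠ 2 * isoNorm j g w) :
    vdz (fun y => ofRealVec (ψ y).1) w = dz (fun y => ((ψ y).2 : ℂ)) w • ofRealVec (g w)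
      + (2 * invAngle g ψ w : ℂ) • isoPart j g w := by
  have hH := h.isLocalHarmonic
  have hAp := h.isoNorm_pos w hw
  have hsp := h.invAngle_pos hw
  have hA := Complex.ofReal_ne_zero.2 hAp.ne'
  have hs := Complex.ofReal_ne_zero.2 hsp.ne'
  have hPP := hH.lorentz3_isoPart_self h.sq_eq hw
  have hPPc := hH.lorentz3_conj_isoPart_self h.sq_eq hw
  have hAP := (ofReal_isoNorm j g w).symm
  have hPg := hH.lorentz3_isoPart_ofRealVec hw j
  have hPcg := hH.lorentz3_conj_isoPart_ofRealVec hw j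
  have hgg := hH.lorentz3_ofRealVec_self hw
  have hNg := h.lorentz3_vdz_gauss hw
  have hNN := h.lorentz3_fst_vdz hw
  obtain ⟨hc1, hc2⟩ := h.pairDz_self hw
  have hX := h.lorentz3_vdz_gauss_add hw
  have hGz : conjVec (vdz (fun y => ofRealVec (g y)) w)
      = conjVec (isoPart j g w) + conjVec (isoPart (-j) g w) := by
    rw [← isoPart_add_isoPart_neg j g w]; ext i; simp
  have hPP' : lorentz3 (conjVec (isoPart j g w)) (conjVec (isoPart (-j) g w))
      = conj (lorentz3 (vdz (fun y => ofRealVec (g y)) w)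
        (vdz (fun y => ofRealVec (g y)) w)) / 2 := by
    rw [lorentz3_conjVec, hH.lorentz3_isoPart_neg h.sq_eq hw, map_div₀, map_ofNat]
  have hPcP' := hH.lorentz3_isoPart_conj_neg h.sq_eq h.conj_eq hw
  have hgP' : lorentz3 (ofRealVec (g w)) (conjVec (vdz (fun y => ofRealVec (g y)) w)) = 0 :=
    hH.lorentz3_conj_vdz hw
  have hNNr : lorentz3 (ofRealVec (ψ w).1) (ofRealVec (ψ w).1) = -1 := by
    rw [lorentz3_ofRealVec, (h.mem_hypPlane w hw).1]; simp
  have hNG := lorentz3_gauss g ψ w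
  set q := lorentz3 (vdz (fun y => ofRealVec (g y)) w) (vdz (fun y => ofRealVec (g y)) w) with hq
  set P := isoPart j g w with hP
  set Gc := ofRealVec (g w) with hGc
  set X := vdz (fun y => ofRealVec (ψ y).1) w with hXdef
  set p := dz (fun y => ((ψ y).2 : ℂ)) w with hp
  set s := invAngle g ψ w with hsdef
  set A := isoNorm j g w with hAdef
  set a := lorentz3 X (conjVec P) / A with ha
  set b := lorentz3 X P / A with hb
  have hexp : X = a • P + b • conjVec P + p • Gc := by
    ext i
    rw [frame_expand hA hPP hPPc hAP hPg hPcg hgg X i, hNg]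
    simp only [Pi.add_apply, Pi.smul_apply, smul_eq_mul]
    ring
  have hXP : lorentz3 X P = b * A := by rw [hb]; field_simp
  have hXPc : lorentz3 X (conjVec P) = a * A := by rw [ha]; field_simp
  clear_value a b
  -- Conformality `⟨ψ_z, ψ_z⟩ = 0`: the term from `g` cancels `h_z²`, and `2Aab` is left. The value
  -- of `⟨ψ_z, ψ_z̄⟩` then gives `|a|² + |b|² = 4s²`.
  have hab : a * b = 0 := by
    have h1 : lorentz3 X X = a * (b * A) + b * (a * A) - p * p := by
      refine (congrArg (lorentz3 X) hexp).trans ?_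
      rw [lorentz3_add_right, lorentz3_add_right, lorentz3_smul_right, lorentz3_smul_right,
        lorentz3_smul_right, hXP, hXPc, hNg]
      ring
    rw [pairDz, ← hXdef, ← hp, h1] at hc1
    have h2 : 2 * A * (a * b) = 0 := by linear_combination hc1
    simpa [hA] using h2
  have hnorm : ‖a‖ ^ 2 + ‖b‖ ^ 2 = 4 * s ^ 2 := by
    have hXc : conjVec X = conj a • conjVec P + conj b • P + conj p • Gc := by
      rw [hexp]; ext i; simp [hGc]
    have h1 : lorentz3 X (conjVec X) = conj a * (a * A) + conj b * (b * A) - p * conj p := by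
      rw [hXc, lorentz3_add_right, lorentz3_add_right, lorentz3_smul_right, lorentz3_smul_right,
        lorentz3_smul_right, hXP, hXPc, hNg]
      ring
    rw [pairDzbar, ← hXdef, ← hp, h1] at hc2
    have h2 : (A : ℂ) * (a * conj a + b * conj b) = A * (4 * s ^ 2) := by
      push_cast at hc2
      linear_combination hc2
    have h3 := mul_left_cancel₀ hA h2
    rw [Complex.mul_conj', Complex.mul_conj'] at h3
    exact_mod_cast h3
  set n := lorentz3 (ofRealVec (ψ w).1) P with hn
  have hnc : lorentz3 (ofRealVec (ψ w).1) (conjVec P) = conj n := lorentz3_ofRealVec_conjVec _ _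
  have hanb : a * n + b * conj n = p * s := by
    have h1 := hNN
    rw [hexp, lorentz3_add_right, lorentz3_add_right, lorentz3_smul_right, lorentz3_smul_right,
      lorentz3_smul_right, hnc, hNG, ← hn] at h1
    linear_combination h1
  have hsn : (s : ℂ) ^ 2 = 1 + 2 * (n * conj n) / A := by
    have h1 : ofRealVec (ψ w).1 = (conj n / A) • P + (n / A) • conjVec P + (s : ℂ) • Gc := by
      ext i
      rw [frame_expand hA hPP hPPc hAP hPg hPcg hgg (ofRealVec (ψ w).1) i, hNG, hnc]
      simp only [Pi.add_apply, Pi.smul_apply, smul_eq_mul]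
      ring
    have h2 := congrArg (lorentz3 (ofRealVec (ψ w).1)) h1
    rw [lorentz3_add_right, lorentz3_add_right, lorentz3_smul_right, lorentz3_smul_right,
      lorentz3_smul_right, hnc, hNG, ← hn, hNNr] at h2
    linear_combination h2
  have hsn' : s ^ 2 = 1 + 2 * ‖n‖ ^ 2 / A := by
    rw [Complex.mul_conj'] at hsn
    exact_mod_cast hsn
  -- One coefficient is zero and the other has modulus `2s`, so in either case `⟨N, N_z⟩ = 0` fixes
  -- the modulus of `n = ⟨N, P⟩`.
  have hnp : ‖n‖ ^ 2 = ‖p‖ ^ 2 / 4 := by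
    have key : ∀ c m : ℂ, ‖c‖ ^ 2 = 4 * s ^ 2 → ‖m‖ = ‖n‖ → c * m = p * s →
        ‖n‖ ^ 2 = ‖p‖ ^ 2 / 4 := by
      intro c m h1 h2 h3
      have h4 := congrArg (fun z : ℂ => ‖z‖ ^ 2) h3
      simp only [norm_mul, mul_pow, h1, h2, Complex.norm_real, Real.norm_eq_abs, sq_abs] at h4
      have h5 : s ^ 2 * (‖n‖ ^ 2 - ‖p‖ ^ 2 / 4) = 0 := by linear_combination h4 / 4
      have h6 := (mul_eq_zero.1 h5).resolve_left (by positivity)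
      linarith
    rcases mul_eq_zero.1 hab with h0 | h0
    · rw [h0] at hnorm hanb
      exact key b (conj n) (by simpa using hnorm) (Complex.norm_conj n) (by simpa using hanb)
    · rw [h0] at hnorm hanb
      exact key a n (by simpa using hnorm) rfl (by simpa using hanb)
  have hX2 : a * A + b * (conj q / 2) = ((2 * A * s : ℝ) : ℂ) := by
    have h1 : lorentz3 X (conjVec (vdz (fun y => ofRealVec (g y)) w))
        = a * A + b * (conj q / 2) := by
      rw [hexp, lorentz3_add_left, lorentz3_add_left, lorentz3_smul_left, lorentz3_smul_left,
        lorentz3_smul_left, hgP', hGz, lorentz3_add_right, lorentz3_add_right, hAP, hPcP', hPPc,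
        hPP']
      ring
    rw [← h1, hX]
    congr 1
    have h2 : ‖p‖ ^ 2 = 2 * A * (s ^ 2 - 1) := by
      rw [hsn', hnp]
      field_simp
      ring
    rw [h2]
    ring
  -- If `a = 0`, then `|b| = 2s` and the mean curvature equation forces `|q| = 2A`, which is
  -- excluded. If `b = 0`, it forces `a = 2s`.
  rcases mul_eq_zero.1 hab with h0 | h0
  · exfalso
    apply hne
    rw [h0] at hnorm hX2
    have h1 : ‖b‖ = 2 * s := by
      have : ‖b‖ ^ 2 = (2 * s) ^ 2 := by simp at hnorm; linarith
      exact (pow_left_inj₀ (norm_nonneg _) (by positivity) (by norm_num)).1 this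
    have h2 := congrArg norm hX2
    rw [zero_mul, zero_add, norm_mul, norm_div, Complex.norm_conj, h1, Complex.norm_real,
      Real.norm_eq_abs, abs_of_pos (by positivity)] at h2
    simp at h2
    have h3 : s * (‖q‖ - 2 * A) = 0 := by linear_combination h2
    have := (mul_eq_zero.1 h3).resolve_left hsp.ne'
    linarith
  · rw [h0, zero_mul, add_zero] at hX2
    have h1 : a = 2 * s := by
      have : (A : ℂ) * (a - 2 * s) = 0 := by push_cast at hX2; linear_combination hX2
      exact sub_eq_zero.1 ((mul_eq_zero.1 this).resolve_left hA)
    rw [hexp, h0, h1]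
    ext i
    simp only [Pi.add_apply, Pi.smul_apply, smul_eq_mul]
    ring

/-- The formula for `N_z` extends by continuity from a dense set. Then `⟨N, N_z⟩ = 0` yields `h_z =
2⟨N, P⟩`, the other half of the system. -/
theorem isLocalSurface (h : IsLocalPrescribed j Ω g ψ)
    (hne : ∀ w ∈ Ω, ∃ᶠ y in 𝓝 w, ‖lorentz3 (vdz (fun y => ofRealVec (g y)) y)
      (vdz (fun y => ofRealVec (g y)) y)‖ ≠ 2 * isoNorm j g y) :
    IsLocalSurface j Ω g ψ where
  isLocalHarmonic := h.isLocalHarmonic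
  sq_eq := h.sq_eq
  conj_eq := h.conj_eq
  isoNorm_pos := h.isoNorm_pos
  mem_hypPlane := h.mem_hypPlane
  gauss_mem_hypPlane := h.gauss_mem_hypPlane
  hasFDerivAt w hw := by
    have hn := h.isLocalHarmonic.isOpen.mem_nhds hw
    have hs := Complex.ofReal_ne_zero.2 (h.invAngle_pos hw).ne'
    have h1 : vdz (fun y => ofRealVec (ψ y).1) w = dz (fun y => ((ψ y).2 : ℂ)) w • ofRealVec (g w)
        + (2 * invAngle g ψ w : ℂ) • isoPart j g w := by
      have hc1 : ContinuousAt (vdz fun y => ofRealVec (ψ y).1) w :=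
        continuousAt_pi.2 fun i => (h.contDiffOn_vdz i).continuousOn.continuousAt hn
      have hsc : ContDiffOn ℝ ∞ (invAngle g ψ) Ω :=
        (ContDiffOn.lorentz3_real h.contDiffOn_fst h.isLocalHarmonic.smooth).neg
      have hc2 : ContinuousAt (fun w => dz (fun y => ((ψ y).2 : ℂ)) w • ofRealVec (g w)
          + (2 * invAngle g ψ w : ℂ) • isoPart j g w) w :=
        continuousAt_pi.2 fun i => ((h.contDiffOn_dz.mul
          (h.isLocalHarmonic.contDiffOn_ofRealVec i)).add ((contDiffOn_const.mul hsc.ofReal).mul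
            (h.isLocalHarmonic.contDiffOn_isoPart j i))).continuousOn.continuousAt hn
      exact eq_of_frequently_eq hc1 hc2 (((hne w hw).and_eventually hn).mono fun y hy =>
        h.vdz_fst_of_ne hy.2 hy.1)
    have h2 : dz (fun y => ((ψ y).2 : ℂ)) w
        = 2 * lorentz3 (ofRealVec (ψ w).1) (isoPart j g w) := by
      have h3 := h.lorentz3_fst_vdz hw
      rw [h1, lorentz3_add_right, lorentz3_smul_right, lorentz3_smul_right, lorentz3_gauss] at h3
      have h4 : (invAngle g ψ w : ℂ) * (dz (fun y => ((ψ y).2 : ℂ)) w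
          - 2 * lorentz3 (ofRealVec (ψ w).1) (isoPart j g w)) = 0 := by linear_combination -h3
      exact sub_eq_zero.1 ((mul_eq_zero.1 h4).resolve_left hs)
    refine hasFDerivAt_theta_of_vdz (h.differentiableAt hw) ?_ h2
    rw [h1, wedgeVec, ← h2, lorentz3_gauss]
    ext i
    simp

end IsLocalPrescribed

end PrescribedSurface

/-! ### From local to global surfaces and the height system -/

section GlobalSurface

open ComplexConjugate

variable {S : Type*} [TopologicalSpace S] [ChartedSpace ℂ S]
  [IsManifold (modelWithCornersSelf ℂ ℂ) ω S] {G : S → Fin 3 → ℝ}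
  {Q : OpenPartialHomeomorph S ℂ → ℂ → ℂ} {τ : OpenPartialHomeomorph S ℂ → ℂ → ℝ}
  {j : ℂ} {ψ : S → Mink4} {e : OpenPartialHomeomorph S ℂ}

omit [IsManifold (modelWithCornersSelf ℂ ℂ) ω S] in
theorem SolvesLinearAt.hasFDerivAt (hψ : ∀ x, SolvesLinearAt j G x ψ)
    (he : e ∈ conformalParams S) {w : ℂ} (hw : w ∈ e.target) :
    HasFDerivAt (readParam e ψ) ((theta j (readParam e G) w).flip (readParam e ψ w)) w := by
  have := hψ (e.symm w) e he (e.map_target hw)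
  rwa [e.right_inv hw] at this

omit [IsManifold (modelWithCornersSelf ℂ ℂ) ω S] in
theorem solvesLinearAt_of_forall (h : ∀ e ∈ conformalParams S, ∀ w ∈ e.target,
    HasFDerivAt (readParam e ψ) ((theta j (readParam e G) w).flip (readParam e ψ w)) w) (x : S) :
    SolvesLinearAt j G x ψ := by
  intro e he hx
  have := h e he (e x) (e.map_source hx)
  rwa [readParam_apply ψ hx] at this

omit [IsManifold (modelWithCornersSelf ℂ ℂ) ω S] in
theorem SolvesLinearAt.translate {x : S} (hψ : SolvesLinearAt j G x ψ) (c : ℝ) :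
    SolvesLinearAt j G x fun x => ((ψ x).1, (ψ x).2 + c) := by
  intro e he hx
  have h1 := (hψ e he hx).add_const ((0, c) : Mink4)
  have h2 : readParam e (fun x => ((ψ x).1, (ψ x).2 + c))
      = fun w => readParam e ψ w + ((0, c) : Mink4) := by
    ext w <;> simp [readParam]
  rw [h2]
  refine h1.congr_fderiv (ContinuousLinearMap.ext fun v => ?_)
  simp [theta_apply]

/-- The connection depends only on the component in `𝕃³`, so vertical translates of solutions are
solutions, and a suitable one matches `φ` at `x₀`. -/
theorem exists_translate_of_solvesLinear [PreconnectedSpace S] (hG : IsHarmonicMap G)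
    (hj : j ^ 2 = -1) (hjc : conj j = -j)
    (hA : ∀ e ∈ conformalParams S, ∀ w ∈ e.target, isoNorm j (readParam e G) w ≠ 0)
    {φ : S → Mink4} (hψ : ∀ x, SolvesLinearAt j G x ψ) (hφ : ∀ x, SolvesLinearAt j G x φ)
    {x₀ : S} (h : (φ x₀).1 = (ψ x₀).1) : ∃ c : ℝ, ∀ x, φ x = ((ψ x).1, (ψ x).2 + c) := by
  refine ⟨(φ x₀).2 - (ψ x₀).2, fun x => ?_⟩
  refine congrFun (eq_of_solvesLinear hG hj hjc hA hφ
    (fun x => (hψ x).translate ((φ x₀).2 - (ψ x₀).2)) (x₀ := x₀) ?_) x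
  exact Prod.ext h (by simp)

theorem continuous_of_solvesLinear (hψ : ∀ x, SolvesLinearAt j G x ψ) : Continuous ψ := by
  refine continuous_iff_continuousAt.2 fun x => ?_
  have hx := mem_chart_source ℂ x
  have h1 : ContinuousAt (readParam (chartAt ℂ x) ψ ∘ chartAt ℂ x) x :=
    ContinuousAt.comp (hψ x _ (chartAt_mem_conformalParams x) hx).continuousAt
      ((chartAt ℂ x).continuousAt hx)
  refine h1.congr ?_
  filter_upwards [(chartAt ℂ x).open_source.mem_nhds hx] with y hy
  exact readParam_apply ψ hy

/-- The connection takes values in the Lorentz-skew endomorphisms of `𝕃³`, so the derivative of `⟨N,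
N⟩` is zero. -/
theorem lorentz3_self_of_solvesLinear [PreconnectedSpace S]
    (hψ : ∀ x, SolvesLinearAt j G x ψ) (x y : S) :
    lorentz3 (ψ x).1 (ψ x).1 = lorentz3 (ψ y).1 (ψ y).1 := by
  have hloc : IsLocallyConstant fun x => lorentz3 (ψ x).1 (ψ x).1 := by
    rw [IsLocallyConstant.iff_eventually_eq]
    intro x
    set e := chartAt ℂ x
    have he : e ∈ conformalParams S := chartAt_mem_conformalParams x
    have hx : x ∈ e.source := mem_chart_source ℂ x
    obtain ⟨ρ, hρ, hball⟩ := Metric.mem_nhds_iff.1 (e.open_target.mem_nhds (e.map_source hx))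
    set f : ℂ → ℝ := fun w => lorentz3 (readParam e ψ w).1 (readParam e ψ w).1 with hf
    have hd : ∀ w ∈ Metric.ball (e x) ρ, HasFDerivAt f (0 : ℂ →L[ℝ] ℝ) w := by
      intro w hw
      have h1 := SolvesLinearAt.hasFDerivAt hψ he (hball hw)
      have h2 := hasFDerivAt_pi'.1 h1.fst
      have h3 := ((((h2 0).mul (h2 0)).neg.add ((h2 1).mul (h2 1))).add ((h2 2).mul (h2 2)))
      refine h3.congr_fderiv (ContinuousLinearMap.ext fun v => ?_)
      simp [theta_apply, lorentz3]
      ring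
    have hconst : ∀ w ∈ Metric.ball (e x) ρ, f w = f (e x) := fun w hw =>
      (convex_ball (e x) ρ).is_const_of_fderivWithin_eq_zero
        (fun w hw => (hd w hw).differentiableAt.differentiableWithinAt)
        (fun w hw => by
          rw [fderivWithin_of_isOpen Metric.isOpen_ball hw, (hd w hw).fderiv])
        hw (Metric.mem_ball_self hρ)
    filter_upwards [e.open_source.mem_nhds hx,
      (e.continuousAt hx).preimage_mem_nhds (Metric.ball_mem_nhds (e x) hρ)] with y hy hyb
    have := hconst (e y) hyb
    simp only [hf] at this
    rwa [readParam_apply ψ hy, readParam_apply ψ hx] at this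
  exact hloc.apply_eq_of_preconnectedSpace x y

/-- On the hyperboloid the time coordinate is never zero; on a connected surface it keeps its sign.
-/
theorem mem_hypPlane_of_solvesLinear [PreconnectedSpace S]
    (hψ : ∀ x, SolvesLinearAt j G x ψ) {x₀ : S} (h : (ψ x₀).1 ∈ hypPlane) (x : S) :
    (ψ x).1 ∈ hypPlane := by
  have hunit : ∀ x, lorentz3 (ψ x).1 (ψ x).1 = -1 := fun x =>
    (lorentz3_self_of_solvesLinear hψ x x₀).trans h.1
  have hne : ∀ x, (ψ x).1 0 ≠ 0 := by
    intro x h0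
    have h1 := hunit x
    simp only [lorentz3, h0] at h1
    nlinarith [sq_nonneg ((ψ x).1 1), sq_nonneg ((ψ x).1 2)]
  have hc : Continuous fun x => (ψ x).1 0 :=
    (continuous_apply 0).comp (continuous_fst.comp (continuous_of_solvesLinear hψ))
  refine ⟨hunit x, ?_⟩
  by_contra hx
  obtain ⟨y, hy⟩ := mem_range_of_exists_le_of_exists_ge hc ⟨x, not_lt.1 hx⟩ ⟨x₀, h.2.le⟩
  exact hne y hy

theorem isLocalSurface_of_solvesLinear (hG : IsHarmonicMap G) (hj : j ^ 2 = -1)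
    (hjc : conj j = -j)
    (hA : ∀ e ∈ conformalParams S, ∀ w ∈ e.target, 0 < isoNorm j (readParam e G) w)
    (hψ : ∀ x, SolvesLinearAt j G x ψ) (hmem : ∀ x, (ψ x).1 ∈ hypPlane)
    (he : e ∈ conformalParams S) :
    IsLocalSurface j e.target (readParam e G) (readParam e ψ) where
  isLocalHarmonic := hG.isLocalHarmonic he
  sq_eq := hj
  conj_eq := hjc
  isoNorm_pos := hA e he
  hasFDerivAt _ hw := SolvesLinearAt.hasFDerivAt hψ he hw
  mem_hypPlane _ _ := hmem _
  gauss_mem_hypPlane _ _ := hG.mem_hypPlane _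

/-- The unit normal of the surface `ψ` with hyperbolic Gauss map `G`. -/
def surfaceNormal (G : S → Fin 3 → ℝ) (ψ : S → Mink4) (x : S) : Mink4 :=
  (fun i => (-lorentz3 (ψ x).1 (G x))⁻¹ * G x i - (ψ x).1 i, (-lorentz3 (ψ x).1 (G x))⁻¹)

omit [ChartedSpace ℂ S] [IsManifold (modelWithCornersSelf ℂ ℂ) ω S] in
theorem readParam_surfaceNormal (e : OpenPartialHomeomorph S ℂ) (G : S → Fin 3 → ℝ)
    (ψ : S → Mink4) :
    readParam e (surfaceNormal G ψ) = gaussNormal (readParam e G) (readParam e ψ) := rfl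

omit [ChartedSpace ℂ S] [IsManifold (modelWithCornersSelf ℂ ℂ) ω S] in
theorem conformalFactor_of_isLocalSurface {w : ℂ} (hw : w ∈ e.target)
    (hS : IsLocalSurface j e.target (readParam e G) (readParam e ψ)) :
    conformalFactor e ψ w
      = 8 * invAngle (readParam e G) (readParam e ψ) w ^ 2 * isoNorm j (readParam e G) w := by
  rw [conformalFactor_eq (hS.differentiableAt hw) (hS.pairDz_self hw), hS.pairDzbar_self hw,
    Complex.ofReal_re]
  ring

theorem isSurfaceWithNormal_of_isLocalSurface
    (hS : ∀ e ∈ conformalParams S, IsLocalSurface j e.target (readParam e G) (readParam e ψ)) :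
    IsSurfaceWithNormal ψ (surfaceNormal G ψ) where
  smooth := contMDiff_iff_readParam.2 fun e he => (hS e he).contDiffOn
  mem_hypPlane x := by
    have hx := mem_chart_source ℂ x
    have := (hS _ (chartAt_mem_conformalParams x)).mem_hypPlane _ (mem_chart_target ℂ x)
    rwa [readParam_apply ψ hx] at this
  factor_pos e he w hw := by
    rw [conformalFactor_of_isLocalSurface hw (hS e he)]
    have h1 := (hS e he).invAngle_pos hw
    have h2 := (hS e he).isoNorm_pos w hw
    positivity
  conformal e he w hw v := by
    rw [firstForm_eq ((hS e he).differentiableAt hw) ((hS e he).pairDz_self hw),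
      conformalFactor_eq ((hS e he).differentiableAt hw) ((hS e he).pairDz_self hw),
      Complex.mul_conj', ← Complex.ofReal_pow, Complex.ofReal_re]
  regular_projection x := by
    have hx := mem_chart_source ℂ x
    have hw := mem_chart_target ℂ x
    have h := hS _ (chartAt_mem_conformalParams x)
    exact (isRegularPt_iff (f := fun y => (ψ y).1) (chartAt_mem_conformalParams x) hx
      (h.hasFDerivAt _ hw).fst.differentiableAt).2 (h.injective_fderiv_fst hw)
  normal_smooth := contMDiff_iff_readParam.2 fun e he => (hS e he).contDiffOn_gaussNormal
  normal_unit x := by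
    have hx := mem_chart_source ℂ x
    have := (hS _ (chartAt_mem_conformalParams x)).lorentz4_gaussNormal (mem_chart_target ℂ x)
    rwa [← readParam_surfaceNormal, readParam_apply _ hx] at this
  normal_tangent_ambient x := by
    have hx := mem_chart_source ℂ x
    have := (hS _ (chartAt_mem_conformalParams x)).lorentz4_gaussNormal_fst (mem_chart_target ℂ x)
    rwa [← readParam_surfaceNormal, readParam_apply _ hx, readParam_apply ψ hx] at this
  normal_orth e he w hw v := (hS e he).lorentz4_gaussNormal_fderiv hw v
  angle_pos x := by
    have hx := mem_chart_source ℂ x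
    have := (hS _ (chartAt_mem_conformalParams x)).invAngle_pos (mem_chart_target ℂ x)
    rw [invAngle, readParam_apply ψ hx, readParam_apply G hx] at this
    exact inv_pos.2 this

theorem isPrescribedSurface_of_isLocalSurface
    (hS : ∀ e ∈ conformalParams S, IsLocalSurface j e.target (readParam e G) (readParam e ψ))
    (hA : ∀ e ∈ conformalParams S, ∀ w ∈ e.target, isoNorm j (readParam e G) w = τ e w / 4)
    {e₀ : OpenPartialHomeomorph S ℂ} {z₀ : S} {ϑ₀ : ℂ}
    (h₀ : dz (inParam e₀ fun x => (ψ x).2) (e₀ z₀) = ϑ₀) :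
    IsPrescribedSurface G τ e₀ z₀ ϑ₀ ψ := by
  have hN := isSurfaceWithNormal_of_isLocalSurface hS
  refine ⟨surfaceNormal G ψ, hN, ?_, ?_, ?_, h₀⟩
  · intro e he w hw
    have h := hS e he
    have h1 := h.invAngle_pos hw
    have h2 := h.isoNorm_pos w hw
    have hd : DifferentiableAt ℝ (readParam e (surfaceNormal G ψ)) w :=
      h.contDiffOn_gaussNormal.differentiableAt_of_isOpen h.isLocalHarmonic.isOpen hw
    rw [meanCurvature_eq (h.differentiableAt hw) hd
      (h.pairDz_self hw) (by rw [h.pairDzbar_self hw, Complex.ofReal_re]; positivity),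
      h.pairDzbar_self hw, readParam_surfaceNormal, h.pairDzbar_gaussNormal hw, Complex.ofReal_re,
      Complex.ofReal_re]
    field_simp
    norm_num
  · intro x
    have h1 := hN.angle_pos x
    simp only [surfaceNormal] at h1 ⊢
    have h2 := (inv_pos.1 h1).ne'
    generalize -lorentz3 (ψ x).1 (G x) = s at h2
    refine Prod.ext (funext fun i => ?_) ?_
    · simp only [Prod.smul_mk, Pi.smul_apply, Pi.add_apply, smul_eq_mul, Prod.mk_add_mk]
      field_simp
      ring
    · simp only [Prod.smul_mk, Prod.mk_add_mk, smul_eq_mul, add_zero]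
      field_simp
  · intro e he w hw
    have h1 := (hS e he).invAngle_pos hw
    rw [conformalFactor_of_isLocalSurface hw (hS e he), hA e he w hw]
    have e1 : (surfaceNormal G ψ (e.symm w)).2 = (invAngle (readParam e G) (readParam e ψ) w)⁻¹ :=
      rfl
    rw [e1]
    field_simp
    ring

theorem sqrt_div_eq {t A x : ℝ} (hA : 0 < A) (ht : t = 4 * A) :
    (t + 2 * x) / t = 1 + x / (2 * A) := by
  rw [ht]; field_simp; ring

theorem half_sqrt_mul_eq {t A x : ℝ} (hA : 0 < A) (ht : t = 4 * A) :
    1 / 2 * Real.sqrt (t * (t + 2 * x)) = 2 * A * Real.sqrt (1 + x / (2 * A)) := by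
  have h1 : t * (t + 2 * x) = t ^ 2 * (1 + x / (2 * A)) := by
    rw [ht]; field_simp; ring
  rw [h1, Real.sqrt_mul (sq_nonneg t), Real.sqrt_sq (by rw [ht]; positivity), ht]
  ring

theorem dz_log_eq {Ω : Set ℂ} {g : ℂ → Fin 3 → ℝ} {t : ℂ → ℝ} {w : ℂ}
    (h : IsLocalWeierstrass Ω g t) (hw : w ∈ Ω) (hA : ∀ w ∈ Ω, isoNorm j g w = t w / 4) :
    dz (fun y => (Real.log (t y) : ℂ)) w
      = dz (fun y => (isoNorm j g y : ℂ)) w / isoNorm j g w := by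
  have ht := (h.pos w hw).ne'
  have hd := h.smooth.differentiableAt_of_isOpen h.isLocalHarmonic.isOpen hw
  have e1 : (fun y => (isoNorm j g y : ℂ)) =ᶠ[𝓝 w] fun y => (1 / 4 : ℂ) * (t y : ℂ) := by
    filter_upwards [h.isLocalHarmonic.isOpen.mem_nhds hw] with y hy
    rw [hA y hy]; push_cast; ring
  rw [dz_congr e1, dz_const_mul _ (differentiableAt_ofReal hd), hA w hw,
    dz_ofReal_comp hd (Real.hasDerivAt_log ht)]
  have ht' := Complex.ofReal_ne_zero.2 ht
  push_cast
  field_simp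

theorem solvesHeightSystem_of_isLocalSurface (hG : IsHarmonicMap G)
    (hW : IsWeierstrassData G (fun e w => -Q e w) (fun e w => 2 * τ e w))
    (hS : ∀ e ∈ conformalParams S, IsLocalSurface j e.target (readParam e G) (readParam e ψ))
    (hA : ∀ e ∈ conformalParams S, ∀ w ∈ e.target, isoNorm j (readParam e G) w = τ e w / 4) :
    SolvesHeightSystem Q τ fun x => (ψ x).2 where
  contMDiff := (contMDiff_iff_readParam (n := 2)).2 fun e he =>
    (hS e he).contDiffOn.snd.of_le ENat.LEInfty.out
  eq_zz e he w hw := by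
    have h := hS e he
    have hq : -Q e w = lorentz3 (vdz (fun y => ofRealVec (readParam e G y)) w)
      (vdz (fun y => ofRealVec (readParam e G y)) w) := hW.hopf e he w hw
    have h1 := h.dz_dz_height hw
    have ht : τ e w = 4 * isoNorm j (readParam e G) w := by rw [hA e he w hw]; ring
    rw [← hq, h.invAngle_eq_sqrt hw] at h1
    rw [sqrt_div_eq (h.isoNorm_pos w hw) ht, dz_log_eq (hW.isLocalWeierstrass hG he) hw (hA e he)]
    refine h1.trans ?_
    rw [neg_mul, sub_neg_eq_add]
    rfl
  eq_zzbar e he w hw := by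
    have h := hS e he
    have h1 := h.dzbar_dz_height hw
    have ht : τ e w = 4 * isoNorm j (readParam e G) w := by rw [hA e he w hw]; ring
    rw [h.invAngle_eq_sqrt hw] at h1
    rw [half_sqrt_mul_eq (h.isoNorm_pos w hw) ht]
    exact h1

/-- Under a change of parameter, `p` and `P` scale by the same factor `c` and `A` by `|c|²`, so
these factors cancel. -/
theorem recon_transition (hG : IsHarmonicMap G) {e' : OpenPartialHomeomorph S ℂ}
    (he : e ∈ conformalParams S) (he' : e' ∈ conformalParams S) {x : S} (hx : x ∈ e.source)
    (hx' : x ∈ e'.source) (p : ℂ) :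
    recon j (readParam e G) (p * transitionDeriv e e' x) (e x)
      = recon j (readParam e' G) p (e' x) := by
  have hc := norm_ne_zero_iff.2 (transitionDeriv_ne_zero he he' hx hx')
  ext i
  rw [recon, recon, hG.isoNorm_transition he he' hx hx', hG.isoPart_transition he he' hx hx',
    readParam_apply G hx, readParam_apply G hx', norm_mul, mul_pow]
  set c := transitionDeriv e e' x
  have h1 : ‖p‖ ^ 2 * ‖c‖ ^ 2 / (2 * (isoNorm j (readParam e' G) (e' x) * ‖c‖ ^ 2))
      = ‖p‖ ^ 2 / (2 * isoNorm j (readParam e' G) (e' x)) := by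
    rw [← mul_assoc, mul_div_mul_right _ _ (pow_ne_zero 2 hc)]
  have h2 : conj (p * c) * (c • isoPart j (readParam e' G) (e' x)) i
      = ((‖c‖ ^ 2 : ℝ) : ℂ) * (conj p * isoPart j (readParam e' G) (e' x) i) := by
    rw [Complex.ofReal_pow, ← Complex.mul_conj', map_mul, Pi.smul_apply, smul_eq_mul]
    ring
  rw [h1, h2, Complex.re_ofReal_mul, mul_comm (‖c‖ ^ 2) (Complex.re _),
    mul_div_mul_right _ _ (pow_ne_zero 2 hc)]

/-- The projection is rebuilt from `h_z` chart by chart. Independence of the chart makes it a global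
map, to which the local statement applies in every parameter. -/
theorem exists_solvesLinear_of_solvesHeightSystem (hG : IsHarmonicMap G)
    (hW : IsWeierstrassData G (fun e w => -Q e w) (fun e w => 2 * τ e w)) (hj : j ^ 2 = -1)
    (hjc : conj j = -j)
    (hA : ∀ e ∈ conformalParams S, ∀ w ∈ e.target, isoNorm j (readParam e G) w = τ e w / 4)
    {f : S → ℝ} (hf : SolvesHeightSystem Q τ f) :
    ∃ φ : S → Mink4, (∀ x, (φ x).2 = f x) ∧ (∀ e ∈ conformalParams S, ∀ x ∈ e.source,
      (φ x).1 = recon j (readParam e G) (dz (inParam e f) (e x)) (e x)) ∧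
      ∀ x, SolvesLinearAt j G x φ := by
  set φ : S → Mink4 := fun x => (recon j (readParam (chartAt ℂ x) G)
    (dz (inParam (chartAt ℂ x) f) (chartAt ℂ x x)) (chartAt ℂ x x), f x) with hφ
  have hfd : ∀ e ∈ conformalParams S, ContDiffOn ℝ 2 (readParam e f) e.target :=
    (contMDiff_iff_readParam (n := 2)).1 hf.contMDiff
  have hinv : ∀ e ∈ conformalParams S, ∀ x ∈ e.source,
      (φ x).1 = recon j (readParam e G) (dz (inParam e f) (e x)) (e x) := by
    intro e he x hx
    have hc := chartAt_mem_conformalParams x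
    have hxc := mem_chart_source ℂ x
    have hd : DifferentiableAt ℝ (readParam e fun x => (f x : ℂ)) (e x) :=
      differentiableAt_ofReal (f := readParam e f) (((hfd e he).contDiffAt
        (e.open_target.mem_nhds (e.map_source hx))).differentiableAt (by norm_num))
    have h1 : dz (inParam (chartAt ℂ x) f) (chartAt ℂ x x)
        = dz (inParam e f) (e x) * transitionDeriv (chartAt ℂ x) e x :=
      dz_readParam_transition (f := fun x => (f x : ℂ)) hc he hxc hx hd
    simp only [hφ]
    rw [h1, recon_transition hG hc he hxc hx]
  refine ⟨φ, fun _ => rfl, hinv, solvesLinearAt_of_forall fun e he w hw => ?_⟩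
  have hL := hW.isLocalWeierstrass hG he
  have hpos : ∀ w ∈ e.target, 0 < isoNorm j (readParam e G) w := fun w hw => by
    rw [hA e he w hw]; have := hL.pos w hw; positivity
  have hq : -Q e w = lorentz3 (vdz (fun y => ofRealVec (readParam e G y)) w)
    (vdz (fun y => ofRealVec (readParam e G y)) w) := hW.hopf e he w hw
  have ht : τ e w = 4 * isoNorm j (readParam e G) w := by rw [hA e he w hw]; ring
  have hev : ∀ w ∈ e.target, readParam e φ w = (recon j (readParam e G)
      (dz (fun y => ((readParam e f y : ℝ) : ℂ)) w) w, readParam e f w) := by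
    intro w hw
    refine Prod.ext ?_ rfl
    have := hinv e he (e.symm w) (e.map_target hw)
    rw [e.right_inv hw] at this
    exact this
  rw [hev w hw]
  refine (hL.isLocalHarmonic.hasFDerivAt_theta_of_height hj hjc hw hpos
    ((hfd e he).contDiffAt (e.open_target.mem_nhds hw)) ?_ ?_).congr_of_eventuallyEq ?_
  · have h1 := hf.eq_zz e he w hw
    rw [sqrt_div_eq (hpos w hw) ht, dz_log_eq hL hw (hA e he)] at h1
    refine h1.trans ?_
    rw [← hq, neg_mul, sub_neg_eq_add]
    rfl
  · have h1 := hf.eq_zzbar e he w hw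
    rw [half_sqrt_mul_eq (hpos w hw) ht] at h1
    exact h1
  · filter_upwards [e.open_target.mem_nhds hw] with y hy
    exact hev y hy

/-- The Gauss map equation gives `η = u (G, 1) - (N, 0)`, and `⟨η, η⟩ = 1` forces `u = -1/⟨N, G⟩`.
The normal is thus determined by `N` and `G`, and the condition on `τ` fixes the conformal factor.
-/
theorem isLocalPrescribed_of_isPrescribedSurface (hG : IsHarmonicMap G) (hj : j ^ 2 = -1)
    (hjc : conj j = -j)
    (hpos : ∀ e ∈ conformalParams S, ∀ w ∈ e.target, 0 < isoNorm j (readParam e G) w)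
    (hA : ∀ e ∈ conformalParams S, ∀ w ∈ e.target, isoNorm j (readParam e G) w = τ e w / 4)
    {e₀ : OpenPartialHomeomorph S ℂ} {z₀ : S} {ϑ₀ : ℂ}
    (h : IsPrescribedSurface G τ e₀ z₀ ϑ₀ ψ) (he : e ∈ conformalParams S) :
    IsLocalPrescribed j e.target (readParam e G) (readParam e ψ) := by
  obtain ⟨η, hN, hH, hGm, hτ, -⟩ := h
  have hη1 : ∀ x i, (η x).1 i = (η x).2 * G x i - (ψ x).1 i := by
    intro x i
    have h1 := congrFun (congrArg Prod.fst (hGm x)) i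
    have h2 := (hN.angle_pos x).ne'
    simp only [Prod.smul_fst, Prod.fst_add, Pi.smul_apply, Pi.add_apply, smul_eq_mul] at h1
    field_simp at h1
    linarith
  have hs : ∀ x, (η x).2 * -lorentz3 (ψ x).1 (G x) = 1 := by
    intro x
    have h1 := hN.normal_unit x
    have e1 : lorentz4 (η x) (η x) = (η x).2 ^ 2 * lorentz3 (G x) (G x)
        - 2 * (η x).2 * lorentz3 (ψ x).1 (G x) + lorentz3 (ψ x).1 (ψ x).1 + (η x).2 ^ 2 := by
      simp only [lorentz4, lorentz3, hη1]; ring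
    rw [e1, (hG.mem_hypPlane x).1, (hN.mem_hypPlane x).1] at h1
    linarith
  have hη2 : ∀ x, (η x).2 = (-lorentz3 (ψ x).1 (G x))⁻¹ := fun x =>
    eq_inv_of_mul_eq_one_left (hs x)
  have hη : η = surfaceNormal G ψ := by
    ext x i
    · rw [hη1, hη2]; rfl
    · rw [hη2]; rfl
  have hη' : readParam e η = gaussNormal (readParam e G) (readParam e ψ) := by
    rw [hη, readParam_surfaceNormal]
  have hsm : ContDiffOn ℝ ∞ (readParam e ψ) e.target := contMDiff_iff_readParam.1 hN.smooth e he
  have hηsm : ContDiffOn ℝ ∞ (readParam e η) e.target :=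
    contMDiff_iff_readParam.1 hN.normal_smooth e he
  have hfac : ∀ w ∈ e.target, conformalFactor e ψ w
      = 8 * isoNorm j (readParam e G) w * invAngle (readParam e G) (readParam e ψ) w ^ 2 := by
    intro w hw
    have h1 := hτ e he w hw
    have h2 : (η (e.symm w)).2 * invAngle (readParam e G) (readParam e ψ) w = 1 := hs _
    rw [hA e he w hw, h1]
    linear_combination (-(conformalFactor e ψ w) * ((η (e.symm w)).2
      * invAngle (readParam e G) (readParam e ψ) w + 1)) * h2
  have hconf : ∀ w ∈ e.target, ∀ v, lorentz4 (fderiv ℝ (readParam e ψ) w v)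
      (fderiv ℝ (readParam e ψ) w v) = 8 * isoNorm j (readParam e G) w
        * invAngle (readParam e G) (readParam e ψ) w ^ 2 * ‖v‖ ^ 2 := by
    intro w hw v
    rw [← hfac w hw]
    exact hN.conformal e he w hw v
  refine ⟨hG.isLocalHarmonic he, hj, hjc, hpos e he, hsm, fun _ _ => hN.mem_hypPlane _,
    fun _ _ => hG.mem_hypPlane _, hconf, ?_, ?_⟩
  · intro w hw v
    rw [← hη']
    exact hN.normal_orth e he w hw v
  · intro w hw
    have hd := hsm.differentiableAt_of_isOpen e.open_target hw
    obtain ⟨c1, c2⟩ := pairDz_eq_zero_of_conformal hd (hconf w hw)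
    have hf := hN.factor_pos e he w hw
    rw [hfac w hw] at hf
    have h1 := hH e he w hw
    rw [meanCurvature_eq hd (hηsm.differentiableAt_of_isOpen e.open_target hw) c1
      (by rw [c2, Complex.ofReal_re]; positivity), c2, Complex.ofReal_re, hη',
      div_eq_div_iff (by positivity) two_ne_zero] at h1
    linarith

end GlobalSurface

end

/-! ### The quotient formula and the main theorem -/

theorem eq_representedProjection {S : Type*} [TopologicalSpace S] [ChartedSpace ℂ S]
    [IsManifold (modelWithCornersSelf ℂ ℂ) ω S] {G : S → Fin 3 → ℝ}
    {Q : OpenPartialHomeomorph S ℂ → ℂ → ℂ} {τ : OpenPartialHomeomorph S ℂ → ℂ → ℝ} {j : ℂ}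
    {ψ : S → Mink4} (hG : IsHarmonicMap G)
    (hW : IsWeierstrassData G (fun e w => -Q e w) (fun e w => 2 * τ e w))
    (hS : ∀ e ∈ conformalParams S, IsLocalSurface j e.target (readParam e G) (readParam e ψ))
    (hA : ∀ e ∈ conformalParams S, ∀ w ∈ e.target, isoNorm j (readParam e G) w = τ e w / 4)
    {e : OpenPartialHomeomorph S ℂ} (he : e ∈ conformalParams S) {x : S} (hx : x ∈ e.source)
    (hr : IsRegularPt G x) :
    τ e (e x) ^ 2 - 4 * ‖Q e (e x)‖ ^ 2 ≠ 0 ∧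
      (ψ x).1 = representedProjection G Q τ (fun y => (ψ y).2) e x := by
  have hw := e.map_source hx
  have hL := hW.isLocalWeierstrass hG he
  have h := hS e he
  have hpos := h.isoNorm_pos _ hw
  have hq : lorentz3 (vdz (fun y => ofRealVec (readParam e G y)) (e x))
    (vdz (fun y => ofRealVec (readParam e G y)) (e x)) = -Q e (e x) := (hW.hopf e he _ hw).symm
  have ht : τ e (e x) = 4 * isoNorm j (readParam e G) (e x) := by rw [hA e he _ hw]; ring
  have hr' : ∀ v : ℂ, fderiv ℝ (readParam e G) (e x) v = 0 → v = 0 := by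
    rwa [← isRegularPt_iff_of_isHarmonicMap hG he hw, e.left_inv hx]
  have hne := hL.norm_ne_of_regular hw hr'
  rw [hq, norm_neg] at hne
  have hne' : τ e (e x) ^ 2 - 4 * ‖Q e (e x)‖ ^ 2 ≠ 0 := by
    intro h0
    apply hne
    have h1 : (2 * ‖Q e (e x)‖) ^ 2 = τ e (e x) ^ 2 := by linear_combination -h0
    exact (pow_left_inj₀ (by positivity) (hL.pos _ hw).le (by norm_num)).1 h1
  refine ⟨hne', ?_⟩
  have h1 := h.fst_eq_recon hw
  rw [readParam_apply ψ hx] at h1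
  rw [h1]
  ext i
  have hne16 : 16 * isoNorm j (readParam e G) (e x) ^ 2 - 4 * ‖Q e (e x)‖ ^ 2 ≠ 0 := by
    rw [ht] at hne'
    convert hne' using 2
    ring
  rw [h.isLocalHarmonic.recon_eq_quotient h.sq_eq h.conj_eq hw hpos _ hq hne16 i,
    representedProjection, sqrt_div_eq hpos ht, ht, readParam_apply G hx]
  have e1 : dzbar (inParam e fun y => (ψ y).2) (e x)
      = (starRingEnd ℂ) (dz (inParam e fun y => (ψ y).2) (e x)) :=
    dzbar_ofReal (fun w => (ψ (e.symm w)).2) (e x)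
  have e2 : (4 * isoNorm j (readParam e G) (e x)) ^ 2
      = 16 * isoNorm j (readParam e G) (e x) ^ 2 := by ring
  rw [e1, e2]
  rfl

theorem mainTheorem1 {S : Type*} [TopologicalSpace S] [T2Space S] [ChartedSpace ℂ S]
    [IsManifold (modelWithCornersSelf ℂ ℂ) ω S] [SimplyConnectedSpace S] [NoncompactSpace S]
    (G : S → Fin 3 → ℝ) (hG : IsHarmonicMap G)
    (Q : OpenPartialHomeomorph S ℂ → ℂ → ℂ) (τ : OpenPartialHomeomorph S ℂ → ℂ → ℝ)
    (hW : IsWeierstrassData G (fun e w => -Q e w) (fun e w => 2 * τ e w))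
    (hsing : interior {x : S | ¬ IsRegularPt G x} = ∅)
    (z₀ : S) (hz₀ : IsRegularPt G z₀)
    (e₀ : OpenPartialHomeomorph S ℂ) (he₀ : e₀ ∈ conformalParams S) (hz₀e₀ : z₀ ∈ e₀.source)
    (ϑ₀ : ℂ) :
    ∃ ψ : S → Mink4,
      -- existence
      IsPrescribedSurface G τ e₀ z₀ ϑ₀ ψ ∧
      -- uniqueness up to vertical translations
      (∀ ψ' : S → Mink4, IsPrescribedSurface G τ e₀ z₀ ϑ₀ ψ' →
        ∃ c : ℝ, ∀ x, ψ' x = ((ψ x).1, (ψ x).2 + c)) ∧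
      -- the height function is the unique solution, up to constants, of the system
      SolvesHeightSystem Q τ (fun x => (ψ x).2) ∧
      (∀ h' : S → ℝ, SolvesHeightSystem Q τ h' → dz (inParam e₀ h') (e₀ z₀) = ϑ₀ →
        ∃ c : ℝ, ∀ x, h' x = (ψ x).2 + c) ∧
      -- the explicit formula, at the regular points of the harmonic map and, by continuous
      -- extension, at all points
      (∀ e ∈ conformalParams S, ∀ x ∈ e.source,
        (IsRegularPt G x →
          τ e (e x) ^ 2 - 4 * ‖Q e (e x)‖ ^ 2 ≠ 0 ∧
          (ψ x).1 = representedProjection G Q τ (fun y => (ψ y).2) e x) ∧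
        (𝓝[{y | IsRegularPt G y}] x).NeBot ∧
        Tendsto (representedProjection G Q τ (fun y => (ψ y).2) e)
          (𝓝[{y | IsRegularPt G y}] x) (𝓝 (ψ x).1)) := by
  obtain ⟨j, hj, hjc, hA⟩ := exists_isoNorm_eq hG hW hsing hz₀
  have hpos : ∀ e ∈ conformalParams S, ∀ w ∈ e.target, 0 < isoNorm j (readParam e G) w :=
    fun e he w hw => by
      rw [hA e he w hw]
      exact div_pos ((hW.isLocalWeierstrass hG he).pos w hw) four_pos
  have hne : ∀ e ∈ conformalParams S, ∀ w ∈ e.target, isoNorm j (readParam e G) w ≠ 0 :=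
    fun e he w hw => (hpos e he w hw).ne'
  have hw₀ := e₀.map_source hz₀e₀
  -- The initial point of ℍ² is the one reconstructed from `ϑ₀`, so that `h_z(z₀) = 2⟨N, P⟩ = ϑ₀`.
  -- The initial height is arbitrary.
  obtain ⟨ψ, hψ₀, hψ⟩ := exists_solvesLinear hG hj hjc hne z₀
    (recon j (readParam e₀ G) ϑ₀ (e₀ z₀), 0)
  have hL₀ := hG.isLocalHarmonic he₀
  have hmem : ∀ x, (ψ x).1 ∈ hypPlane := mem_hypPlane_of_solvesLinear hψ (x₀ := z₀) (by
    rw [hψ₀]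
    exact hL₀.recon_mem_hypPlane hj hw₀ (hpos e₀ he₀ _ hw₀) (hG.mem_hypPlane _) ϑ₀)
  have hS : ∀ e ∈ conformalParams S, IsLocalSurface j e.target (readParam e G) (readParam e ψ) :=
    fun e he => isLocalSurface_of_solvesLinear hG hj hjc hpos hψ hmem he
  have hdz : dz (inParam e₀ fun x => (ψ x).2) (e₀ z₀) = ϑ₀ := by
    refine ((hS e₀ he₀).dz_height hw₀).trans ?_
    rw [readParam_apply ψ hz₀e₀, hψ₀, hL₀.lorentz3_recon_isoPart hj hw₀ (hne e₀ he₀ _ hw₀)]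
    ring
  refine ⟨ψ, isPrescribedSurface_of_isLocalSurface hS hA hdz, ?_,
    solvesHeightSystem_of_isLocalSurface hG hW hS hA, ?_, ?_⟩
  · intro ψ' hψ'
    -- Density of the regular points supplies the points with `|q| ≠ 2A`, at which a competing
    -- surface is forced into the linear system.
    have hS' : ∀ e ∈ conformalParams S,
        IsLocalSurface j e.target (readParam e G) (readParam e ψ') := fun e he =>
      (isLocalPrescribed_of_isPrescribedSurface hG hj hjc hpos hA hψ' he).isLocalSurface
        fun w hw => ((frequently_regular_param hG hsing he hw).and_eventually
          (e.open_target.mem_nhds hw)).mono fun y hy => by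
            have h1 := (hW.isLocalWeierstrass hG he).norm_ne_of_regular hy.2 hy.1
            rw [hA e he y hy.2]
            intro h2
            apply h1
            rw [h2]
            ring
    -- Both projections at `z₀` are reconstructed from the same `ϑ₀`, so the two solutions start at
    -- the same point of ℍ².
    refine exists_translate_of_solvesLinear hG hj hjc hne hψ
      (solvesLinearAt_of_forall fun e he w hw => (hS' e he).hasFDerivAt w hw) (x₀ := z₀) ?_
    obtain ⟨-, -, -, -, -, hdz'⟩ := hψ'
    have h1 := (hS' e₀ he₀).fst_eq_recon hw₀
    rw [readParam_apply ψ' hz₀e₀] at h1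
    rw [h1, hψ₀]
    exact congrArg (fun p => recon j (readParam e₀ G) p (e₀ z₀)) hdz'
  · intro h' hh' hdz'
    obtain ⟨φ, hφ2, hφ1, hφ⟩ := exists_solvesLinear_of_solvesHeightSystem hG hW hj hjc hA hh'
    obtain ⟨c, hc⟩ := exists_translate_of_solvesLinear hG hj hjc hne hψ hφ (x₀ := z₀) (by
      rw [hφ1 e₀ he₀ z₀ hz₀e₀, hψ₀, hdz'])
    refine ⟨c, fun x => ?_⟩
    rw [← hφ2, hc]
  · intro e he x hx
    have hrep := fun (y : S) (hy : y ∈ e.source) => eq_representedProjection hG hW hS hA he hy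
    refine ⟨hrep x hx, ?_, ?_⟩
    · rw [← mem_closure_iff_nhdsWithin_neBot, mem_closure_iff_frequently]
      exact frequently_isRegularPt hsing x
    · have hcont : Tendsto (fun y => (ψ y).1) (𝓝[{y | IsRegularPt G y}] x) (𝓝 (ψ x).1) :=
        ((continuous_fst.comp (continuous_of_solvesLinear hψ)).tendsto x).mono_left
          nhdsWithin_le_nhds
      refine hcont.congr' ?_
      filter_upwards [self_mem_nhdsWithin,
        mem_nhdsWithin_of_mem_nhds (e.open_source.mem_nhds hx)] with y hy hye
      exact (hrep y hye hy).2
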